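/- **Setting.** For positive integers $A,H$, an MDP has a finite state space $\mathcal S=\bigcup_{h=0}^{H}\mathcal S_h$ (pairwise disjoint stages, $\mathcal S_H=\{\bot\}$), actions $[A]$, and for every $(s,a)$ a joint law $Q(\cdot|s,a)$ of a reward and a next state, supported on $[0,1]\times(\{\bot\}\cup\mathcal S_{h+1})$ for $s\in\mathcal S_h$, $h<H$, and on $\{(0,\bot)\}$ for $s=\bot$. The initial states are those of $\mathcal S_0$; $v^\star(s)$ and $q^\star(s,a)$ are the suprema, over history-dependent randomized policies, of the expected total reward from $s$ (respectively, from $s$ with first action $a$). For $B>0$ and a positive integer $d$, consider the following classes, in which all feature vectors lie in the unit ball of $\mathbb R^d$. * $\mathcal M^{v^\star}_{B,d,H,A}$: MDPs with $\phi:\mathcal S\to\mathbb R^d$ such that for some $\theta^\star$ with $\|\theta^\star\|_2\le B$, $v^\star(s)=\langle\phi(s),\theta^\star\rangle$ for all $s\in\mathcal S$. * $\mathcal M^{q^\star}_{B,d,H,A}$: MDPs with $\phi:\mathcal S\times[A]\to\mathbb R^d$ such that for some $\theta^\star$ with $\|\theta^\star\|_2\le B$, $q^\star(s,a)=\langle\phi(s,a),\theta^\star\rangle$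 for all $(s,a)$; $\mathcal M^{\mathrm{Pdet}}$ is the class of MDPs with deterministic transitions (and possibly random rewards). * $\mathcal M^{v^\star/q^\star\,\mathrm{reach}}_{B,d,H,A}$: MDPs with two feature maps $\phi_v,\phi_q$ such that for some $\theta^\star$ with $\|\theta^\star\|_2\le B$, $v^\star(s)=\langle\phi_v(s),\theta^\star\rangle$ and $q^\star(s,a)=\langle\phi_q(s,a),\theta^\star\rangle$ for all actions $a$ and all states $s$ reachable from the initial states. A (randomized) local-access planner is called in each of the $H$ steps of an episode with the current state and its features. In each call it may query a simulator at pairs $(s,a)$ with $s$ a state that it has already encountered, receiving a reward and a next state drawn from $Q(\cdot|s,a)$ together with the features of that next state; it then returns an action, which is executed. It may keep information between calls. It is $\delta$-sound for a class if for every member and every initial state $s_0$ its expected total reward is at least $v^\star(s_0)-\delta$. Its query cost on an MDP is the worst case, over all calls that may occur, of the expected number of queries made in the call, and $\mathcal C^\star_{\mathrm{LA}}(\mathcal M,\delta)$ is the infimum over $\delta$-sound planners of the supremum over $\mathcal M$ of the query cost. **Theorem 2 (upper bound with local access).** For $\mathcal M\in\{\mathcal M^{v^\star}_{B,d,H,A},\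 \mathcal M^{q^\star}_{B,d,H,A}\cap\mathcal M^{\mathrm{Pdet}},\ \mathcal M^{v^\star/q^\star\,\mathrm{reach}}_{B,d,H,A}\}$, $$\mathcal C^\star_{\mathrm{LA}}(\mathcal M,\delta)=O\Big(\mathrm{poly}\big((dH/\delta)^A,\,B\big)\Big)$$ in the following sense. 1. For every positive integer $A$ there is a real polynomial $p$ in two variables such that $\mathcal C^\star_{\mathrm{LA}}(\mathcal M,\delta)\le p\big((dH/\delta)^A,B\big)$ for all three classes, all positive reals $\delta,B$ and all positive integers $d,H$. 2. There is one real polynomial $p$, independent also of $A$, such that the same bound holds for all three classes, all positive integers $A,d,H$, all $B>0$ and all $0<\delta\le 1$. -/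

import Mathlib

open MeasureTheory ProbabilityTheory Set
open scoped ENNReal

noncomputable section

/-! ### Fixed-horizon Markov decision processes -/

/-- A finite fixed-horizon Markov decision process with action set `Fin A` and horizon `H`.
The state space is an arbitrary finite set; its elements are named by natural numbers, and the
name `0` is reserved for the final absorbing state (written `⊥` in comments).  The states encode
the stage they belong to, and `Q s a` is the joint law of the reward and of the next state. -/
structure MDP (A H : ℕ) where
  states : Finset ℕ
  bot_mem : 0 ∈ states
  stage : states → ℕ
  stage_le : ∀ s, stage s ≤ H
  stage_eq_iff : ∀ s, stage s = H ↔ (s : ℕ) = 0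
  Q : states → Fin A → Measure (ℝ × states)
  prob : ∀ (s : states) (a : Fin A), IsProbabilityMeasure (Q s a)
  supp : ∀ (s : states) (a : Fin A), stage s < H → ∀ᵐ x ∂(Q s a),
    x.1 ∈ Icc (0 : ℝ) 1 ∧ ((x.2 : ℕ) = 0 ∨ stage x.2 = stage s + 1)
  supp_bot : ∀ (s : states) (a : Fin A), (s : ℕ) = 0 → ∀ᵐ x ∂(Q s a), x.1 = 0 ∧ (x.2 : ℕ) = 0

namespace MDP

variable {A H : ℕ} (M : MDP A H)

/-- The transition-reward kernel. -/
def kernel : Kernel (M.states × Fin A) (ℝ × M.states) :=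
  Kernel.ofFunOfCountable fun p => M.Q p.1 p.2

instance : IsMarkovKernel M.kernel := ⟨fun p => M.prob p.1 p.2⟩

/-- A history with `n` completed steps: the triplets (state, action, reward) of these steps,
followed by the present state. -/
abbrev Hist (n : ℕ) : Type := (Fin n → M.states × Fin A × ℝ) × M.states

/-- A (history-dependent, randomized) policy: stochastic kernels from histories to actions. -/
structure Policy where
  act : (n : ℕ) → Kernel (M.Hist n) (Fin A)
  markov : ∀ n, IsMarkovKernel (act n)

/-- The history after one more step, given the action, the reward and the next state. -/
def extend (n : ℕ) (x : M.Hist n × (Fin A × (ℝ × M.states))) : M.Hist (n + 1) :=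
  (Fin.snoc (α := fun _ => M.states × Fin A × ℝ) x.1.1 (x.1.2, x.2.1, x.2.2.1), x.2.2.2)

theorem measurable_extend (n : ℕ) : Measurable (M.extend n) := by
  unfold extend
  refine Measurable.prodMk ?_ (by fun_prop)
  refine measurable_pi_iff.2 fun i => ?_
  refine Fin.lastCases ?_ (fun j => ?_) i
  · simp only [Fin.snoc_last]
    fun_prop
  · simp only [Fin.snoc_castSucc]
    fun_prop

variable {M}

/-- One step of the process controlled by the policy `π`. -/
def Policy.stepKernel (π : M.Policy) (n : ℕ) : Kernel (M.Hist n) (M.Hist (n + 1)) :=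
  (Kernel.id ×ₖ ((π.act n) ⊗ₖ
    (M.kernel.comap (fun x : M.Hist n × Fin A => (x.1.2, x.2)) (by fun_prop)))).map (M.extend n)

instance (π : M.Policy) (n : ℕ) : IsMarkovKernel (π.stepKernel n) := by
  have := π.markov n
  unfold Policy.stepKernel
  exact Kernel.IsMarkovKernel.map _ (M.measurable_extend n)

/-- The law of the history after `n` steps when `π` is used from the state `s`. -/
def Policy.law (π : M.Policy) (s : M.states) : (n : ℕ) → Measure (M.Hist n)
  | 0 => Measure.dirac (Fin.elim0, s)
  | n + 1 => (Policy.law π s n).bind (π.stepKernel n)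

instance (π : M.Policy) (s : M.states) (n : ℕ) : IsProbabilityMeasure (π.law s n) := by
  induction n with
  | zero => unfold Policy.law; infer_instance
  | succ n ih => unfold Policy.law; infer_instance

/-- The value of a policy: the expected total reward.  From every state, `⊥` is reached after at
most `H` steps and no reward is incurred afterwards, so that the sum stops after `H` steps. -/
def Policy.value (π : M.Policy) (s : M.states) : ℝ :=
  ∫ x, ∑ i, (x.1 i).2.2 ∂(π.law s H)

/-- The policy that takes the action `a` in the first step and then behaves like `π`. -/
def Policy.fixFirst (π : M.Policy) (a : Fin A) : M.Policy where
  act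
    | 0 => Kernel.const _ (Measure.dirac a)
    | n + 1 => π.act (n + 1)
  markov
    | 0 => inferInstance
    | n + 1 => π.markov (n + 1)

variable (M)

/-- The optimal value function. -/
def vstar (s : M.states) : ℝ := ⨆ π : M.Policy, π.value s

/-- The optimal action-value function. -/
def qstar (s : M.states) (a : Fin A) : ℝ := ⨆ π : M.Policy, (π.fixFirst a).value s

/-- Some action leads from `s` to `s'` with positive probability. -/
def Leads (s s' : M.states) : Prop := ∃ a, M.Q s a {x | x.2 = s'} ≠ 0

/-- `s` is reachable from the initial states, which are all the states of stage `0`. -/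
def Reachable (s : M.states) : Prop :=
  ∃ s₀, M.stage s₀ = 0 ∧ Relation.ReflTransGen M.Leads s₀ s

/-- Deterministic transitions (the rewards may be random). -/
def DetTransitions : Prop := ∀ s a, ∃ s', ∀ᵐ x ∂(M.Q s a), x.2 = s'

end MDP

/-! ### Featurized MDPs and the classes considered -/

/-- An MDP together with a feature-map: the features of a state form an element of `F`. -/
structure FMDP (A H : ℕ) (F : Type) extends MDP A H where
  feat : states → F

/-- State features. -/
abbrev VFeat (d : ℕ) : Type := EuclideanSpace ℝ (Fin d)

/-- State-action features: a state comes with the features of all the actions. -/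
abbrev QFeat (A d : ℕ) : Type := Fin A → EuclideanSpace ℝ (Fin d)

/-- The class of `v⋆`-realizable featurized MDPs. -/
def classV (B : ℝ) (d H A : ℕ) : Set (FMDP A H (VFeat d)) :=
  {M | (∀ s, ‖M.feat s‖ ≤ 1) ∧
    ∃ θ : EuclideanSpace ℝ (Fin d), ‖θ‖ ≤ B ∧ ∀ s, M.vstar s = inner ℝ (M.feat s) θ}

/-- The class of `q⋆`-realizable featurized MDPs. -/
def classQ (B : ℝ) (d H A : ℕ) : Set (FMDP A H (QFeat A d)) :=
  {M | (∀ s a, ‖M.feat s a‖ ≤ 1) ∧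
    ∃ θ : EuclideanSpace ℝ (Fin d), ‖θ‖ ≤ B ∧ ∀ s a, M.qstar s a = inner ℝ (M.feat s a) θ}

/-- The class of reachable-`v⋆/q⋆`-realizable MDPs, with two feature-maps. -/
def classReach (B : ℝ) (d H A : ℕ) : Set (FMDP A H (VFeat d × QFeat A d)) :=
  {M | (∀ s, ‖(M.feat s).1‖ ≤ 1) ∧ (∀ s a, ‖(M.feat s).2 a‖ ≤ 1) ∧
    ∃ θ : EuclideanSpace ℝ (Fin d), ‖θ‖ ≤ B ∧ ∀ s, M.Reachable s →
      M.vstar s = inner ℝ (M.feat s).1 θ ∧ ∀ a, M.qstar s a = inner ℝ ((M.feat s).2 a) θ}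

/-- The class of featurized MDPs with deterministic transitions. -/
def classPdet (A H : ℕ) (F : Type) : Set (FMDP A H F) := {M | M.DetTransitions}

/-! ### Planners with local access -/

/-- What a planner is told: it is called with a state and its features, or its query is refused,
or its query is answered by a reward, a next state and the features of that state. -/
abbrev Percept (F : Type) : Type := (ℕ × F) ⊕ (Unit ⊕ (ℝ × ℕ × F))

/-- What a planner does next: it queries the simulator at a state and an action, or it stops
querying and returns an action. -/
inductive Decision (A : ℕ) where
  | query (s : ℕ) (a : Fin A)
  | ret (a : Fin A)

instance (A : ℕ) : MeasurableSpace (Decision A) := ⊤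

instance (A : ℕ) : DiscreteMeasurableSpace (Decision A) := ⟨fun _ => trivial⟩

instance (A : ℕ) : Countable (Decision A) := by
  let f : Decision A → (ℕ × Fin A) ⊕ Fin A := fun x => match x with
    | .query s a => .inl (s, a)
    | .ret a => .inr a
  refine Function.Injective.countable (f := f) ?_
  rintro (⟨s, a⟩ | a) (⟨s', a'⟩ | a') h <;> simp_all [f]

/-- A randomized planner, with a memory that it keeps during the whole episode.  A planner has no
access to the MDP except through percepts and decisions. -/
structure Planner (A : ℕ) (F : Type) [MeasurableSpace F] where
  Mem : Type
  instMem : MeasurableSpace Mem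
  init : Mem
  act : Kernel (Mem × Percept F) (Mem × Decision A)
  markov : IsMarkovKernel act

attribute [instance] Planner.instMem Planner.markov

/-- The status of an interaction: the number of calls that the planner has completed, the present
state of the process, the states that the planner has encountered, and whether the last decision
of the planner was a query. -/
structure Status {A H : ℕ} (M : MDP A H) where
  calls : ℕ
  cur : M.states
  seen : Finset M.states
  queried : Bool

instance {A H : ℕ} (M : MDP A H) : MeasurableSpace (Status M) := ⊤

instance {A H : ℕ} (M : MDP A H) : DiscreteMeasurableSpace (Status M) := ⟨fun _ => trivial⟩

instance {A H : ℕ} (M : MDP A H) : Countable (Status M) := by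
  refine Function.Injective.countable
    (f := fun x : Status M => (x.calls, x.cur, x.seen, x.queried)) ?_
  rintro ⟨_, _, _, _⟩ ⟨_, _, _, _⟩ h
  simp_all

section Interaction

variable {A H : ℕ} {F : Type} [MeasurableSpace F]

namespace FMDP

variable (M : FMDP A H F)

/-- The answer of the simulator to a query, and the new status. -/
def answer (σ : Status M.toMDP) (x : ℝ × M.states) : Percept F × (ℝ × Status M.toMDP) :=
  (.inr (.inr (x.1, (x.2 : ℕ), M.feat x.2)),
    (0, { σ with seen := insert x.2 σ.seen, queried := true }))

/-- The effect of an action taken in the MDP: a reward is incurred, and the planner is called with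
the next state. -/
def advance (σ : Status M.toMDP) (x : ℝ × M.states) : Percept F × (ℝ × Status M.toMDP) :=
  (.inl ((x.2 : ℕ), M.feat x.2),
    (x.1, { calls := σ.calls + 1, cur := x.2, seen := insert x.2 σ.seen, queried := false }))

theorem measurable_answer (σ : Status M.toMDP) : Measurable (M.answer σ) := by
  have h1 : Measurable fun s : M.states => M.feat s := measurable_of_countable _
  have h2 : Measurable fun s : M.states =>
      ({ σ with seen := insert s σ.seen, queried := true } : Status M.toMDP) :=
    measurable_of_countable _
  unfold answer
  refine Measurable.prodMk (measurable_inr.comp (measurable_inr.comp ?_)) ?_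
  · exact measurable_fst.prodMk
      ((measurable_subtype_coe.comp measurable_snd).prodMk (h1.comp measurable_snd))
  · exact measurable_const.prodMk (h2.comp measurable_snd)

theorem measurable_advance (σ : Status M.toMDP) : Measurable (M.advance σ) := by
  have h1 : Measurable fun s : M.states => M.feat s := measurable_of_countable _
  have h2 : Measurable fun s : M.states =>
      ({ calls := σ.calls + 1, cur := s, seen := insert s σ.seen, queried := false } :
        Status M.toMDP) :=
    measurable_of_countable _
  unfold advance
  refine Measurable.prodMk (measurable_inl.comp ?_) ?_
  · exact (measurable_subtype_coe.comp measurable_snd).prodMk (h1.comp measurable_snd)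
  · exact measurable_fst.prodMk (h2.comp measurable_snd)

open Classical in
/-- The reaction of the simulator and of the MDP to a decision of the planner: the law of the next
percept, of the reward incurred in the MDP, and of the next status.  A query is answered only at a
state that the planner has encountered (local access); otherwise it is refused, but still counts.
The episode is over when `H` actions have been returned. -/
def react (D : Decision A) (σ : Status M.toMDP) : Measure (Percept F × (ℝ × Status M.toMDP)) :=
  if H ≤ σ.calls then Measure.dirac (.inr (.inl ()), (0, { σ with queried := false }))
  else match D with
    | .query n a =>
      if h : ∃ s ∈ σ.seen, (s : ℕ) = n then (M.Q h.choose a).map (M.answer σ)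
      else Measure.dirac (.inr (.inl ()), (0, { σ with queried := true }))
    | .ret a => (M.Q σ.cur a).map (M.advance σ)

theorem isProbabilityMeasure_react (D : Decision A) (σ : Status M.toMDP) :
    IsProbabilityMeasure (M.react D σ) := by
  have := M.prob
  unfold react
  split_ifs
  · infer_instance
  · cases D with
    | query n a =>
      dsimp only
      split_ifs
      · exact Measure.isProbabilityMeasure_map (M.measurable_answer σ).aemeasurable
      · infer_instance
    | ret a => exact Measure.isProbabilityMeasure_map (M.measurable_advance σ).aemeasurable

/-- `react` as a kernel. -/
def reactKernel : Kernel (Decision A × Status M.toMDP) (Percept F × (ℝ × Status M.toMDP)) :=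
  Kernel.ofFunOfCountable fun p => M.react p.1 p.2

instance : IsMarkovKernel M.reactKernel := ⟨fun p => M.isProbabilityMeasure_react p.1 p.2⟩

end FMDP

namespace Planner

/-- A configuration of the interaction of a planner with an MDP: the memory of the planner, the
percept it has to process, the reward just incurred in the MDP, and the status. -/
abbrev Config (P : Planner A F) (M : FMDP A H F) : Type :=
  (P.Mem × Percept F) × (ℝ × Status M.toMDP)

variable (P : Planner A F) (M : FMDP A H F)

/-- One step of the interaction: one decision of the planner and the reaction to it. -/
def step : Kernel (P.Config M) (P.Config M) :=
  ((P.act.comap Prod.fst measurable_fst) ⊗ₖ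
    (M.reactKernel.comap
      (fun x : P.Config M × (P.Mem × Decision A) => (x.2.2, x.1.2.2)) (by fun_prop))).map
    (fun y => ((y.1.1, y.2.1), y.2.2))

instance : IsMarkovKernel (P.step M) := by
  unfold step
  exact Kernel.IsMarkovKernel.map _ (by fun_prop)

/-- `n` steps of the interaction. -/
def steps : ℕ → Kernel (P.Config M) (P.Config M)
  | 0 => Kernel.id
  | n + 1 => P.step M ∘ₖ steps n

/-- The first configuration of an episode: the planner is called with the initial state. -/
def start (s₀ : M.states) : P.Config M :=
  ((P.init, .inl ((s₀ : ℕ), M.feat s₀)),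
    (0, { calls := 0, cur := s₀, seen := {s₀}, queried := false }))

/-- The expected total reward incurred in an episode that starts in `s₀`, that is, the value of
the policy that the planner induces. -/
def value (s₀ : M.states) : ℝ≥0∞ :=
  ∑' n, ∫⁻ c, ENNReal.ofReal c.2.1 ∂(P.steps M n (P.start M s₀))

/-- The expected number of queries made, from the configuration `c` on, during the present call. -/
def callCost (c : P.Config M) : ℝ≥0∞ :=
  ∑' n, P.steps M n c {c' | c'.2.2.queried = true ∧ c'.2.2.calls = c.2.2.calls}

/-- The query cost: the worst case, over all the calls to the planner that can happen in an episode
(from any initial state, and up to events of probability zero), of the expected number of queries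
used in the call. -/
def queryCost : ℝ≥0∞ :=
  ⨆ s₀ : M.states, ⨆ _ : M.stage s₀ = 0, ⨆ n : ℕ,
    essSup (fun c => if c.1.2.isLeft then P.callCost M c else 0) (P.steps M n (P.start M s₀))

end Planner

/-- The planner `P` is `δ`-sound for the class `C`, under local access. -/
def SoundLA (P : Planner A F) (C : Set (FMDP A H F)) (δ : ℝ) : Prop :=
  ∀ M ∈ C, ∀ s₀ : M.states, M.stage s₀ = 0 → M.vstar s₀ - δ ≤ (P.value M s₀).toReal

/-- The minimax query cost of `δ`-sound planners for the class `C`, under local access. -/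
def queryComplexityLA (C : Set (FMDP A H F)) (δ : ℝ) : ℝ≥0∞ :=
  ⨅ P : Planner A F, ⨅ _ : SoundLA P C δ, ⨆ M ∈ C, P.queryCost M

end Interaction

end

/-! The planner rests on two ideas.

*Products of temporal differences.* Let a node be a state with an action, valued by the pairing of
its features with the unknown parameter `θ⋆`. The Bellman equation says that at each node *some*
action has a vanishing temporal difference under `θ⋆`, without saying which one. Hence the product
of the temporal differences of all the actions vanishes. It is the pairing of a tensor, which can be
estimated by queries at one state, with the tensor power `θ⋆ ⊗ ⋯ ⊗ θ⋆`: a linear constraint in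
dimension `(d + 1) ^ A`. If only the `v⋆` are linear, the features of a node are those of its state,
and the temporal difference of `a'` is `r + v⋆(s') - v⋆(s)` for the query `(s, a')`. If the `q⋆` are
linear and transitions are deterministic, the temporal difference of `a'` at `(s, a)` is
`r + q⋆(s', a') - q⋆(s, a)` for the query `(s, a)`: as the next state `s'` is not random, the action
`a'` that is optimal at it does not depend on chance. In the third class, the features of the states
suffice. `Params.sel` expresses the difference between the two cases.

*Optimism.* The planner keeps a list of such tensors and takes a hypothesis `θ` that satisfies the
constraints and predicts the largest value at the initial state, so that the prediction is at least
the optimal value. It simulates an episode in which the action of smallest temporal difference under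
`θ` is taken at each node. If the products met are all small, the prediction of `θ` is nearly earned
(`Params.Realizes.le_playValue`); otherwise a new constraint is recorded that `θ` violates. Tensors
found in this way are eluder-independent: each one pairs significantly with a bounded tensor that
pairs negligibly with its predecessors. The determinant of their regularized Gram matrix therefore
at least doubles each time, whereas it is bounded polynomially in its trace, so that there are about
`(d + 1) ^ A` of them at most, up to logarithms (`Potential.Chain.length_lt`). Consequently most of
`K` simulated episodes earn nearly the optimal value (`Params.Realizes.le_totalPlay`), and a planner
that stops training after a uniformly random number of episodes `k < K`, and then follows its
hypothesis in the actual episode, is sound (`Params.strategy_sound`). A logarithmic dependence on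
the norms is essential here: it keeps `B` from being raised to a power that grows with `A`.

Two devices connect this with kernels and planners. Rewards and features are rounded, so that the
planner only sees a countable set of percepts, its measurability is automatic, and the expectations
of its programs are finite sums (`Sim`). Planners are interpreters of programs (`Strategy`), whose
value and query cost can be bounded by induction on programs (`Strategy.IsLowerValue.le_value`,
`Strategy.queryCost_le`).

The number of queries is polynomial in `(16 * U) ^ A` and `B`, where `U` is about `d * H / δ`. The
constant to the power `A` is absorbed by a power of `(d * H / δ) ^ A` if `d * H / δ ≥ 2`. The
remaining case with `δ ≤ 1` is that of `d = H = 1` and `δ > 1 / 2`; there it suffices to try a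
fraction `2 * (1 - δ)` of the actions, which is a number of order `(1 / δ) ^ A` by Bernoulli's
inequality. If `δ > 1` and `A` is fixed, then either `δ ≥ B`, and no query is needed, or passing to
`δ = 1` costs a factor `B` only. -/

noncomputable section

/-! ### Optimal values and the Bellman equation -/

namespace MDP

variable {A H : ℕ} (M : MDP A H)

mutual
/-- The optimal expected total reward over `k` steps, by backward induction. -/
def optVal : ℕ → M.states → ℝ≥0∞
  | 0, _ => 0
  | k + 1, s => ⨆ a, optAct k s a
/-- The optimal expected total reward over `k + 1` steps, when the first action is prescribed. -/
def optAct : ℕ → M.states → Fin A → ℝ≥0∞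
  | k, s, a => ∫⁻ x, (ENNReal.ofReal x.1 + optVal k x.2) ∂(M.Q s a)
end

theorem measurable_of_state {β : Type*} [MeasurableSpace β] (f : M.states → β) : Measurable f :=
  measurable_of_countable f

variable {M}

theorem ae_reward (s : M.states) (a : Fin A) : ∀ᵐ x ∂(M.Q s a), x.1 ∈ Icc (0 : ℝ) 1 := by
  rcases (M.stage_le s).lt_or_eq with h | h
  · filter_upwards [M.supp s a h] with x hx using hx.1
  · filter_upwards [M.supp_bot s a ((M.stage_eq_iff s).1 h)] with x hx
    simp [hx.1]

theorem ae_stage (s : M.states) (a : Fin A) :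
    ∀ᵐ x ∂(M.Q s a), min H (M.stage s + 1) ≤ M.stage x.2 := by
  rcases (M.stage_le s).lt_or_eq with h | h
  · filter_upwards [M.supp s a h] with x hx
    rcases hx.2 with h0 | h1
    · rw [(M.stage_eq_iff x.2).2 h0]; exact min_le_left _ _
    · rw [h1]; exact min_le_right _ _
  · filter_upwards [M.supp_bot s a ((M.stage_eq_iff s).1 h)] with x hx
    rw [(M.stage_eq_iff x.2).2 hx.2]; exact min_le_left _ _

theorem lintegral_stepKernel (π : M.Policy) (n : ℕ) (x : M.Hist n) {g : M.Hist (n + 1) → ℝ≥0∞}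
    (hg : Measurable g) :
    ∫⁻ y, g y ∂(π.stepKernel n x)
      = ∫⁻ a, ∫⁻ z, g (M.extend n (x, (a, z))) ∂(M.Q x.2 a) ∂(π.act n x) := by
  have := π.markov n
  have hge : Measurable fun y => g (M.extend n y) := hg.comp (M.measurable_extend n)
  unfold Policy.stepKernel
  rw [Kernel.lintegral_map _ (M.measurable_extend n) _ hg,
    Kernel.lintegral_prod _ _ _ hge, Kernel.lintegral_id, Kernel.lintegral_compProd]
  · rfl
  · exact hge.comp measurable_prodMk_left

/-- The total reward of a history, as an extended nonnegative real. -/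
def histReward (n : ℕ) (x : M.Hist n) : ℝ≥0∞ := ∑ i, ENNReal.ofReal (x.1 i).2.2

theorem measurable_histReward (n : ℕ) : Measurable (histReward (M := M) n) := by
  unfold histReward
  fun_prop

theorem histReward_extend (n : ℕ) (x : M.Hist n) (y : Fin A × (ℝ × M.states)) :
    histReward (n + 1) (M.extend n (x, y)) = histReward n x + ENNReal.ofReal y.2.1 := by
  simp [histReward, MDP.extend, Fin.sum_univ_castSucc]

/-- The expected reward of the first `n` steps under `π`, plus the optimal value of the remaining
`H - n` steps. -/
def Policy.hybrid (π : M.Policy) (s : M.states) (n : ℕ) : ℝ≥0∞ :=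
  ∫⁻ x, (histReward n x + optVal M (H - n) x.2) ∂(π.law s n)

theorem measurable_hybrid_integrand (n k : ℕ) :
    Measurable fun x : M.Hist n => histReward n x + optVal M k x.2 :=
  (measurable_histReward n).add ((M.measurable_of_state _).comp measurable_snd)

theorem Policy.hybrid_succ (π : M.Policy) (s : M.states) (n : ℕ) :
    π.hybrid s (n + 1) = ∫⁻ x, (histReward n x + ∫⁻ a, optAct M (H - (n + 1)) x.2 a ∂(π.act n x))
      ∂(π.law s n) := by
  have := π.markov n
  unfold Policy.hybrid
  rw [Policy.law, Measure.lintegral_bind (Kernel.aemeasurable _)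
    (measurable_hybrid_integrand _ _).aemeasurable]
  refine lintegral_congr fun x => ?_
  rw [lintegral_stepKernel _ _ _ (measurable_hybrid_integrand _ _)]
  have h1 : ∀ a, ∫⁻ z, (histReward (n + 1) (M.extend n (x, (a, z)))
      + optVal M (H - (n + 1)) (M.extend n (x, (a, z))).2) ∂(M.Q x.2 a)
      = histReward n x + optAct M (H - (n + 1)) x.2 a := by
    intro a
    have := M.prob x.2 a
    rw [optAct]
    simp only [histReward_extend, add_assoc]
    rw [lintegral_add_left measurable_const, lintegral_const, measure_univ, mul_one]
    rfl
  simp only [h1]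
  rw [lintegral_add_left measurable_const, lintegral_const, measure_univ, mul_one]

theorem Policy.hybrid_succ_le (π : M.Policy) (s : M.states) {n : ℕ} (hn : n < H) :
    π.hybrid s (n + 1) ≤ π.hybrid s n := by
  have := π.markov n
  rw [π.hybrid_succ s n, Policy.hybrid]
  refine lintegral_mono fun x => add_le_add le_rfl ?_
  obtain ⟨k, hk⟩ : ∃ k, H - n = k + 1 := ⟨H - n - 1, by omega⟩
  have hk' : H - (n + 1) = k := by omega
  rw [hk, hk', optVal]
  calc ∫⁻ a, optAct M k x.2 a ∂(π.act n x) ≤ ∫⁻ _, ⨆ a, optAct M k x.2 a ∂(π.act n x) :=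
        lintegral_mono fun a => le_iSup (optAct M k x.2) a
    _ = ⨆ a, optAct M k x.2 a := by rw [lintegral_const, measure_univ, mul_one]

theorem Policy.ae_law_reward (π : M.Policy) (s : M.states) (n : ℕ) :
    ∀ᵐ x ∂(π.law s n), ∀ i, 0 ≤ (x.1 i).2.2 := by
  induction n with
  | zero => exact Filter.Eventually.of_forall fun x i => i.elim0
  | succ n ih =>
    have := π.markov n
    have hm : ∀ m, MeasurableSet {x : M.Hist m | ∀ i, 0 ≤ (x.1 i).2.2} := by
      intro m
      rw [ofPred_forall]
      exact MeasurableSet.iInter fun i => measurableSet_le measurable_const (by fun_prop)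
    have hc : {x : M.Hist (n + 1) | ¬ ∀ i, 0 ≤ (x.1 i).2.2}
        = {x : M.Hist (n + 1) | ∀ i, 0 ≤ (x.1 i).2.2}ᶜ := rfl
    rw [ae_iff, hc, Policy.law, Measure.bind_apply (hm _).compl (Kernel.aemeasurable _),
      lintegral_eq_zero_iff' ((Kernel.measurable_coe _ (hm _).compl).aemeasurable)]
    filter_upwards [ih] with x hx
    rw [← lintegral_indicator_one (hm _).compl, lintegral_stepKernel _ _ _
      (measurable_one.indicator (hm _).compl)]
    simp only [Pi.zero_apply]
    rw [lintegral_eq_zero_iff (measurable_of_countable _)]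
    refine Filter.Eventually.of_forall fun a => ?_
    simp only [Pi.zero_apply]
    rw [← lintegral_zero (μ := M.Q x.2 a)]
    refine lintegral_congr_ae ?_
    filter_upwards [ae_reward x.2 a] with z hz
    rw [indicator_of_notMem]
    simp only [mem_compl_iff, mem_ofPred_eq, not_not]
    intro i
    refine Fin.lastCases ?_ (fun j => ?_) i
    · simpa [MDP.extend] using hz.1
    · simpa [MDP.extend] using hx j

theorem Policy.value_eq (π : M.Policy) (s : M.states) :
    π.value s = (π.hybrid s H).toReal := by
  have h0 := π.ae_law_reward s H
  rw [Policy.value, integral_eq_lintegral_of_nonneg_ae, Policy.hybrid]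
  · congr 1
    refine lintegral_congr_ae ?_
    filter_upwards [h0] with x hx
    rw [Nat.sub_self, optVal, add_zero, histReward, ENNReal.ofReal_sum_of_nonneg fun i _ => hx i]
  · filter_upwards [h0] with x hx using Finset.sum_nonneg fun i _ => hx i
  · have : Measurable fun x : M.Hist H => ∑ i, (x.1 i).2.2 := by fun_prop
    exact this.aestronglyMeasurable

theorem Policy.hybrid_zero (π : M.Policy) (s : M.states) : π.hybrid s 0 = optVal M H s := by
  rw [Policy.hybrid, Policy.law, lintegral_dirac' _ (measurable_hybrid_integrand _ _)]
  simp [histReward]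

theorem Policy.hybrid_le (π : M.Policy) (s : M.states) {m n : ℕ} (hmn : m ≤ n) (hn : n ≤ H) :
    π.hybrid s n ≤ π.hybrid s m := by
  induction n, hmn using Nat.le_induction with
  | base => exact le_rfl
  | succ n hmn ih => exact (π.hybrid_succ_le s (by omega)).trans (ih (by omega))

theorem optVal_le (k : ℕ) (s : M.states) : optVal M k s ≤ k := by
  induction k generalizing s with
  | zero => simp [optVal]
  | succ k ih =>
    rw [optVal]
    refine iSup_le fun a => ?_
    have := M.prob s a
    rw [optAct]
    calc ∫⁻ x, (ENNReal.ofReal x.1 + optVal M k x.2) ∂(M.Q s a)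
        ≤ ∫⁻ _, (1 + (k : ℝ≥0∞)) ∂(M.Q s a) := by
          refine lintegral_mono_ae ?_
          filter_upwards [ae_reward s a] with x hx
          exact add_le_add (ENNReal.ofReal_le_one.2 hx.2) (ih _)
      _ = ((k + 1 : ℕ) : ℝ≥0∞) := by
          rw [lintegral_const, measure_univ, mul_one]; push_cast; ring

theorem optAct_le (k : ℕ) (s : M.states) (a : Fin A) : optAct M k s a ≤ (k + 1 : ℕ) := by
  have h := optVal_le (M := M) (k + 1) s
  rw [optVal] at h
  exact (le_iSup (optAct M k s) a).trans h

/-- At a state whose remaining horizon is at most `k`, further steps bring nothing. -/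
theorem optVal_succ_eq (k : ℕ) (s : M.states) (hs : H ≤ M.stage s + k) :
    optVal M (k + 1) s = optVal M k s := by
  induction k generalizing s with
  | zero =>
    have h0 : (s : ℕ) = 0 := (M.stage_eq_iff s).1 (le_antisymm (M.stage_le s) hs)
    simp only [optVal, optAct, add_zero, ENNReal.iSup_eq_zero]
    intro a
    rw [← lintegral_zero (μ := M.Q s a)]
    refine lintegral_congr_ae ?_
    filter_upwards [M.supp_bot s a h0] with x hx
    simp [hx.1]
  | succ k ih =>
    rw [optVal, optVal]
    refine iSup_congr fun a => ?_
    rw [optAct, optAct]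
    refine lintegral_congr_ae ?_
    filter_upwards [ae_stage s a] with x hx
    rw [ih x.2 (by omega)]

theorem optVal_bot (s : M.states) (hs : M.stage s = H) (k : ℕ) : optVal M k s = 0 := by
  induction k with
  | zero => rw [optVal]
  | succ k ih => rw [optVal_succ_eq k s (by omega), ih]

theorem Policy.hybrid_fixFirst_one (π : M.Policy) (s : M.states) (a : Fin A) :
    (π.fixFirst a).hybrid s 1 = optAct M (H - 1) s a := by
  rw [Policy.hybrid_succ _ s 0, Policy.law, lintegral_dirac']
  · simp only [histReward, Finset.univ_eq_empty, Finset.sum_empty, zero_add]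
    change ∫⁻ b, optAct M (H - 1) s b ∂(Kernel.const _ (Measure.dirac a) _) = _
    rw [Kernel.const_apply, lintegral_dirac]
  · refine (measurable_histReward 0).add ?_
    have := (π.fixFirst a).markov 0
    have h : Measurable (Function.uncurry fun (x : M.Hist 0) (b : Fin A) =>
        optAct M (H - (0 + 1)) x.2 b) :=
      (measurable_of_countable fun p : M.states × Fin A => optAct M (H - (0 + 1)) p.1 p.2).comp
        (by fun_prop : Measurable fun p : M.Hist 0 × Fin A => (p.1.2, p.2))
    exact h.lintegral_kernel_prod_right

variable [NeZero A]

theorem exists_optAct_eq (k : ℕ) (s : M.states) : ∃ a, optVal M (k + 1) s = optAct M k s a := by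
  obtain ⟨a, ha⟩ := exists_eq_ciSup_of_finite (f := optAct M k s)
  exact ⟨a, by rw [optVal, ha]⟩

/-- The policy that is greedy with respect to the optimal values. -/
def greedy (M : MDP A H) : M.Policy where
  act n := Kernel.deterministic
    ((fun s => (exists_optAct_eq (M := M) (H - (n + 1)) s).choose) ∘ Prod.snd)
    ((M.measurable_of_state _).comp measurable_snd)
  markov _ := inferInstance

instance : Nonempty M.Policy := ⟨greedy M⟩

/-- Equality holds along a policy that agrees with the greedy one. -/
theorem Policy.hybrid_succ_eq (π : M.Policy) (s : M.states) {n : ℕ} (hn : n < H)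
    (hπ : π.act n = (greedy M).act n) : π.hybrid s (n + 1) = π.hybrid s n := by
  rw [π.hybrid_succ s n, Policy.hybrid]
  refine lintegral_congr fun x => ?_
  rw [hπ]
  have hk : H - n = (H - (n + 1)) + 1 := by omega
  rw [hk, (exists_optAct_eq (M := M) (H - (n + 1)) x.2).choose_spec]
  congr 1
  simp only [greedy]
  rw [Kernel.deterministic_apply, lintegral_dirac]
  rfl

theorem Policy.hybrid_eq (π : M.Policy) (s : M.states) {m n : ℕ} (hmn : m ≤ n) (hn : n ≤ H)
    (hπ : ∀ k, m ≤ k → k < n → π.act k = (greedy M).act k) : π.hybrid s n = π.hybrid s m := by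
  induction n, hmn using Nat.le_induction with
  | base => exact rfl
  | succ n hmn ih =>
    rw [π.hybrid_succ_eq s (by omega) (hπ n hmn (by omega)),
      ih (by omega) fun k hk hkn => hπ k hk (by omega)]

/-- The supremum over policies is given by backward induction: the hybrids decrease from the optimal
value to the value of the policy, and they are constant along the greedy policy. -/
theorem vstar_eq (s : M.states) : M.vstar s = (optVal M H s).toReal := by
  have hle : ∀ π : M.Policy, π.value s ≤ (optVal M H s).toReal := by
    intro π
    rw [π.value_eq, ← π.hybrid_zero]
    refine ENNReal.toReal_mono ?_ (π.hybrid_le s (Nat.zero_le _) le_rfl)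
    rw [π.hybrid_zero]
    exact ne_top_of_le_ne_top (ENNReal.natCast_ne_top H) (optVal_le H s)
  refine le_antisymm (ciSup_le hle) ?_
  rw [← (greedy M).hybrid_zero, ← (greedy M).hybrid_eq s (Nat.zero_le _) le_rfl fun _ _ _ => rfl,
    ← Policy.value_eq]
  exact le_ciSup (f := fun π : M.Policy => π.value s) ⟨_, by rintro _ ⟨π, rfl⟩; exact hle π⟩ _

theorem qstar_eq (hH : 0 < H) (s : M.states) (a : Fin A) :
    M.qstar s a = (optAct M (H - 1) s a).toReal := by
  have hle : ∀ π : M.Policy, (π.fixFirst a).value s ≤ (optAct M (H - 1) s a).toReal := by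
    intro π
    rw [Policy.value_eq, ← π.hybrid_fixFirst_one]
    refine ENNReal.toReal_mono ?_ (Policy.hybrid_le _ s hH le_rfl)
    rw [π.hybrid_fixFirst_one]
    exact ne_top_of_le_ne_top (ENNReal.natCast_ne_top _) (optAct_le _ s a)
  refine le_antisymm (ciSup_le hle) ?_
  rw [← (greedy M).hybrid_fixFirst_one, ← Policy.hybrid_eq _ s hH le_rfl, ← Policy.value_eq]
  · exact le_ciSup (f := fun π : M.Policy => (π.fixFirst a).value s)
      ⟨_, by rintro _ ⟨π, rfl⟩; exact hle π⟩ _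
  · intro k hk _
    obtain ⟨j, rfl⟩ : ∃ j, k = j + 1 := ⟨k - 1, by omega⟩
    rfl

theorem vstar_nonneg (s : M.states) : 0 ≤ M.vstar s := by
  rw [vstar_eq]; exact ENNReal.toReal_nonneg

theorem vstar_le (s : M.states) : M.vstar s ≤ H := by
  rw [vstar_eq]
  exact ENNReal.toReal_le_of_le_ofReal (by positivity) (by simpa using optVal_le H s)

theorem vstar_bot (s : M.states) (hs : M.stage s = H) : M.vstar s = 0 := by
  rw [vstar_eq, optVal_bot s hs, ENNReal.toReal_zero]

theorem qstar_eq_integral (hH : 0 < H) (s : M.states) (a : Fin A) :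
    M.qstar s a = ∫ x, (x.1 + M.vstar x.2) ∂(M.Q s a) := by
  rw [qstar_eq hH, integral_eq_lintegral_of_nonneg_ae, optAct]
  · congr 1
    refine lintegral_congr_ae ?_
    filter_upwards [ae_reward s a, ae_stage s a] with x hx hst
    rw [ENNReal.ofReal_add hx.1 (vstar_nonneg _), vstar_eq, ENNReal.ofReal_toReal
      (ne_top_of_le_ne_top (ENNReal.natCast_ne_top _) (optVal_le H x.2))]
    congr 1
    obtain ⟨k, rfl⟩ : ∃ k, H = k + 1 := ⟨H - 1, by omega⟩
    exact (optVal_succ_eq k x.2 (by omega)).symm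
  · filter_upwards [ae_reward s a] with x hx using add_nonneg hx.1 (vstar_nonneg _)
  · have h : Measurable (M.vstar ∘ Prod.snd : ℝ × M.states → ℝ) :=
      (M.measurable_of_state _).comp measurable_snd
    exact (measurable_fst.add h).aestronglyMeasurable

theorem exists_vstar_eq_qstar (hH : 0 < H) (s : M.states) : ∃ a, M.vstar s = M.qstar s a := by
  obtain ⟨k, rfl⟩ : ∃ k, H = k + 1 := ⟨H - 1, by omega⟩
  obtain ⟨a, ha⟩ := exists_optAct_eq (M := M) k s
  exact ⟨a, by rw [vstar_eq, qstar_eq hH, ha]; rfl⟩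

theorem qstar_le_vstar (hH : 0 < H) (s : M.states) (a : Fin A) : M.qstar s a ≤ M.vstar s := by
  rw [vstar_eq, qstar_eq hH]
  refine ENNReal.toReal_mono
    (ne_top_of_le_ne_top (ENNReal.natCast_ne_top _) (optVal_le H s)) ?_
  obtain ⟨k, rfl⟩ : ∃ k, H = k + 1 := ⟨H - 1, by omega⟩
  rw [optVal]
  exact le_iSup (optAct M k s) a

end MDP

/-! ### Query programs -/

/-- The digest of an answer of the simulator: the reward rounded down to a multiple of `1 / κ`, the
name of the next state, and the digest of its features. -/
abbrev Answer (κ : ℕ) (G : Type) : Type := Fin (κ + 1) × ℕ × G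

/-- Programs that query a simulator at names of states and return a result; the continuation of a
query depends on the answer only through `Y`. -/
inductive Prog (A : ℕ) (Y R : Type) where
  | ret (r : R) : Prog A Y R
  | query (n : ℕ) (a : Fin A) (k : Y → Prog A Y R) : Prog A Y R

namespace Prog

variable {A : ℕ} {Y R R' : Type}

/-- Sequential composition. -/
def bind (f : R → Prog A Y R') : Prog A Y R → Prog A Y R'
  | ret r => f r
  | query n a k => query n a fun y => (k y).bind f

/-- Apply a function to the result. -/
def map (f : R → R') (p : Prog A Y R) : Prog A Y R' := p.bind fun r => ret (f r)

/-- The worst-case number of queries. -/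
def cost : Prog A Y R → ℝ≥0∞
  | ret _ => 0
  | query _ _ k => 1 + ⨆ y, (k y).cost

theorem cost_bind_le (f : R → Prog A Y R') {N : ℝ≥0∞} (hf : ∀ r, (f r).cost ≤ N)
    (p : Prog A Y R) : (p.bind f).cost ≤ p.cost + N := by
  induction p with
  | ret r => simpa [bind, cost] using hf r
  | query n a k ih =>
    simp only [bind, cost, add_assoc]
    refine add_le_add le_rfl (iSup_le fun y => (ih y).trans ?_)
    exact add_le_add (le_iSup (fun y => (k y).cost) y) le_rfl

theorem cost_map_le (f : R → R') (p : Prog A Y R) : (p.map f).cost ≤ p.cost := by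
  simpa [map] using
    cost_bind_le (fun r => ret (A := A) (Y := Y) (f r)) (N := 0) (fun r => by simp [cost]) p

/-- All queries concern names from the given set or names of states returned by earlier queries;
`name` extracts the name of the state from an answer. -/
def Valid (name : Y → ℕ) : Prog A Y R → Set ℕ → Prop
  | ret _, _ => True
  | query n _ k, t => n ∈ t ∧ ∀ y, (k y).Valid name (insert (name y) t)

theorem Valid.mono {name : Y → ℕ} {p : Prog A Y R} {t t' : Set ℕ} (h : p.Valid name t)
    (ht : t ⊆ t') : p.Valid name t' := by
  induction p generalizing t t' with
  | ret r => trivial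
  | query n a k ih => exact ⟨ht h.1, fun y => ih y (h.2 y) (insert_subset_insert ht)⟩

theorem Valid.bind {name : Y → ℕ} {p : Prog A Y R} {f : R → Prog A Y R'} {t : Set ℕ}
    (h : p.Valid name t) (hf : ∀ r, (f r).Valid name t) : (p.bind f).Valid name t := by
  induction p generalizing t with
  | ret r => exact hf r
  | query n a k ih =>
    exact ⟨h.1, fun y => ih y (h.2 y) fun r => (hf r).mono (subset_insert _ _)⟩

theorem Valid.map {name : Y → ℕ} {p : Prog A Y R} {t : Set ℕ} (h : p.Valid name t) (f : R → R') :
    (p.map f).Valid name t := h.bind fun _ => trivial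

end Prog

/-! ### Total expectations along the interaction -/

namespace Planner

variable {A H : ℕ} {F : Type} [MeasurableSpace F] (P : Planner A F) (M : FMDP A H F)

/-- The expected sum of `g` over all the configurations of the interaction from `c` on. -/
def tot (g : P.Config M → ℝ≥0∞) (c : P.Config M) : ℝ≥0∞ :=
  ∑' n, ∫⁻ c', g c' ∂(P.steps M n c)

theorem steps_succ' (n : ℕ) : P.steps M (n + 1) = P.steps M n ∘ₖ P.step M := by
  induction n with
  | zero => simp [steps]
  | succ n ih =>
    change P.step M ∘ₖ P.steps M (n + 1) = (P.step M ∘ₖ P.steps M n) ∘ₖ P.step M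
    rw [ih, Kernel.comp_assoc]

variable {P M}

theorem lintegral_steps_succ {g : P.Config M → ℝ≥0∞} (hg : Measurable g) (n : ℕ) (c : P.Config M) :
    ∫⁻ c', g c' ∂(P.steps M (n + 1) c)
      = ∫⁻ c₁, ∫⁻ c', g c' ∂(P.steps M n c₁) ∂(P.step M c) := by
  rw [steps_succ', Kernel.lintegral_comp _ _ _ hg]

theorem measurable_tot {g : P.Config M → ℝ≥0∞} (hg : Measurable g) : Measurable (P.tot M g) :=
  Measurable.tsum fun _ => hg.lintegral_kernel

theorem tot_eq {g : P.Config M → ℝ≥0∞} (hg : Measurable g) (c : P.Config M) :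
    P.tot M g c = g c + ∫⁻ c', P.tot M g c' ∂(P.step M c) := by
  have h0 : ∫⁻ c', g c' ∂(P.steps M 0 c) = g c := by
    rw [steps, Kernel.id_apply, lintegral_dirac' _ hg]
  rw [tot, tsum_eq_zero_add' ENNReal.summable, h0]
  simp only [tot]
  rw [lintegral_tsum fun n => (hg.lintegral_kernel (κ := P.steps M n)).aemeasurable]
  simp only [lintegral_steps_succ hg]

/-- A supersolution of the recursion for the total expectation dominates it. -/
theorem tot_le {g u : P.Config M → ℝ≥0∞} (hg : Measurable g)
    (hu : ∀ c, g c + ∫⁻ c', u c' ∂(P.step M c) ≤ u c) (c : P.Config M) : P.tot M g c ≤ u c := by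
  refine ENNReal.tsum_le_of_sum_range_le fun n => ?_
  induction n generalizing c with
  | zero => simp
  | succ n ih =>
    rw [Finset.sum_range_succ', steps, Kernel.id_apply, lintegral_dirac' _ hg, add_comm]
    simp only [lintegral_steps_succ hg]
    rw [← lintegral_finsetSum _ fun i _ => hg.lintegral_kernel]
    exact (add_le_add le_rfl (lintegral_mono ih)).trans (hu c)

theorem lintegral_step (c : P.Config M) {J : P.Config M → ℝ≥0∞} (hJ : Measurable J) :
    ∫⁻ c', J c' ∂(P.step M c)
      = ∫⁻ d, ∫⁻ y, J ((d.1, y.1), y.2) ∂(M.react d.2 c.2.2) ∂(P.act c.1) := by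
  have h : Measurable fun y : (P.Mem × Decision A) × (Percept F × (ℝ × Status M.toMDP)) =>
    J ((y.1.1, y.2.1), y.2.2) := hJ.comp (by fun_prop)
  rw [step, Kernel.lintegral_map _ (by fun_prop) _ hJ, Kernel.lintegral_compProd _ _ _ h]
  rfl

/-- The reward incurred in the last step. -/
def reward (c : P.Config M) : ℝ≥0∞ := ENNReal.ofReal c.2.1

theorem measurable_reward : Measurable (reward (P := P) (M := M)) := by
  unfold reward
  fun_prop

theorem measurable_status (f : Status M.toMDP → ℝ≥0∞) :
    Measurable fun c : P.Config M => f c.2.2 :=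
  (measurable_of_countable f).comp (by fun_prop)

theorem value_eq_tot (s₀ : M.states) : P.value M s₀ = P.tot M reward (P.start M s₀) := rfl

theorem lintegral_react_ret (σ : Status M.toMDP) (a : Fin A) (h : σ.calls < H)
    {J : Percept F × (ℝ × Status M.toMDP) → ℝ≥0∞} (hJ : Measurable J) :
    ∫⁻ y, J y ∂(M.react (.ret a) σ) = ∫⁻ x, J (M.advance σ x) ∂(M.Q σ.cur a) := by
  rw [FMDP.react, if_neg (by omega), lintegral_map hJ (M.measurable_advance σ)]

theorem lintegral_react_over (σ : Status M.toMDP) (d : Decision A) (h : H ≤ σ.calls)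
    {J : Percept F × (ℝ × Status M.toMDP) → ℝ≥0∞} (hJ : Measurable J) :
    ∫⁻ y, J y ∂(M.react d σ) = J (.inr (.inl ()), (0, { σ with queried := false })) := by
  unfold FMDP.react
  rw [if_pos h, lintegral_dirac' _ hJ]

theorem lintegral_react_query (σ : Status M.toMDP) (a : Fin A) (h : σ.calls < H)
    (s : M.states) (hs : s ∈ σ.seen)
    {J : Percept F × (ℝ × Status M.toMDP) → ℝ≥0∞} (hJ : Measurable J) :
    ∫⁻ y, J y ∂(M.react (.query s a) σ) = ∫⁻ x, J (M.answer σ x) ∂(M.Q s a) := by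
  have h1 : ∃ s' ∈ σ.seen, (s' : ℕ) = s := ⟨s, hs, rfl⟩
  have h2 : h1.choose = s := Subtype.ext h1.choose_spec.2
  rw [FMDP.react, if_neg (by omega)]
  rw [dif_pos h1, h2, lintegral_map hJ (M.measurable_answer σ)]

theorem lintegral_react_refused (σ : Status M.toMDP) (n : ℕ) (a : Fin A) (h : σ.calls < H)
    (hs : ¬ ∃ s ∈ σ.seen, (s : ℕ) = n)
    {J : Percept F × (ℝ × Status M.toMDP) → ℝ≥0∞} (hJ : Measurable J) :
    ∫⁻ y, J y ∂(M.react (.query n a) σ)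
      = J (.inr (.inl ()), (0, { σ with queried := true })) := by
  rw [FMDP.react, if_neg (by omega)]
  rw [dif_neg hs, lintegral_dirac' _ hJ]

/-- The total reward from a configuration on is at most one for each remaining call. -/
theorem tot_reward_le (c : P.Config M) :
    P.tot M reward c ≤ reward c + ((H - c.2.2.calls : ℕ) : ℝ≥0∞) := by
  refine tot_le (u := fun c => reward c + ((H - c.2.2.calls : ℕ) : ℝ≥0∞)) measurable_reward
    (fun c => add_le_add le_rfl ?_) c
  have hm : Measurable fun c : P.Config M => reward c + ((H - c.2.2.calls : ℕ) : ℝ≥0∞) :=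
    measurable_reward.add (measurable_status fun σ => ((H - σ.calls : ℕ) : ℝ≥0∞))
  rw [lintegral_step c hm]
  refine (lintegral_mono (g := fun _ => ((H - c.2.2.calls : ℕ) : ℝ≥0∞)) fun d => ?_).trans
    (by rw [lintegral_const, measure_univ, mul_one])
  have hm' : Measurable fun y : Percept F × (ℝ × Status M.toMDP) =>
      reward (P := P) ((d.1, y.1), y.2) + ((H - y.2.2.calls : ℕ) : ℝ≥0∞) :=
    hm.comp (by fun_prop : Measurable fun y : Percept F × (ℝ × Status M.toMDP) =>
      (((d.1, y.1), y.2) : P.Config M))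
  dsimp only
  rcases le_or_gt H c.2.2.calls with h | h
  · rw [lintegral_react_over _ _ h hm']
    simp [reward]
  · obtain ⟨m, n | a⟩ := d
    · rename_i b
      by_cases hs : ∃ s ∈ c.2.2.seen, (s : ℕ) = n
      · obtain ⟨s, hs, rfl⟩ := hs
        rw [lintegral_react_query _ _ h s hs hm']
        have := M.prob s b
        simp [FMDP.answer, reward]
      · rw [lintegral_react_refused _ _ _ h hs hm']
        simp [reward]
    · rw [lintegral_react_ret _ _ h hm']
      have := M.prob c.2.2.cur a
      refine (lintegral_mono_ae (g := fun _ => ((H - c.2.2.calls : ℕ) : ℝ≥0∞)) ?_).trans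
        (by rw [lintegral_const, measure_univ, mul_one])
      filter_upwards [MDP.ae_reward c.2.2.cur a] with x hx
      obtain ⟨j, hj⟩ : ∃ j, H - c.2.2.calls = j + 1 := ⟨H - c.2.2.calls - 1, by omega⟩
      have hj' : H - (c.2.2.calls + 1) = j := by omega
      simp only [FMDP.advance, reward, hj, hj']
      push_cast
      rw [add_comm]
      exact add_le_add le_rfl (ENNReal.ofReal_le_one.2 hx.2)

theorem value_ne_top (s₀ : M.states) : P.value M s₀ ≠ ⊤ := by
  rw [value_eq_tot]
  refine ne_top_of_le_ne_top ?_ (tot_reward_le _)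
  exact ENNReal.add_ne_top.2 ⟨ENNReal.ofReal_ne_top, ENNReal.natCast_ne_top _⟩

end Planner

/-! ### Planners that interpret query programs -/

theorem lintegral_coin_map {Ω X Y : Type*} [MeasurableSpace Ω] [MeasurableSpace X]
    [MeasurableSpace Y] (ν : Measure Ω) [SFinite ν] {f : Ω × X → Y} (hf : Measurable f)
    {g : Y → ℝ≥0∞} (hg : Measurable g) (x : X) :
    ∫⁻ y, g y ∂((Kernel.const X ν ×ₖ Kernel.id).map f x) = ∫⁻ ω, g (f (ω, x)) ∂ν := by
  have hg' : Measurable fun p => g (f p) := hg.comp hf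
  rw [Kernel.lintegral_map _ hf _ hg, Kernel.prod_apply, Kernel.const_apply, Kernel.id_apply,
    lintegral_prod _ hg'.aemeasurable]
  refine lintegral_congr fun ω => ?_
  rw [lintegral_dirac']
  exact hg'.comp measurable_prodMk_left

/-- The reward `r` rounded down to a multiple of `1 / κ`, as a numerator. -/
def level (κ : ℕ) (r : ℝ) : Fin (κ + 1) := ⟨min κ ⌊κ * r⌋₊, by omega⟩

theorem measurable_level (κ : ℕ) : Measurable (level κ) := by
  have h1 : Measurable fun r : ℝ => ⌊κ * r⌋₊ := Nat.measurable_floor.comp (by fun_prop)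
  exact (measurable_of_countable fun n : ℕ => (⟨min κ n, by omega⟩ : Fin (κ + 1))).comp h1

/-- A randomized strategy: in each call it draws a fresh coin `ω` and runs the program
`call z ω x`, where `z` is its memory and `x` the digest of the state; the program returns the
action and the next memory. Features are digested by `ρ` to a countable type. -/
structure Strategy (A κ : ℕ) (F G : Type) [MeasurableSpace F] [MeasurableSpace G] where
  ρ : F → G
  measurable_ρ : Measurable ρ
  Z : Type
  z₀ : Z
  dflt : Fin A
  Ω : Type
  instΩ : MeasurableSpace Ω
  countable_Ω : Countable Ω
  discrete_Ω : DiscreteMeasurableSpace Ω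
  ν : Measure Ω
  prob_ν : IsProbabilityMeasure ν
  call : Z → Ω → ℕ × G → Prog A (Answer κ G) (Fin A × Z)

namespace Strategy

attribute [instance] Strategy.instΩ Strategy.countable_Ω Strategy.discrete_Ω Strategy.prob_ν

variable {A κ : ℕ} {F G : Type} [MeasurableSpace F] [MeasurableSpace G]
  (S : Strategy A κ F G)

/-- The programs that the calls of a strategy run. -/
abbrev Pr : Type := Prog A (Answer κ G) (Fin A × S.Z)

/-- The memory of the planner: between calls, the memory of the strategy; within a call, the
continuation of the program that is being run. All its subsets are measurable. -/
def Mem : Type := S.Z ⊕ (Answer κ G → S.Pr)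

instance : MeasurableSpace S.Mem := ⊤

/-- Digested percepts. -/
abbrev DPercept (κ : ℕ) (G : Type) : Type := (ℕ × G) ⊕ (Unit ⊕ Answer κ G)

/-- The digest of a percept. -/
def digest : Percept F → DPercept κ G :=
  Sum.elim (fun x => .inl (x.1, S.ρ x.2)) (Sum.elim (fun x => .inr (.inl x))
    (fun x => .inr (.inr (level κ x.1, x.2.1, S.ρ x.2.2))))

theorem measurable_digest : Measurable S.digest := by
  have h := S.measurable_ρ
  have h' := measurable_level κ
  refine Measurable.sumElim ?_ (Measurable.sumElim ?_ ?_)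
  · exact measurable_inl.comp (by fun_prop)
  · exact measurable_inr.comp measurable_inl
  · exact measurable_inr.comp (measurable_inr.comp (by fun_prop))

/-- The program to go on with. A refused query makes the planner return a default action. -/
def next (ω : S.Ω) : S.Mem → DPercept κ G → S.Pr
  | .inl z, .inl x => S.call z ω x
  | .inr k, .inr (.inr y) => k y
  | _, _ => .ret (S.dflt, S.z₀)

/-- The first decision of a program, and the memory after it. -/
def exec : S.Pr → S.Mem × Decision A
  | .ret r => (.inl r.2, .ret r.1)
  | .query n a k => (.inr k, .query n a)

theorem measurableSingletonClass_sum {α β : Type*} [MeasurableSpace α] [MeasurableSpace β]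
    [MeasurableSingletonClass α] [MeasurableSingletonClass β] :
    MeasurableSingletonClass (α ⊕ β) := by
  refine ⟨fun x => ?_⟩
  rcases x with x | x
  · rw [← image_singleton]
    exact (measurableSet_singleton x).inl_image
  · rw [← image_singleton]
    exact (measurableSet_singleton x).inr_image

variable [Countable G] [DiscreteMeasurableSpace G]

theorem measurable_exec_next :
    Measurable fun x : S.Ω × (S.Mem × Percept F) =>
      S.exec (S.next x.1 x.2.1 (S.digest x.2.2)) := by
  have : MeasurableSingletonClass (Unit ⊕ Answer κ G) := measurableSingletonClass_sum
  have : MeasurableSingletonClass (DPercept κ G) := measurableSingletonClass_sum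
  have h1 : Measurable fun x : S.Mem × (S.Ω × DPercept κ G) =>
      S.exec (S.next x.2.1 x.1 x.2.2) :=
    measurable_from_prod_countable_left fun y => measurable_from_top
  have h2 := S.measurable_digest
  exact h1.comp (by
    fun_prop : Measurable fun x : S.Ω × (S.Mem × Percept F) => (x.2.1, (x.1, S.digest x.2.2)))

/-- The law of the next decision and of the memory after it. -/
def actKernel : Kernel (S.Mem × Percept F) (S.Mem × Decision A) :=
  (Kernel.const (S.Mem × Percept F) S.ν ×ₖ Kernel.id).map
    fun x : S.Ω × (S.Mem × Percept F) => S.exec (S.next x.1 x.2.1 (S.digest x.2.2))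

instance : IsMarkovKernel S.actKernel :=
  Kernel.IsMarkovKernel.map _ S.measurable_exec_next

theorem lintegral_actKernel (m : S.Mem) (x : Percept F) {g : S.Mem × Decision A → ℝ≥0∞}
    (hg : Measurable g) :
    ∫⁻ d, g d ∂(S.actKernel (m, x)) = ∫⁻ ω, g (S.exec (S.next ω m (S.digest x))) ∂S.ν := by
  exact lintegral_coin_map S.ν S.measurable_exec_next hg (m, x)

/-- The planner that follows a strategy. -/
def planner : Planner A F where
  Mem := S.Mem
  instMem := inferInstance
  init := Sum.inl S.z₀
  act := S.actKernel
  markov := inferInstance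

variable {H : ℕ} (M : FMDP A H F)

/-- The expectation of `J` over the configurations that can follow, when the program `p` is about
to make its next decision. -/
def after (J : S.planner.Config M → ℝ≥0∞) (p : S.Pr) (σ : Status M.toMDP) : ℝ≥0∞ :=
  ∫⁻ y, J (((S.exec p).1, y.1), y.2) ∂(M.react (S.exec p).2 σ)

variable {M}

theorem measurable_slice {J : S.planner.Config M → ℝ≥0∞} (hJ : Measurable J) (m : S.Mem) :
    Measurable fun y : Percept F × (ℝ × Status M.toMDP) => J ((m, y.1), y.2) := by
  have h : Measurable fun y : Percept F × (ℝ × Status M.toMDP) =>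
      (((m, y.1), y.2) : S.planner.Config M) := by
    refine Measurable.prodMk (Measurable.prodMk measurable_const ?_) ?_ <;> fun_prop
  exact hJ.comp h

theorem lintegral_step {J : S.planner.Config M → ℝ≥0∞} (hJ : Measurable J)
    (c : S.planner.Config M) :
    ∫⁻ c', J c' ∂(S.planner.step M c)
      = ∫⁻ ω, S.after M J (S.next ω c.1.1 (S.digest c.1.2)) c.2.2 ∂S.ν := by
  rw [Planner.lintegral_step c hJ]
  have hm : Measurable fun d : S.planner.Mem × Decision A =>
      ∫⁻ y, J ((d.1, y.1), y.2) ∂(M.react d.2 c.2.2) := by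
    have h1 : Measurable fun x : (S.planner.Mem × Decision A) ×
        (Percept F × (ℝ × Status M.toMDP)) => J ((x.1.1, x.2.1), x.2.2) := hJ.comp (by fun_prop)
    exact h1.lintegral_kernel_prod_right'
      (κ := M.reactKernel.comap (fun d : S.planner.Mem × Decision A => (d.2, c.2.2)) (by fun_prop))
  exact S.lintegral_actKernel c.1.1 c.1.2 hm

theorem after_ret {J : S.planner.Config M → ℝ≥0∞} (hJ : Measurable J) (r : Fin A × S.Z)
    (σ : Status M.toMDP) (h : σ.calls < H) :
    S.after M J (.ret r) σ = ∫⁻ x, J ((.inl r.2, (M.advance σ x).1), (M.advance σ x).2)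
      ∂(M.Q σ.cur r.1) := by
  rw [after, exec, Planner.lintegral_react_ret _ _ h (S.measurable_slice hJ _)]

/-! ### The query cost of a strategy -/

/-- The indicator of a query made during the `k`-th call. -/
def queriedIn (k : ℕ) (c : S.planner.Config M) : ℝ≥0∞ :=
  if c.2.2.queried = true ∧ c.2.2.calls = k then 1 else 0

theorem measurable_queriedIn (k : ℕ) : Measurable (S.queriedIn (M := M) k) :=
  Planner.measurable_status fun σ => if σ.queried = true ∧ σ.calls = k then 1 else 0

theorem queriedIn_le_one (k : ℕ) (c : S.planner.Config M) : S.queriedIn k c ≤ 1 := by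
  unfold queriedIn
  split_ifs <;> simp

theorem callCost_eq (c : S.planner.Config M) :
    S.planner.callCost M c = S.planner.tot M (S.queriedIn c.2.2.calls) c := by
  unfold Planner.callCost Planner.tot
  refine tsum_congr fun n => ?_
  have hs : MeasurableSet {c' : S.planner.Config M |
      c'.2.2.queried = true ∧ c'.2.2.calls = c.2.2.calls} :=
    (by fun_prop : Measurable fun c' : S.planner.Config M => c'.2.2)
      (MeasurableSet.of_discrete (s := {σ : Status M.toMDP |
        σ.queried = true ∧ σ.calls = c.2.2.calls}))
  rw [← lintegral_indicator_one hs]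
  refine lintegral_congr fun c' => ?_
  by_cases h : c'.2.2.queried = true ∧ c'.2.2.calls = c.2.2.calls
  · exact (indicator_of_mem (s := {c' : S.planner.Config M |
      c'.2.2.queried = true ∧ c'.2.2.calls = c.2.2.calls}) h _).trans (if_pos h).symm
  · exact (indicator_of_notMem (s := {c' : S.planner.Config M |
      c'.2.2.queried = true ∧ c'.2.2.calls = c.2.2.calls}) h _).trans (if_neg h).symm

/-- No more queries are counted for a call that is over, or when the episode is over. -/
theorem tot_queriedIn_eq_zero (k : ℕ) (c : S.planner.Config M)
    (hc : k < c.2.2.calls ∨ (H ≤ c.2.2.calls ∧ c.2.2.queried = false)) :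
    S.planner.tot M (S.queriedIn k) c = 0 := by
  classical
  let u' : Status M.toMDP → ℝ≥0∞ := fun σ =>
    if k < σ.calls ∨ (H ≤ σ.calls ∧ σ.queried = false) then 0 else ⊤
  let u : S.planner.Config M → ℝ≥0∞ := fun c => u' c.2.2
  have hu : u c = 0 := if_pos hc
  rw [← nonpos_iff_eq_zero, ← hu]
  refine Planner.tot_le (S.measurable_queriedIn k) (fun c => ?_) c
  by_cases h : k < c.2.2.calls ∨ (H ≤ c.2.2.calls ∧ c.2.2.queried = false)
  · have h1 : S.queriedIn k c = 0 := by
      refine if_neg ?_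
      rintro ⟨h2, h3⟩
      rcases h with h | h
      · omega
      · simp [h2] at h
    have hm : Measurable u := Planner.measurable_status u'
    have huc : u c = 0 := if_pos h
    rw [h1, zero_add, huc, nonpos_iff_eq_zero, S.lintegral_step hm]
    refine (lintegral_congr fun ω => ?_).trans lintegral_zero
    generalize S.next ω c.1.1 (S.digest c.1.2) = p
    have hsl := S.measurable_slice hm (S.exec p).1
    rcases le_or_gt H c.2.2.calls with hH | hH
    · rw [after, Planner.lintegral_react_over _ _ hH hsl]
      exact if_pos (Or.inr ⟨hH, rfl⟩)
    · have hk : k < c.2.2.calls := by omega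
      cases p with
      | ret r =>
        rw [S.after_ret hm _ _ hH]
        refine (lintegral_congr fun x => ?_).trans lintegral_zero
        exact if_pos (Or.inl (by simp only [FMDP.advance]; omega))
      | query n a k' =>
        by_cases hs : ∃ s ∈ c.2.2.seen, (s : ℕ) = n
        · obtain ⟨s, hs, rfl⟩ := hs
          rw [after, exec, Planner.lintegral_react_query _ _ hH s hs (S.measurable_slice hm _)]
          refine (lintegral_congr fun x => ?_).trans lintegral_zero
          exact if_pos (Or.inl (by simpa only [FMDP.answer] using hk))
        · rw [after, exec, Planner.lintegral_react_refused _ _ _ hH hs (S.measurable_slice hm _)]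
          exact if_pos (Or.inl hk)
  · have huc : u c = ⊤ := if_neg h
    rw [huc]
    exact le_top

/-- The expected number of queries still made during a call is at most the cost of the program that
is being run. -/
theorem after_queriedIn_le (k : ℕ) (p : S.Pr) (σ : Status M.toMDP) (hσ : σ.calls = k) :
    S.after M (S.planner.tot M (S.queriedIn k)) p σ ≤ p.cost := by
  have hg := S.measurable_queriedIn (M := M) k
  have hm := Planner.measurable_tot hg
  rcases le_or_gt H σ.calls with hH | hH
  · rw [after, Planner.lintegral_react_over _ _ hH (S.measurable_slice hm _),
      tot_queriedIn_eq_zero _ _ _ (Or.inr ⟨hH, rfl⟩)]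
    exact zero_le
  induction p generalizing σ with
  | ret r =>
    rw [S.after_ret hm _ _ hH]
    refine (lintegral_congr fun x => ?_).trans_le (lintegral_zero.trans_le zero_le)
    exact S.tot_queriedIn_eq_zero _ _ (Or.inl (by simp only [FMDP.advance]; omega))
  | query n a k' ih =>
    rw [Prog.cost]
    by_cases hs : ∃ s ∈ σ.seen, (s : ℕ) = n
    · obtain ⟨s, hs, rfl⟩ := hs
      have := M.prob s a
      rw [after, exec, Planner.lintegral_react_query _ _ hH s hs (S.measurable_slice hm _)]
      refine (lintegral_mono (g := fun _ => 1 + ⨆ y, (k' y).cost) fun x => ?_).trans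
        (by rw [lintegral_const, measure_univ, mul_one])
      dsimp only
      rw [Planner.tot_eq hg, S.lintegral_step hm]
      refine add_le_add (S.queriedIn_le_one _ _) ?_
      refine (lintegral_mono (g := fun _ => ⨆ y, (k' y).cost) fun ω => ?_).trans
        (by rw [lintegral_const, measure_univ, mul_one])
      exact (ih (level κ x.1, (x.2 : ℕ), S.ρ (M.feat x.2)) _
        (by simpa only [FMDP.answer] using hσ) (by simpa only [FMDP.answer] using hH)).trans
          (le_iSup (fun y => (k' y).cost) _)
    · rw [after, exec, Planner.lintegral_react_refused _ _ _ hH hs (S.measurable_slice hm _)]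
      rw [Planner.tot_eq hg, S.lintegral_step hm]
      refine add_le_add (S.queriedIn_le_one _ _) ?_
      refine (lintegral_mono (g := fun _ => 0) fun ω => ?_).trans
        (lintegral_zero.trans_le zero_le)
      change S.after M _ (.ret (S.dflt, S.z₀)) { σ with queried := true } ≤ 0
      rw [S.after_ret hm _ { σ with queried := true } hH]
      refine (lintegral_congr fun x => ?_).trans_le lintegral_zero.le
      exact S.tot_queriedIn_eq_zero _ _ (Or.inl (by simp only [FMDP.advance]; omega))

/-- The query cost of a strategy is bounded by the expectation, over the coin, of the cost of its
programs. The additive constant accounts for the configuration in which the call begins. -/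
theorem queryCost_le {N : ℝ≥0∞} (hN : ∀ z x, ∫⁻ ω, (S.call z ω x).cost ∂S.ν ≤ N) :
    S.planner.queryCost M ≤ 1 + N := by
  unfold Planner.queryCost
  refine iSup_le fun s₀ => iSup_le fun _ => iSup_le fun n => ?_
  refine essSup_le_of_ae_le _ (Filter.Eventually.of_forall fun c => ?_)
  dsimp only
  split_ifs with h
  · rw [callCost_eq, Planner.tot_eq (S.measurable_queriedIn _),
      S.lintegral_step (Planner.measurable_tot (S.measurable_queriedIn _))]
    refine add_le_add (S.queriedIn_le_one _ _) ?_
    refine (lintegral_mono fun ω => S.after_queriedIn_le _ _ _ rfl).trans ?_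
    obtain ⟨⟨m, x⟩, r, σ⟩ := c
    obtain ⟨x, rfl⟩ := Sum.isLeft_iff.1 h
    rcases m with z | k
    · exact hN z (x.1, S.ρ x.2)
    · refine (lintegral_mono (g := fun _ => 0) fun ω => ?_).trans
        (lintegral_zero.trans_le zero_le)
      exact (show Prog.cost (Prog.ret (S.dflt, S.z₀) : S.Pr) ≤ 0 by simp [Prog.cost])
  · exact zero_le

end Strategy

/-! ### Expectations of programs over a finite simulator -/

/-- A simulator with finitely many outcomes `x`, of weight `w n a x` when the action `a` is queried
at the name `n`; the outcome `x` is reported as `ans x`. -/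
structure Sim (A : ℕ) (Y : Type) where
  X : Type
  fin : Fintype X
  w : ℕ → Fin A → X → ℝ
  ans : X → Y
  w_nonneg : ∀ n a x, 0 ≤ w n a x
  w_sum : ∀ n a, ∑ x, w n a x = 1

attribute [instance] Sim.fin

namespace Sim

variable {A : ℕ} {Y : Type} (S : Sim A Y)

/-- The expectation of a function of the answer to a query. -/
def mean (n : ℕ) (a : Fin A) (f : Y → ℝ) : ℝ := ∑ x, S.w n a x * f (S.ans x)

theorem mean_const (n : ℕ) (a : Fin A) (c : ℝ) : S.mean n a (fun _ => c) = c := by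
  rw [mean, ← Finset.sum_mul, S.w_sum, one_mul]

theorem mean_add (n : ℕ) (a : Fin A) (f g : Y → ℝ) :
    S.mean n a (fun y => f y + g y) = S.mean n a f + S.mean n a g := by
  simp [mean, mul_add, Finset.sum_add_distrib]

theorem mean_const_mul (n : ℕ) (a : Fin A) (c : ℝ) (f : Y → ℝ) :
    S.mean n a (fun y => c * f y) = c * S.mean n a f := by
  simp [mean, Finset.mul_sum, mul_left_comm]

theorem mean_sub (n : ℕ) (a : Fin A) (f g : Y → ℝ) :
    S.mean n a (fun y => f y - g y) = S.mean n a f - S.mean n a g := by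
  simp [mean, mul_sub, Finset.sum_sub_distrib]

/-- Monotonicity, where only the answers of positive weight matter. -/
theorem mean_mono' {n : ℕ} {a : Fin A} {f g : Y → ℝ}
    (h : ∀ x, S.w n a x ≠ 0 → f (S.ans x) ≤ g (S.ans x)) : S.mean n a f ≤ S.mean n a g := by
  refine Finset.sum_le_sum fun x _ => ?_
  by_cases hx : S.w n a x = 0
  · simp [hx]
  · exact mul_le_mul_of_nonneg_left (h x hx) (S.w_nonneg n a x)

theorem mean_mono {n : ℕ} {a : Fin A} {f g : Y → ℝ} (h : ∀ y, f y ≤ g y) :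
    S.mean n a f ≤ S.mean n a g := S.mean_mono' fun _ _ => h _

theorem mean_nonneg {n : ℕ} {a : Fin A} {f : Y → ℝ} (h : ∀ y, 0 ≤ f y) : 0 ≤ S.mean n a f :=
  Finset.sum_nonneg fun x _ => mul_nonneg (S.w_nonneg n a x) (h _)

variable {R R' : Type}

/-- The expectation of a function of the result of a program. -/
def ev : Prog A Y R → (R → ℝ) → ℝ
  | .ret r, Φ => Φ r
  | .query n a k, Φ => S.mean n a fun y => ev (k y) Φ

theorem ev_bind (p : Prog A Y R) (f : R → Prog A Y R') (Φ : R' → ℝ) :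
    S.ev (p.bind f) Φ = S.ev p fun r => S.ev (f r) Φ := by
  induction p with
  | ret r => rfl
  | query n a k ih => simp only [Prog.bind, ev, ih]

theorem ev_map (p : Prog A Y R) (f : R → R') (Φ : R' → ℝ) :
    S.ev (p.map f) Φ = S.ev p fun r => Φ (f r) := S.ev_bind p _ Φ

theorem ev_const (p : Prog A Y R) (c : ℝ) : S.ev p (fun _ => c) = c := by
  induction p with
  | ret r => rfl
  | query n a k ih => simp only [ev, ih, mean_const]

theorem ev_add (p : Prog A Y R) (Φ Ψ : R → ℝ) :
    S.ev p (fun r => Φ r + Ψ r) = S.ev p Φ + S.ev p Ψ := by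
  induction p with
  | ret r => rfl
  | query n a k ih => simp only [ev, ih, mean_add]

theorem ev_const_mul (p : Prog A Y R) (c : ℝ) (Φ : R → ℝ) :
    S.ev p (fun r => c * Φ r) = c * S.ev p Φ := by
  induction p with
  | ret r => rfl
  | query n a k ih => simp only [ev, ih, mean_const_mul]

theorem ev_sub (p : Prog A Y R) (Φ Ψ : R → ℝ) :
    S.ev p (fun r => Φ r - Ψ r) = S.ev p Φ - S.ev p Ψ := by
  induction p with
  | ret r => rfl
  | query n a k ih => simp only [ev, ih, mean_sub]

theorem ev_mono (p : Prog A Y R) {Φ Ψ : R → ℝ} (h : ∀ r, Φ r ≤ Ψ r) : S.ev p Φ ≤ S.ev p Ψ := by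
  induction p with
  | ret r => exact h r
  | query n a k ih => exact S.mean_mono ih

theorem ev_nonneg (p : Prog A Y R) {Φ : R → ℝ} (h : ∀ r, 0 ≤ Φ r) : 0 ≤ S.ev p Φ := by
  rw [← S.ev_const p 0]
  exact S.ev_mono p h

theorem ev_sum {ι : Type*} (s : Finset ι) (p : Prog A Y R) (Φ : ι → R → ℝ) :
    S.ev p (fun r => ∑ i ∈ s, Φ i r) = ∑ i ∈ s, S.ev p (Φ i) := by
  classical
  induction s using Finset.induction_on with
  | empty => simp [ev_const]
  | insert i s hi ih => simp only [Finset.sum_insert hi, ev_add, ih]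

end Sim

/-- Every possible result of the program satisfies `φ`. -/
def Prog.All {A : ℕ} {Y R : Type} (φ : R → Prop) : Prog A Y R → Prop
  | .ret r => φ r
  | .query _ _ k => ∀ y, (k y).All φ

theorem Prog.All.bind {A : ℕ} {Y R R' : Type} {φ : R → Prop} {ψ : R' → Prop} {p : Prog A Y R}
    {f : R → Prog A Y R'} (hp : p.All φ) (hf : ∀ r, φ r → (f r).All ψ) : (p.bind f).All ψ := by
  induction p with
  | ret r => exact hf r hp
  | query n a k ih => exact fun y => ih y (hp y)

theorem Prog.All.map {A : ℕ} {Y R R' : Type} {φ : R → Prop} {ψ : R' → Prop} {p : Prog A Y R}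
    {f : R → R'} (hp : p.All φ) (hf : ∀ r, φ r → ψ (f r)) : (p.map f).All ψ := hp.bind hf

theorem Sim.ev_mono_of_all {A : ℕ} {Y R : Type} (S : Sim A Y) {φ : R → Prop} {p : Prog A Y R}
    (hp : p.All φ) {Φ Ψ : R → ℝ} (h : ∀ r, φ r → Φ r ≤ Ψ r) : S.ev p Φ ≤ S.ev p Ψ := by
  induction p with
  | ret r => exact h r hp
  | query n a k ih => exact S.mean_mono fun y => ih y (hp y)

/-! ### The simulator of an MDP -/

/-- The state with a given name (and the final state for a name that is not used). -/
def MDP.stateOf {A H : ℕ} (M : MDP A H) (n : ℕ) : M.states :=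
  if h : n ∈ M.states then ⟨n, h⟩ else ⟨0, M.bot_mem⟩

theorem MDP.stateOf_coe {A H : ℕ} (M : MDP A H) (s : M.states) : M.stateOf s = s := by
  simp [MDP.stateOf]

/-- The numerical value of the reward in an answer. -/
def Answer.rew {κ : ℕ} {G : Type} (y : Answer κ G) : ℝ := (y.1 : ℕ) / (κ : ℝ)

theorem Answer.rew_nonneg {κ : ℕ} {G : Type} (y : Answer κ G) : 0 ≤ y.rew := by
  unfold Answer.rew
  positivity

theorem Answer.rew_le_one {κ : ℕ} {G : Type} (y : Answer κ G) : y.rew ≤ 1 := by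
  unfold Answer.rew
  refine div_le_one_of_le₀ ?_ (by positivity)
  exact_mod_cast Nat.lt_succ_iff.1 y.1.2

theorem level_div_le {κ : ℕ} {r : ℝ} (hr : 0 ≤ r) : ((level κ r : ℕ) : ℝ) / κ ≤ r := by
  rcases Nat.eq_zero_or_pos κ with rfl | hκ
  · simpa using hr
  have hκ' : (0 : ℝ) < κ := by exact_mod_cast hκ
  rw [div_le_iff₀ hκ']
  have h1 : ((level κ r : ℕ) : ℝ) ≤ (⌊κ * r⌋₊ : ℝ) := by
    exact_mod_cast (min_le_right κ ⌊κ * r⌋₊)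
  refine h1.trans ((Nat.floor_le (by positivity)).trans_eq (mul_comm _ _))

theorem le_level_div {κ : ℕ} (hκ : 0 < κ) {r : ℝ} (hr : r ≤ 1) :
    r - 1 / κ ≤ ((level κ r : ℕ) : ℝ) / κ := by
  have hκ' : (0 : ℝ) < κ := by exact_mod_cast hκ
  rw [sub_le_iff_le_add, ← add_div, le_div_iff₀ hκ']
  have h1 : ((level κ r : ℕ) : ℝ) = min (κ : ℝ) (⌊κ * r⌋₊ : ℝ) := by
    simp [level]
  rw [h1]
  rcases min_cases (κ : ℝ) (⌊κ * r⌋₊ : ℝ) with h | h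
  · rw [h.1]; nlinarith
  · rw [h.1]; nlinarith [Nat.lt_floor_add_one ((κ : ℝ) * r)]

namespace FMDP

variable {A H κ : ℕ} {F G : Type} (M : FMDP A H F) (ρ : F → G)

/-- The outcome of a query, with the reward rounded down. -/
def outcome (κ : ℕ) (x : ℝ × M.states) : Fin (κ + 1) × M.states := (level κ x.1, x.2)

theorem measurable_outcome : Measurable (M.outcome κ) := by
  have := measurable_level κ
  unfold outcome
  fun_prop

/-- The finite simulator that describes the digested answers of the simulator of `M`. -/
def sim (κ : ℕ) : Sim A (Answer κ G) where
  X := Fin (κ + 1) × M.states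
  fin := inferInstance
  w n a x := ((M.Q (M.stateOf n) a).map (M.outcome κ)).real {x}
  ans x := (x.1, (x.2 : ℕ), ρ (M.feat x.2))
  w_nonneg _ _ _ := measureReal_nonneg
  w_sum n a := by
    have := M.prob (M.stateOf n) a
    have : IsProbabilityMeasure ((M.Q (M.stateOf n) a).map (M.outcome κ)) :=
      Measure.isProbabilityMeasure_map M.measurable_outcome.aemeasurable
    rw [sum_measureReal_singleton]
    simp

/-- The digest of the answer to a query. -/
def digestAnswer (κ : ℕ) (x : ℝ × M.states) : Answer κ G :=
  (level κ x.1, (x.2 : ℕ), ρ (M.feat x.2))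

theorem integral_digest (s : M.states) (a : Fin A) (Φ : Answer κ G → ℝ) :
    ∫ x, Φ (M.digestAnswer ρ κ x) ∂(M.Q s a) = (M.sim ρ κ).mean s a Φ := by
  have := M.prob s a
  have : IsProbabilityMeasure ((M.Q s a).map (M.outcome κ)) :=
    Measure.isProbabilityMeasure_map M.measurable_outcome.aemeasurable
  have h := integral_map (μ := M.Q s a) M.measurable_outcome.aemeasurable
    (f := fun z : Fin (κ + 1) × M.states => Φ ((M.sim ρ κ).ans z))
    (measurable_of_countable _).aestronglyMeasurable
  refine h.symm.trans ?_
  rw [integral_fintype (.of_finite), Sim.mean]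
  simp only [sim, M.stateOf_coe, smul_eq_mul]
  rfl

theorem lintegral_digest (s : M.states) (a : Fin A) {Φ : Answer κ G → ℝ} (hΦ : ∀ y, 0 ≤ Φ y) :
    ∫⁻ x, ENNReal.ofReal (Φ (M.digestAnswer ρ κ x)) ∂(M.Q s a)
      = ENNReal.ofReal ((M.sim ρ κ).mean s a Φ) := by
  have := M.prob s a
  have hm : Measurable fun x : ℝ × M.states => Φ (M.digestAnswer ρ κ x) :=
    (measurable_of_countable fun z : Fin (κ + 1) × M.states => Φ ((M.sim ρ κ).ans z)).comp
      M.measurable_outcome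
  have hi : Integrable (fun x : ℝ × M.states => Φ (M.digestAnswer ρ κ x)) (M.Q s a) := by
    obtain ⟨C, hC⟩ := (finite_range fun z : Fin (κ + 1) × M.states =>
      ‖Φ ((M.sim ρ κ).ans z)‖).bddAbove
    exact Integrable.of_bound hm.aestronglyMeasurable C (Filter.Eventually.of_forall fun x =>
      hC ⟨M.outcome κ x, rfl⟩)
  rw [← integral_digest, ofReal_integral_eq_lintegral_ofReal hi
    (Filter.Eventually.of_forall fun x => hΦ _)]

/-- An almost sure property of the outcome holds for all outcomes of positive weight. -/
theorem of_weight_ne_zero {s : M.states} {a : Fin A} {φ : M.states → Prop}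
    (h : ∀ᵐ x ∂(M.Q s a), φ x.2) {x : Fin (κ + 1) × M.states}
    (hx : (M.sim ρ κ).w s a x ≠ 0) : φ x.2 := by
  by_contra hφ
  apply hx
  simp only [sim, M.stateOf_coe]
  rw [Measure.real, Measure.map_apply M.measurable_outcome (measurableSet_singleton x)]
  rw [show (M.Q s a) (M.outcome κ ⁻¹' {x}) = 0 from ?_, ENNReal.toReal_zero]
  refine measure_mono_null (fun y hy => ?_) h
  have h2 : y.2 = x.2 := congrArg Prod.snd (hy : M.outcome κ y = x)
  change ¬ φ y.2
  rwa [h2]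

end FMDP

/-! ### Lower bounds on the value of a strategy -/

namespace Strategy

variable {A κ H : ℕ} {F G : Type} [MeasurableSpace F] [MeasurableSpace G]
  [Countable G] [DiscreteMeasurableSpace G] (S : Strategy A κ F G) {M : FMDP A H F}

/-- The digest of a state. -/
def dig (s : M.states) : ℕ × G := ((s : ℕ), S.ρ (M.feat s))

/-- The names of the states encountered. -/
def seenNames (σ : Status M.toMDP) : Set ℕ := {n | ∃ s ∈ σ.seen, (s : ℕ) = n}

/-- Running a program in the interaction, instead of evaluating it on the finite simulator: it suffices
to bound what happens after an action has been returned. -/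
theorem ofReal_ev_le_after {Φ : Fin A × S.Z → ℝ} (hΦ : ∀ r, 0 ≤ Φ r) (p : S.Pr)
    (σ : Status M.toMDP) (hσ : σ.calls < H) (hp : p.Valid (fun y => y.2.1) (seenNames σ))
    (hret : ∀ r σ', σ'.calls = σ.calls → σ'.cur = σ.cur →
      ENNReal.ofReal (Φ r) ≤ S.after M (S.planner.tot M Planner.reward) (.ret r) σ') :
    ENNReal.ofReal ((M.sim S.ρ κ).ev p Φ)
      ≤ S.after M (S.planner.tot M Planner.reward) p σ := by
  have hm := Planner.measurable_tot (Planner.measurable_reward (P := S.planner) (M := M))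
  induction p generalizing σ with
  | ret r => exact hret r σ rfl rfl
  | query n a k ih =>
    obtain ⟨⟨s, hs, rfl⟩, hk⟩ := hp
    rw [after, exec, Planner.lintegral_react_query _ _ hσ s hs (S.measurable_slice hm _), Sim.ev,
      ← FMDP.lintegral_digest _ _ _ _ fun y => Sim.ev_nonneg _ _ hΦ]
    refine lintegral_mono fun x => ?_
    dsimp only
    rw [Planner.tot_eq Planner.measurable_reward, S.lintegral_step hm]
    refine le_add_left ?_
    refine le_trans ?_ (lintegral_mono (f := fun _ => ENNReal.ofReal
      ((M.sim S.ρ κ).ev (k (M.digestAnswer S.ρ κ x)) Φ)) fun ω => ?_)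
    · rw [lintegral_const, measure_univ, mul_one]
    · refine ih (M.digestAnswer S.ρ κ x) (M.answer σ x).2.2 hσ ((hk _).mono ?_) hret
      rintro m (rfl | ⟨s', hs', rfl⟩)
      · exact ⟨x.2, Finset.mem_insert_self _ _, rfl⟩
      · exact ⟨s', Finset.mem_insert_of_mem hs', rfl⟩

/-- The expected reward of the action `r.1` at `x`, plus `V r.2` at the next state. -/
def lookahead (M : FMDP A H F) (V : S.Z → ℕ × G → ℝ) (x : ℕ × G) (r : Fin A × S.Z) : ℝ :=
  (M.sim S.ρ κ).mean x.1 r.1 fun y => y.rew + V r.2 y.2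

variable {S} in
/-- The hypotheses under which `V h z x` bounds from below the expected reward of the last `h` calls
from a state with digest `x`, when the memory is `z`. -/
structure IsLowerValue (M : FMDP A H F) (V : ℕ → S.Z → ℕ × G → ℝ) : Prop where
  valid : ∀ z ω x, (S.call z ω x).Valid (fun y => y.2.1) {x.1}
  nonneg : ∀ h z x, 0 ≤ V h z x
  zero : ∀ z x, V 0 z x = 0
  succ : ∀ h z ω x, V (h + 1) z x ≤ (M.sim S.ρ κ).ev (S.call z ω x) (S.lookahead M (V h) x)

variable {S}

omit [Countable G] [DiscreteMeasurableSpace G] in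
theorem IsLowerValue.lookahead_nonneg {V : ℕ → S.Z → ℕ × G → ℝ} (hV : IsLowerValue M V) (h : ℕ)
    (x : ℕ × G) (r : Fin A × S.Z) : 0 ≤ S.lookahead M (V h) x r :=
  Sim.mean_nonneg _ fun y => add_nonneg y.rew_nonneg (hV.nonneg _ _ _)

theorem IsLowerValue.le_after {V : ℕ → S.Z → ℕ × G → ℝ} (hV : IsLowerValue M V) {h : ℕ}
    (hle : ∀ (z : S.Z) (s : M.states) (σ : Status M.toMDP) (r : ℝ), σ.cur = s → s ∈ σ.seen →
      h + σ.calls = H → ENNReal.ofReal r + ENNReal.ofReal (V h z (S.dig s)) ≤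
        S.planner.tot M Planner.reward ((Sum.inl z, .inl ((s : ℕ), M.feat s)), (r, σ)))
    (z : S.Z) (ω : S.Ω) (s : M.states) (σ : Status M.toMDP) (hcur : σ.cur = s) (hs : s ∈ σ.seen)
    (hσ : h + 1 + σ.calls = H) :
    ENNReal.ofReal ((M.sim S.ρ κ).ev (S.call z ω (S.dig s)) (S.lookahead M (V h) (S.dig s)))
      ≤ S.after M (S.planner.tot M Planner.reward) (S.call z ω (S.dig s)) σ := by
  have hm := Planner.measurable_tot (Planner.measurable_reward (P := S.planner) (M := M))
  refine S.ofReal_ev_le_after (hV.lookahead_nonneg h _) _ σ (by omega)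
    ((hV.valid z ω _).mono ?_) fun r σ' h1 h2 => ?_
  · rintro m rfl
    exact ⟨s, hs, rfl⟩
  · rw [S.after_ret hm _ _ (by omega), h2, hcur, lookahead, dig,
      ← FMDP.lintegral_digest _ _ _ _ fun y => add_nonneg y.rew_nonneg (hV.nonneg _ _ _)]
    refine lintegral_mono_ae ?_
    filter_upwards [MDP.ae_reward s r.1] with x hx
    refine le_trans ?_ (hle r.2 x.2 (M.advance σ' x).2.2 x.1 rfl (Finset.mem_insert_self _ _) ?_)
    · rw [← ENNReal.ofReal_add hx.1 (hV.nonneg _ _ _)]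
      exact ENNReal.ofReal_le_ofReal (add_le_add (level_div_le hx.1) le_rfl)
    · change h + (σ'.calls + 1) = H
      omega

theorem IsLowerValue.le_tot {V : ℕ → S.Z → ℕ × G → ℝ} (hV : IsLowerValue M V) (h : ℕ) (z : S.Z)
    (s : M.states) (σ : Status M.toMDP) (r : ℝ) (hcur : σ.cur = s) (hs : s ∈ σ.seen)
    (hσ : h + σ.calls = H) :
    ENNReal.ofReal r + ENNReal.ofReal (V h z (S.dig s)) ≤
      S.planner.tot M Planner.reward ((Sum.inl z, .inl ((s : ℕ), M.feat s)), (r, σ)) := by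
  have hm := Planner.measurable_tot (Planner.measurable_reward (P := S.planner) (M := M))
  induction h generalizing z s σ r with
  | zero =>
    rw [hV.zero, ENNReal.ofReal_zero, add_zero, Planner.tot_eq Planner.measurable_reward]
    exact le_self_add
  | succ h ih =>
    rw [Planner.tot_eq Planner.measurable_reward, S.lintegral_step hm]
    refine add_le_add le_rfl ?_
    refine le_trans ?_ (lintegral_mono (f := fun _ => ENNReal.ofReal (V (h + 1) z (S.dig s)))
      fun ω => ?_)
    · rw [lintegral_const, measure_univ, mul_one]
    · exact (ENNReal.ofReal_le_ofReal (hV.succ h z ω _)).trans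
        (hV.le_after (fun z s σ r h1 h2 h3 => ih z s σ r h1 h2 h3) z ω s σ hcur hs hσ)

/-- The value of a strategy is at least the expectation, over the coin of the first call, of the
expected reward of the first action plus the lower bound for the rest of the episode. -/
theorem IsLowerValue.le_value {V : ℕ → S.Z → ℕ × G → ℝ} (hV : IsLowerValue M V) (hH : 0 < H)
    (s₀ : M.states) :
    ∫⁻ ω, ENNReal.ofReal ((M.sim S.ρ κ).ev (S.call S.z₀ ω (S.dig s₀))
      (S.lookahead M (V (H - 1)) (S.dig s₀))) ∂S.ν ≤ S.planner.value M s₀ := by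
  have hm := Planner.measurable_tot (Planner.measurable_reward (P := S.planner) (M := M))
  rw [Planner.value_eq_tot, Planner.tot_eq Planner.measurable_reward, S.lintegral_step hm]
  refine le_add_left (lintegral_mono fun ω => ?_)
  refine hV.le_after (fun z s σ r h1 h2 h3 => hV.le_tot _ z s σ r h1 h2 h3) S.z₀ ω s₀ _ rfl
    (Finset.mem_singleton_self _) ?_
  simp only [Planner.start]
  omega

end Strategy

/-! ### The elliptical potential -/

namespace Potential

open Matrix

variable {J : Type*} [Fintype J]

/-- The list `C` (latest element first) has the eluder property: each of its elements pairs
significantly with some bounded vector that pairs negligibly with all the earlier elements. -/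
def Chain (e e' L W : ℝ) : List (J → ℝ) → Prop
  | [] => True
  | T :: C => Chain e e' L W C ∧ T ⬝ᵥ T ≤ L ∧
      ∃ w : J → ℝ, w ⬝ᵥ w ≤ W ∧ (∀ T' ∈ C, |T' ⬝ᵥ w| ≤ e') ∧ e ≤ |T ⬝ᵥ w|

theorem Chain.norm_le {e e' L W : ℝ} {C : List (J → ℝ)} (h : Chain e e' L W C) :
    ∀ T ∈ C, T ⬝ᵥ T ≤ L := by
  induction C with
  | nil => simp
  | cons T C ih =>
    intro T' hT'
    rcases List.mem_cons.1 hT' with rfl | h'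
    · exact h.2.1
    · exact ih h.1 T' h'

theorem Chain.suffix {e e' L W : ℝ} {C C' : List (J → ℝ)} (h : Chain e e' L W C)
    (hC : C' <:+ C) : Chain e e' L W C' := by
  induction C with
  | nil => rw [List.suffix_nil.1 hC]; trivial
  | cons T C ih =>
    rcases List.suffix_cons_iff.1 hC with rfl | h'
    · exact h
    · exact ih h.1 h'

variable [DecidableEq J]

/-- The regularized Gram matrix of a list of vectors. -/
def gram (l : ℝ) : List (J → ℝ) → Matrix J J ℝ
  | [] => l • 1
  | T :: C => gram l C + vecMulVec T T

theorem gram_posDef {l : ℝ} (hl : 0 < l) (C : List (J → ℝ)) : (gram l C).PosDef := by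
  induction C with
  | nil => exact PosDef.one.smul hl
  | cons T C ih =>
    have h := posSemidef_vecMulVec_self_star T
    rw [star_trivial] at h
    exact ih.add_posSemidef h

theorem quad_gram (l : ℝ) (C : List (J → ℝ)) (w : J → ℝ) :
    w ⬝ᵥ (gram l C *ᵥ w) = l * (w ⬝ᵥ w) + (C.map fun T => (T ⬝ᵥ w) ^ 2).sum := by
  induction C with
  | nil => simp [gram, smul_mulVec, dotProduct_smul]
  | cons T C ih =>
    rw [gram, add_mulVec, dotProduct_add, ih, vecMulVec_mulVec, List.map_cons, List.sum_cons,
      dotProduct_smul, dotProduct_comm w T]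
    simp only [op_smul_eq_smul, smul_eq_mul]
    ring

theorem trace_gram_le (l L : ℝ) (C : List (J → ℝ)) (hC : ∀ T ∈ C, T ⬝ᵥ T ≤ L) :
    (gram l C).trace ≤ Fintype.card J * l + C.length * L := by
  induction C with
  | nil => simp [gram, mul_comm]
  | cons T C ih =>
    have h1 := ih fun T' h => hC T' (List.mem_cons_of_mem _ h)
    have h2 := hC T List.mem_cons_self
    rw [gram, trace_add, trace_vecMulVec, List.length_cons]
    push_cast
    linarith

theorem det_gram_cons {l : ℝ} (hl : 0 < l) (T : J → ℝ) (C : List (J → ℝ)) :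
    (gram l (T :: C)).det = (gram l C).det * (1 + T ⬝ᵥ ((gram l C)⁻¹ *ᵥ T)) := by
  have hu : IsUnit (gram l C).det := (gram_posDef hl C).det_pos.ne'.isUnit
  rw [gram, vecMulVec_eq Unit, det_add_replicateCol_mul_replicateRow hu]
  congr 1
  rw [det_unique, Matrix.add_apply, one_apply_eq, Matrix.mul_assoc]
  rfl

/-- A vector that pairs with `w` as much as `w` weighs in the metric of `V` is at least of unit
length in the dual metric: the Cauchy-Schwarz inequality. -/
theorem one_le_dual {V : Matrix J J ℝ} (hV : V.PosDef) {T w : J → ℝ}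
    {e : ℝ} (he : 0 < e) (hw : w ⬝ᵥ (V *ᵥ w) ≤ e) (hT : e ≤ (T ⬝ᵥ w) ^ 2) :
    1 ≤ T ⬝ᵥ (V⁻¹ *ᵥ T) := by
  set y := V⁻¹ *ᵥ T with hy
  have hu : IsUnit V.det := hV.det_pos.ne'.isUnit
  have hVy : V *ᵥ y = T := by rw [hy, mulVec_mulVec, mul_nonsing_inv _ hu, one_mulVec]
  have hsymm : ∀ u v : J → ℝ, u ⬝ᵥ (V *ᵥ v) = v ⬝ᵥ (V *ᵥ u) := by
    intro u v
    have h : Vᵀ = V := by simpa using hV.isHermitian.eq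
    rw [dotProduct_mulVec, ← mulVec_transpose, h, dotProduct_comm]
  set c := (T ⬝ᵥ w) / e with hc
  have h0 : 0 ≤ (y - c • w) ⬝ᵥ (V *ᵥ (y - c • w)) := by
    simpa using hV.posSemidef.dotProduct_mulVec_nonneg (y - c • w)
  have h1 : (y - c • w) ⬝ᵥ (V *ᵥ (y - c • w))
      = T ⬝ᵥ y - 2 * c * (T ⬝ᵥ w) + c ^ 2 * (w ⬝ᵥ (V *ᵥ w)) := by
    rw [mulVec_sub, mulVec_smul, sub_dotProduct, dotProduct_sub, dotProduct_sub,
      smul_dotProduct, smul_dotProduct, dotProduct_smul, dotProduct_smul, hsymm y w, hVy,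
      dotProduct_comm y T, dotProduct_comm w T]
    simp only [smul_eq_mul]
    ring
  have h2 : c * e = T ⬝ᵥ w := by rw [hc]; field_simp
  have h3 : c ^ 2 * (w ⬝ᵥ (V *ᵥ w)) ≤ c ^ 2 * e := mul_le_mul_of_nonneg_left hw (sq_nonneg c)
  have h4 : 1 ≤ c * (T ⬝ᵥ w) := by
    rw [hc, div_mul_eq_mul_div, le_div_iff₀ he]
    nlinarith
  have h5 : c ^ 2 * e = c * (T ⬝ᵥ w) := by rw [← h2]; ring
  linarith

/-- By the matrix determinant lemma, each element of a list with the eluder property multiplies the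
determinant of the Gram matrix by at least `2`. -/
theorem Chain.det_ge {e e' L W : ℝ} (he : 0 < e) (hW : 0 < W) {C : List (J → ℝ)}
    (h : Chain e e' L W C) (hC : C.length * e' ^ 2 ≤ e ^ 2 / 2) :
    2 ^ C.length * (e ^ 2 / (2 * W)) ^ Fintype.card J ≤ (gram (e ^ 2 / (2 * W)) C).det := by
  have hl : 0 < e ^ 2 / (2 * W) := by positivity
  induction C with
  | nil => simp [gram]
  | cons T C ih =>
    obtain ⟨hc, -, w, hw, hw', hT⟩ := h
    have hlen : (C.length : ℝ) * e' ^ 2 ≤ e ^ 2 / 2 := by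
      rw [List.length_cons] at hC
      push_cast at hC
      nlinarith [sq_nonneg e']
    have h1 := ih hc hlen
    have hsum : (C.map fun T => (T ⬝ᵥ w) ^ 2).sum ≤ C.length * e' ^ 2 := by
      have := List.sum_le_card_nsmul (C.map fun T => (T ⬝ᵥ w) ^ 2) (e' ^ 2) (by
        intro x hx
        obtain ⟨T', hT', rfl⟩ := List.mem_map.1 hx
        exact sq_le_sq' (abs_le.1 (hw' T' hT')).1 (abs_le.1 (hw' T' hT')).2)
      simpa using this
    have hq : w ⬝ᵥ (gram (e ^ 2 / (2 * W)) C *ᵥ w) ≤ e ^ 2 := by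
      rw [quad_gram]
      have : e ^ 2 / (2 * W) * (w ⬝ᵥ w) ≤ e ^ 2 / (2 * W) * W :=
        mul_le_mul_of_nonneg_left hw hl.le
      have h2 : e ^ 2 / (2 * W) * W = e ^ 2 / 2 := by field_simp
      linarith
    have hT2 : e ^ 2 ≤ (T ⬝ᵥ w) ^ 2 := by
      rw [← sq_abs (T ⬝ᵥ w)]
      exact pow_le_pow_left₀ he.le hT 2
    have h3 := one_le_dual (gram_posDef hl C) (by positivity) hq hT2
    rw [det_gram_cons hl, List.length_cons, pow_succ]
    have h4 : 0 < (gram (e ^ 2 / (2 * W)) C).det := (gram_posDef hl C).det_pos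
    nlinarith

theorem det_le_trace_pow {V : Matrix J J ℝ} (hV : V.PosDef) :
    V.det ≤ V.trace ^ Fintype.card J := by
  have hpos := hV.eigenvalues_pos
  rw [hV.isHermitian.det_eq_prod_eigenvalues, hV.isHermitian.trace_eq_sum_eigenvalues]
  simp only [RCLike.ofReal_real_eq_id, id]
  refine (Finset.prod_le_prod (fun i _ => (hpos i).le) fun i _ =>
    Finset.single_le_sum (fun j _ => (hpos j).le) (Finset.mem_univ i)).trans_eq ?_
  simp

/-- The length of a list with the eluder property is bounded, essentially linearly in the
dimension, by comparing the determinant of the Gram matrix with its trace. -/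
theorem Chain.two_pow_le {e e' L W : ℝ} (he : 0 < e) (hW : 0 < W) {C : List (J → ℝ)}
    (h : Chain e e' L W C) (hC : C.length * e' ^ 2 ≤ e ^ 2 / 2) :
    2 ^ C.length ≤ (Fintype.card J + C.length * (2 * L * W / e ^ 2)) ^ Fintype.card J := by
  set l := e ^ 2 / (2 * W) with hl
  have hl0 : 0 < l := by positivity
  have h1 := h.det_ge he hW hC
  have h2 := det_le_trace_pow (gram_posDef hl0 C)
  have h3 := trace_gram_le l L C h.norm_le
  have h4 : 0 ≤ (gram l C).trace := (gram_posDef hl0 C).posSemidef.trace_nonneg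
  have h5 : (2 : ℝ) ^ C.length * l ^ Fintype.card J
      ≤ (Fintype.card J * l + C.length * L) ^ Fintype.card J :=
    h1.trans (h2.trans (pow_le_pow_left₀ h4 h3 _))
  have h6 : (Fintype.card J * l + C.length * L)
      = (Fintype.card J + C.length * (2 * L * W / e ^ 2)) * l := by
    rw [hl]; field_simp
  rw [h6, mul_pow] at h5
  exact le_of_mul_le_mul_right h5 (by positivity)

/-- If the potential excludes the length `m`, it excludes all greater lengths, since the oldest `m`
elements of a list with the eluder property have it too. -/
theorem Chain.length_lt {e e' L W : ℝ} (he : 0 < e) (hW : 0 < W) {C : List (J → ℝ)}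
    (h : Chain e e' L W C) {m : ℕ} (hm : m * e' ^ 2 ≤ e ^ 2 / 2)
    (hm' : (Fintype.card J + m * (2 * L * W / e ^ 2)) ^ Fintype.card J < 2 ^ m) :
    C.length < m := by
  by_contra! hlt
  have hs : C.drop (C.length - m) <:+ C := List.drop_suffix _ _
  have hlen : (C.drop (C.length - m)).length = m := by rw [List.length_drop]; omega
  have h1 := (h.suffix hs).two_pow_le he hW (by rw [hlen]; exact hm)
  rw [hlen] at h1
  linarith

end Potential

/-! ### Estimation by sampling -/

section Estimation

variable {A : ℕ} {Y ι : Type}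

/-- Query `(n, a)` a number of times and add up the vectors `g y` of the answers `y`. -/
def sampleSum (n : ℕ) (a : Fin A) (g : Y → ι → ℝ) : ℕ → Prog A Y (ι → ℝ)
  | 0 => .ret 0
  | m + 1 => .query n a fun y => (sampleSum n a g m).map (g y + ·)

/-- Averages of `N` samples of each of the `j` vectors `g i`, at the name `n` and the actions
`b i`. -/
def estimate (n N : ℕ) : (j : ℕ) → (Fin j → Fin A) → (Fin j → Y → ι → ℝ) →
    Prog A Y (Fin j → ι → ℝ)
  | 0, _, _ => .ret Fin.elim0
  | j + 1, b, g => (sampleSum n (b 0) (g 0) N).bind fun s =>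
      (estimate n N j (Fin.tail b) (Fin.tail g)).map
        (Fin.cons (α := fun _ => ι → ℝ) ((N : ℝ)⁻¹ • s))

theorem sampleSum_cost (n : ℕ) (a : Fin A) (g : Y → ι → ℝ) (m : ℕ) :
    (sampleSum n a g m).cost ≤ m := by
  induction m with
  | zero => simp [sampleSum, Prog.cost]
  | succ m ih =>
    rw [sampleSum, Prog.cost]
    push_cast
    rw [add_comm]
    exact add_le_add (iSup_le fun y => (Prog.cost_map_le _ _).trans ih) le_rfl

theorem estimate_cost (n N : ℕ) (j : ℕ) (b : Fin j → Fin A) (g : Fin j → Y → ι → ℝ) :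
    (estimate n N j b g).cost ≤ (j * N : ℕ) := by
  induction j with
  | zero => simp [estimate, Prog.cost]
  | succ j ih =>
    rw [estimate]
    refine (Prog.cost_bind_le _ (fun s => (Prog.cost_map_le _ _).trans (ih _ _)) _).trans ?_
    refine (add_le_add (sampleSum_cost _ _ _ _) le_rfl).trans_eq ?_
    push_cast
    ring

theorem sampleSum_valid (name : Y → ℕ) (n : ℕ) (a : Fin A) (g : Y → ι → ℝ) (m : ℕ) {t : Set ℕ}
    (ht : n ∈ t) : (sampleSum n a g m).Valid name t := by
  induction m generalizing t with
  | zero => trivial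
  | succ m ih => exact ⟨ht, fun y => (ih (mem_insert_of_mem _ ht)).map _⟩

theorem estimate_valid (name : Y → ℕ) (n N : ℕ) (j : ℕ) (b : Fin j → Fin A)
    (g : Fin j → Y → ι → ℝ) {t : Set ℕ} (ht : n ∈ t) : (estimate n N j b g).Valid name t := by
  induction j with
  | zero => trivial
  | succ j ih => exact (sampleSum_valid name n _ _ N ht).bind fun s => (ih _ _).map _

theorem sampleSum_all (n : ℕ) (a : Fin A) {g : Y → ι → ℝ} (hg : ∀ y i, |g y i| ≤ 1) (m : ℕ) :
    (sampleSum n a g m).All fun s => ∀ i, |s i| ≤ (m : ℝ) := by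
  induction m with
  | zero => intro i; simp
  | succ m ih =>
    refine fun y => ih.map fun s hs i => ?_
    refine (abs_add_le _ _).trans ?_
    push_cast
    linarith [hg y i, hs i]

theorem estimate_all (n N : ℕ) (j : ℕ) (b : Fin j → Fin A) {g : Fin j → Y → ι → ℝ}
    (hg : ∀ k y i, |g k y i| ≤ 1) : (estimate n N j b g).All fun T => ∀ k i, |T k i| ≤ 1 := by
  induction j with
  | zero => intro k; exact k.elim0
  | succ j ih =>
    refine (sampleSum_all n (b 0) (hg 0) N).bind fun s hs =>
      (ih (Fin.tail b) (fun k => hg k.succ)).map fun T hT k => ?_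
    refine Fin.cases (fun i => ?_) (fun k => ?_) k
    · simp only [Fin.cons_zero, Pi.smul_apply, smul_eq_mul, abs_mul, abs_inv, Nat.abs_cast]
      calc (N : ℝ)⁻¹ * |s i| ≤ (N : ℝ)⁻¹ * N := mul_le_mul_of_nonneg_left (hs i) (by positivity)
        _ ≤ 1 := inv_mul_le_one
    · simpa using hT k

variable [Fintype ι] (S : Sim A Y)

theorem sampleSum_variance (n : ℕ) (a : Fin A) (g : Y → ι → ℝ) (θ : ι → ℝ) {R : ℝ}
    (hR : ∀ y, |g y ⬝ᵥ θ| ≤ R) (m : ℕ) :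
    S.ev (sampleSum n a g m) (fun s => (s ⬝ᵥ θ - m * S.mean n a fun y => g y ⬝ᵥ θ) ^ 2)
      ≤ m * R ^ 2 := by
  set μ := S.mean n a fun y => g y ⬝ᵥ θ with hμ
  induction m with
  | zero => simp [sampleSum, Sim.ev]
  | succ m ih =>
    rw [sampleSum, Sim.ev]
    simp only [Sim.ev_map]
    set p := sampleSum n a g m
    set E2 := S.ev p (fun s => (s ⬝ᵥ θ - m * μ) ^ 2)
    set E1 := S.ev p (fun s => (s ⬝ᵥ θ - m * μ))
    have h1 : ∀ y, S.ev p (fun s => ((g y + s) ⬝ᵥ θ - ((m + 1 : ℕ) : ℝ) * μ) ^ 2)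
        = E2 + ((2 * E1) * (g y ⬝ᵥ θ - μ) + (g y ⬝ᵥ θ - μ) ^ 2) := by
      intro y
      have : ∀ s : ι → ℝ, ((g y + s) ⬝ᵥ θ - ((m + 1 : ℕ) : ℝ) * μ) ^ 2
          = (s ⬝ᵥ θ - m * μ) ^ 2 + ((2 * (g y ⬝ᵥ θ - μ)) * (s ⬝ᵥ θ - m * μ)
            + (g y ⬝ᵥ θ - μ) ^ 2) := by
        intro s
        rw [add_dotProduct]
        push_cast
        ring
      simp only [this, Sim.ev_add, Sim.ev_const_mul, Sim.ev_const]
      simp only [E2, E1]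
      ring
    simp only [h1, Sim.mean_add, Sim.mean_const, Sim.mean_const_mul, Sim.mean_sub]
    rw [← hμ, sub_self, mul_zero, zero_add]
    have h2 : S.mean n a (fun y => (g y ⬝ᵥ θ - μ) ^ 2) ≤ R ^ 2 := by
      have h3 : ∀ y, (g y ⬝ᵥ θ - μ) ^ 2 = (g y ⬝ᵥ θ) ^ 2 - ((2 * μ) * (g y ⬝ᵥ θ) - μ ^ 2) :=
        fun y => by ring
      have h4 : S.mean n a (fun y => (g y ⬝ᵥ θ) ^ 2) ≤ R ^ 2 := by
        rw [← S.mean_const n a (R ^ 2)]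
        exact S.mean_mono fun y => sq_le_sq' (abs_le.1 (hR y)).1 (abs_le.1 (hR y)).2
      simp only [h3, Sim.mean_sub, Sim.mean_const_mul, Sim.mean_const]
      rw [← hμ]
      nlinarith [sq_nonneg μ]
    push_cast
    linarith

/-- The expected squared error of the estimates in a given direction. -/
theorem estimate_variance {n N : ℕ} (hN : 0 < N) (θ : ι → ℝ) {R : ℝ} (j : ℕ) (b : Fin j → Fin A)
    (g : Fin j → Y → ι → ℝ) (hR : ∀ k y, |g k y ⬝ᵥ θ| ≤ R) :
    S.ev (estimate n N j b g)
      (fun T => ∑ k, (T k ⬝ᵥ θ - S.mean n (b k) fun y => g k y ⬝ᵥ θ) ^ 2) ≤ j * R ^ 2 / N := by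
  have hN' : (0 : ℝ) < N := by exact_mod_cast hN
  induction j with
  | zero => simp [estimate, Sim.ev]
  | succ j ih =>
    rw [estimate, Sim.ev_bind]
    simp only [Sim.ev_map, Fin.sum_univ_succ, Fin.cons_zero, Fin.cons_succ, Sim.ev_add,
      Sim.ev_const]
    have h1 := ih (Fin.tail b) (Fin.tail g) fun k => hR k.succ
    have h2 := sampleSum_variance S n (b 0) (g 0) θ (hR 0) N
    set μ := S.mean n (b 0) fun y => g 0 y ⬝ᵥ θ
    have h3 : ∀ s : ι → ℝ, (((N : ℝ)⁻¹ • s) ⬝ᵥ θ - μ) ^ 2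
        = ((N : ℝ)⁻¹) ^ 2 * (s ⬝ᵥ θ - N * μ) ^ 2 := by
      intro s
      rw [smul_dotProduct, smul_eq_mul]
      field_simp
    simp only [h3, Sim.ev_const_mul]
    have h4 : ((N : ℝ)⁻¹) ^ 2 * (N * R ^ 2) = R ^ 2 / N := by field_simp
    have h5 : ((N : ℝ)⁻¹) ^ 2 * S.ev (sampleSum n (b 0) (g 0) N) (fun s => (s ⬝ᵥ θ - N * μ) ^ 2)
        ≤ R ^ 2 / N := by
      rw [← h4]
      exact mul_le_mul_of_nonneg_left h2 (by positivity)
    have h6 : ((j + 1 : ℕ) : ℝ) * R ^ 2 / N = R ^ 2 / N + j * R ^ 2 / N := by push_cast; ring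
    rw [h6]
    exact add_le_add h5 h1

end Estimation

/-! ### The planning algorithm -/

/-- Digested features: rounded numerators of the features of all the actions. State features are
regarded as features that do not depend on the action. -/
abbrev Feat (A d : ℕ) : Type := Fin A → Fin d → ℤ

/-- Vectors with an additional coordinate `none`, which takes the rewards. -/
abbrev Vec (d : ℕ) : Type := Option (Fin d) → ℝ

/-- The feature vector of an observed state and an action. The value of the final state is known to
be `0`, so that its features are replaced by `0`. -/
def feature {A d : ℕ} (κ : ℕ) (x : ℕ × Feat A d) (a : Fin A) : Vec d
  | none => 0
  | some i => if x.1 = 0 then 0 else max (-1) (min 1 ((x.2 a i : ℝ) / κ))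

/-- The vector of an answer: the reward, and the feature vector of the next state with `a`. -/
def outcomeVec {A d κ : ℕ} (a : Fin A) (y : Answer κ (Feat A d)) : Vec d
  | none => y.rew
  | some i => feature κ y.2 a (some i)

theorem abs_feature_le {A d : ℕ} (κ : ℕ) (x : ℕ × Feat A d) (a : Fin A) (i : Option (Fin d)) :
    |feature κ x a i| ≤ 1 := by
  cases i with
  | none => simp [feature]
  | some i =>
    rw [feature]
    split_ifs
    · simp
    · exact abs_le.2 ⟨le_max_left _ _, max_le (by norm_num) (min_le_left _ _)⟩

theorem abs_outcomeVec_le {A d κ : ℕ} (a : Fin A) (y : Answer κ (Feat A d)) (i : Option (Fin d)) :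
    |outcomeVec a y i| ≤ 1 := by
  cases i with
  | none => exact abs_le.2 ⟨by linarith [y.rew_nonneg, show outcomeVec a y none = y.rew from rfl],
      y.rew_le_one⟩
  | some i => exact abs_feature_le κ y.2 a (some i)

/-- The product over the actions of the pairings with `θ`. If `D a` is the vector whose pairing
with `θ` is the temporal difference of the action `a` under the hypothesis `θ`, then the Bellman
equation makes this product vanish. -/
def tens {A d : ℕ} (D : Fin A → Vec d) (θ : Vec d) : ℝ := ∏ a, D a ⬝ᵥ θ

/-- The parameters of the algorithm: reward and features are rounded to multiples of `1 / κ`,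
`N` samples are used for an estimate, `ε` and `ε'` are the thresholds at which the product of the
temporal differences is considered as large or as small, `η` is the accuracy of the estimates and of
the optimization, hypotheses lie in the box of radius `B`, and `sel a a'` is the action to be
queried when `a` has been chosen for the present state and `a'` is chosen for the next node. -/
structure Params (A : ℕ) where
  κ : ℕ
  N : ℕ
  ε : ℝ
  ε' : ℝ
  η : ℝ
  B : ℝ
  sel : Fin A → Fin A → Fin A

namespace Params

variable {A d : ℕ} (P : Params A)

/-- The box of hypotheses. -/
def hyp (d : ℕ) : Set (Vec d) := {θ | θ none = 1 ∧ ∀ i, |θ (some i)| ≤ P.B}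

/-- The hypotheses for which all the recorded products are small. -/
def Consistent (C : List (Fin A → Vec d)) (θ : Vec d) : Prop :=
  θ ∈ P.hyp d ∧ ∀ D ∈ C, |tens D θ| ≤ P.ε'

/-- Estimates of the temporal difference vectors at a node. -/
def tdEst (x : ℕ × Feat A d) (a : Fin A) : Prog A (Answer P.κ (Feat A d)) (Fin A → Vec d) :=
  (estimate x.1 P.N A (P.sel a) outcomeVec).map fun T a' => T a' - feature P.κ x a

variable [NeZero A]

/-- The action whose temporal difference is smallest in absolute value. -/
def best (D : Fin A → Vec d) (θ : Vec d) : Fin A :=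
  (Finite.exists_min fun a => |D a ⬝ᵥ θ|).choose

omit P in
theorem best_spec (D : Fin A → Vec d) (θ : Vec d) (a : Fin A) :
    |D (best D θ) ⬝ᵥ θ| ≤ |D a ⬝ᵥ θ| := (Finite.exists_min fun a => |D a ⬝ᵥ θ|).choose_spec a

/-- Simulate `h` steps of the policy that follows the hypothesis `θ`; stop and return the temporal
difference vectors as soon as their product is large. -/
def roll (θ : Vec d) : ℕ → ℕ × Feat A d → Fin A →
    Prog A (Answer P.κ (Feat A d)) (Option (Fin A → Vec d))
  | 0, _, _ => .ret none
  | h + 1, x, a => (P.tdEst x a).bind fun D =>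
      open Classical in
      if P.ε ≤ |tens D θ| then .ret (some D)
      else .query x.1 (P.sel a (best D θ)) fun y => roll θ h y.2 (best D θ)

theorem exists_optimistic (x : ℕ × Feat A d) (C : List (Fin A → Vec d)) (hη : 0 < P.η)
    (hC : ∃ θ, P.Consistent C θ) : ∃ p : Vec d × Fin A, P.Consistent C p.1 ∧
      ∀ θ a, P.Consistent C θ → feature P.κ x a ⬝ᵥ θ - P.η ≤ feature P.κ x p.2 ⬝ᵥ p.1 := by
  let s : Set ℝ := {r | ∃ θ a, P.Consistent C θ ∧ r = feature P.κ x a ⬝ᵥ θ}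
  obtain ⟨θ₀, h₀⟩ := hC
  have hne : s.Nonempty := ⟨_, θ₀, 0, h₀, rfl⟩
  have hbdd : BddAbove s := by
    refine ⟨∑ i : Option (Fin d), max 1 P.B, ?_⟩
    rintro _ ⟨θ, a, hθ, rfl⟩
    refine Finset.sum_le_sum fun i _ => (le_abs_self _).trans ?_
    rw [abs_mul]
    have h2 : |θ i| ≤ max 1 P.B := by
      cases i with
      | none => rw [hθ.1.1]; simp
      | some i => exact (hθ.1.2 i).trans (le_max_right _ _)
    have h3 := mul_le_mul (abs_feature_le P.κ x a i) h2 (abs_nonneg _) zero_le_one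
    rwa [one_mul] at h3
  obtain ⟨_, ⟨θ, a, hθ, rfl⟩, hlt⟩ := exists_lt_of_lt_csSup hne
    (sub_lt_self (sSup s) hη)
  exact ⟨(θ, a), hθ, fun θ' a' h' => by
    linarith [le_csSup hbdd ⟨θ', a', h', rfl⟩]⟩

open Classical in
/-- An optimistic consistent hypothesis and first action (up to `η`). -/
def opt (x : ℕ × Feat A d) (C : List (Fin A → Vec d)) : Vec d × Fin A :=
  if h : ∃ p : Vec d × Fin A, P.Consistent C p.1 ∧
      ∀ θ a, P.Consistent C θ → feature P.κ x a ⬝ᵥ θ - P.η ≤ feature P.κ x p.2 ⬝ᵥ p.1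
    then h.choose else (0, 0)

theorem opt_spec (x : ℕ × Feat A d) (C : List (Fin A → Vec d)) (hη : 0 < P.η)
    (hC : ∃ θ, P.Consistent C θ) : P.Consistent C (P.opt x C).1 ∧
      ∀ θ a, P.Consistent C θ →
        feature P.κ x a ⬝ᵥ θ - P.η ≤ feature P.κ x (P.opt x C).2 ⬝ᵥ (P.opt x C).1 := by
  have h := P.exists_optimistic x C hη hC
  rw [opt, dif_pos h]
  exact h.choose_spec

/-- Record the outcome of a simulated episode. -/
def record (C : List (Fin A → Vec d)) (o : Option (Fin A → Vec d)) : List (Fin A → Vec d) :=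
  o.elim C (· :: C)

/-- `k` simulated episodes from `x`, each of `H` steps, starting with the constraints `C`. -/
def train (H : ℕ) (x : ℕ × Feat A d) : ℕ → List (Fin A → Vec d) →
    Prog A (Answer P.κ (Feat A d)) (List (Fin A → Vec d))
  | 0, C => .ret C
  | k + 1, C => ((P.roll (P.opt x C).1 H x (P.opt x C).2).map (record C)).bind (train H x k)

/-- Choose an action following the hypothesis `θ`, where `a` is the action of the present node. -/
def act (θ : Vec d) (x : ℕ × Feat A d) (a : Fin A) :
    Prog A (Answer P.κ (Feat A d)) (Fin A × Option (Vec d × Fin A)) :=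
  (P.tdEst x a).map fun D => (P.sel a (best D θ), some (θ, best D θ))

/-- The program of a call: in the first call, `k` simulated episodes to find a hypothesis, which is
then followed. -/
def call (H : ℕ) (z : Option (Vec d × Fin A)) (k : ℕ) (x : ℕ × Feat A d) :
    Prog A (Answer P.κ (Feat A d)) (Fin A × Option (Vec d × Fin A)) :=
  match z with
  | none => (P.train H x k []).bind fun C => P.act (P.opt x C).1 x (P.opt x C).2
  | some (θ, a) => P.act θ x a

/-! ### Cost and validity of the programs -/

omit [NeZero A] in
theorem tdEst_cost (x : ℕ × Feat A d) (a : Fin A) : (P.tdEst x a).cost ≤ (A * P.N : ℕ) :=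
  (Prog.cost_map_le _ _).trans (estimate_cost _ _ _ _ _)

theorem roll_cost (θ : Vec d) (h : ℕ) (x : ℕ × Feat A d) (a : Fin A) :
    (P.roll θ h x a).cost ≤ (h * (A * P.N + 1) : ℕ) := by
  induction h generalizing x a with
  | zero => simp [roll, Prog.cost]
  | succ h ih =>
    rw [roll]
    refine (Prog.cost_bind_le _ (N := ((1 + h * (A * P.N + 1) : ℕ) : ℝ≥0∞)) (fun D => ?_) _).trans
      ((add_le_add (P.tdEst_cost x a) le_rfl).trans_eq (by push_cast; ring))
    split_ifs
    · simp [Prog.cost]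
    · rw [Prog.cost]
      push_cast
      refine add_le_add le_rfl (iSup_le fun y => (ih _ _).trans_eq (by push_cast; ring))

theorem train_cost (H : ℕ) (x : ℕ × Feat A d) (k : ℕ) (C : List (Fin A → Vec d)) :
    (P.train H x k C).cost ≤ (k * (H * (A * P.N + 1)) : ℕ) := by
  induction k generalizing C with
  | zero => simp [train, Prog.cost]
  | succ k ih =>
    rw [train]
    refine (Prog.cost_bind_le _ ih _).trans ((add_le_add ((Prog.cost_map_le _ _).trans
      (P.roll_cost _ _ _ _)) le_rfl).trans_eq (by push_cast; ring))

theorem act_cost (θ : Vec d) (x : ℕ × Feat A d) (a : Fin A) :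
    (P.act θ x a).cost ≤ (A * P.N : ℕ) := (Prog.cost_map_le _ _).trans (P.tdEst_cost x a)

theorem call_cost (H : ℕ) (z : Option (Vec d × Fin A)) (k : ℕ) (x : ℕ × Feat A d) :
    (P.call H z k x).cost ≤ (k * (H * (A * P.N + 1)) + A * P.N : ℕ) := by
  rcases z with _ | ⟨θ, a⟩
  · refine (Prog.cost_bind_le _ (fun C => P.act_cost _ _ _) _).trans ?_
    push_cast
    refine add_le_add ((P.train_cost H x k []).trans_eq (by push_cast; ring)) le_rfl
  · refine (P.act_cost θ x a).trans ?_
    exact_mod_cast Nat.le_add_left _ _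

omit [NeZero A] in
theorem tdEst_valid (x : ℕ × Feat A d) (a : Fin A) {t : Set ℕ} (ht : x.1 ∈ t) :
    (P.tdEst x a).Valid (fun y => y.2.1) t := (estimate_valid _ _ _ _ _ _ ht).map _

theorem roll_valid (θ : Vec d) (h : ℕ) (x : ℕ × Feat A d) (a : Fin A) {t : Set ℕ}
    (ht : x.1 ∈ t) : (P.roll θ h x a).Valid (fun y => y.2.1) t := by
  induction h generalizing x a t with
  | zero => trivial
  | succ h ih =>
    refine (P.tdEst_valid x a ht).bind fun D => ?_
    split_ifs
    · trivial
    · exact ⟨ht, fun y => ih _ _ (mem_insert _ _)⟩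

theorem train_valid (H : ℕ) (x : ℕ × Feat A d) (k : ℕ) (C : List (Fin A → Vec d)) {t : Set ℕ}
    (ht : x.1 ∈ t) : (P.train H x k C).Valid (fun y => y.2.1) t := by
  induction k generalizing C with
  | zero => trivial
  | succ k ih => exact ((P.roll_valid _ _ _ _ ht).map _).bind ih

theorem call_valid (H : ℕ) (z : Option (Vec d × Fin A)) (k : ℕ) (x : ℕ × Feat A d) :
    (P.call H z k x).Valid (fun y => y.2.1) {x.1} := by
  have h : x.1 ∈ ({x.1} : Set ℕ) := mem_singleton _
  rcases z with _ | ⟨θ, a⟩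
  · exact (P.train_valid H x k [] h).bind fun C => (P.tdEst_valid _ _ h).map _
  · exact (P.tdEst_valid _ _ h).map _

/-! ### The value of following a hypothesis -/

variable (S : Sim A (Answer P.κ (Feat A d)))

/-- The expected reward of `h` steps of the policy that follows `θ`. -/
def playValue (θ : Vec d) : ℕ → ℕ × Feat A d → Fin A → ℝ
  | 0, _, _ => 0
  | h + 1, x, a => S.ev (P.tdEst x a) fun D => S.mean x.1 (P.sel a (best D θ)) fun y =>
      y.rew + playValue θ h y.2 (best D θ)

theorem playValue_nonneg (θ : Vec d) (h : ℕ) (x : ℕ × Feat A d) (a : Fin A) :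
    0 ≤ P.playValue S θ h x a := by
  induction h generalizing x a with
  | zero => exact le_rfl
  | succ h ih =>
    exact S.ev_nonneg _ fun D => S.mean_nonneg fun y => add_nonneg y.rew_nonneg (ih _ _)

end Params

/-! ### The regret of the simulated episodes -/

namespace Params

variable {A d : ℕ} (P : Params A) (S : Sim A (Answer P.κ (Feat A d)))

/-- The temporal difference of the action `a'` at the node `(x, a)`, under the hypothesis `θ`. -/
def td (θ : Vec d) (x : ℕ × Feat A d) (a a' : Fin A) : ℝ :=
  (S.mean x.1 (P.sel a a') fun y => outcomeVec a' y ⬝ᵥ θ) - feature P.κ x a ⬝ᵥ θ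

/-- The estimates `D` are inaccurate in the direction `θ`. -/
def Bad (θ : Vec d) (x : ℕ × Feat A d) (a : Fin A) (D : Fin A → Vec d) : Prop :=
  ∃ a', P.η < |D a' ⬝ᵥ θ - P.td S θ x a a'|

/-- Bound on the pairings of a hypothesis with feature vectors. -/
def range (d : ℕ) : ℝ := 1 + d * P.B

/-- Bound on the probability that estimates are inaccurate. -/
def failProb (d : ℕ) : ℝ := A * P.range d ^ 2 / (P.N * P.η ^ 2)

variable {P S}

theorem abs_dotProduct_le {θ : Vec d} (hθ : θ ∈ P.hyp d) {v : Vec d} (hv : ∀ i, |v i| ≤ 1) :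
    |v ⬝ᵥ θ| ≤ P.range d := by
  have h1 : ∑ i : Option (Fin d), |v i * θ i| ≤ P.range d := by
    rw [Fintype.sum_option, range]
    refine add_le_add ?_ ?_
    · rw [hθ.1, mul_one]; exact hv none
    · refine (Finset.sum_le_card_nsmul _ _ P.B fun i _ => ?_).trans_eq (by simp)
      rw [abs_mul]
      have h3 := mul_le_mul (hv (some i)) (hθ.2 i) (abs_nonneg _) zero_le_one
      rwa [one_mul] at h3
  exact (Finset.abs_sum_le_sum_abs _ _).trans h1

theorem range_nonneg {θ : Vec d} (hθ : θ ∈ P.hyp d) : 0 ≤ P.range d :=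
  (abs_nonneg ((0 : Vec d) ⬝ᵥ θ)).trans (abs_dotProduct_le hθ (by simp))

theorem failProb_nonneg : 0 ≤ P.failProb d := by
  unfold failProb
  positivity

theorem outcomeVec_dotProduct {θ : Vec d} (hθ : θ none = 1) (a : Fin A)
    (y : Answer P.κ (Feat A d)) :
    outcomeVec a y ⬝ᵥ θ = y.rew + feature P.κ y.2 a ⬝ᵥ θ := by
  unfold dotProduct
  rw [Fintype.sum_option, Fintype.sum_option]
  simp [outcomeVec, feature, hθ]

open Classical in
/-- Chebyshev's inequality for the estimates of the temporal differences. -/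
theorem ev_bad_le (hN : 0 < P.N) (hη : 0 < P.η) {θ : Vec d} (hθ : θ ∈ P.hyp d)
    (x : ℕ × Feat A d) (a : Fin A) :
    S.ev (P.tdEst x a) (fun D => if P.Bad S θ x a D then 1 else 0) ≤ P.failProb d := by
  have hN' : (0 : ℝ) < P.N := by exact_mod_cast hN
  have h1 := estimate_variance S hN (n := x.1) θ A (P.sel a) outcomeVec
    (fun k y => abs_dotProduct_le hθ (abs_outcomeVec_le k y))
  rw [tdEst, Sim.ev_map]
  have h2 : ∀ T : Fin A → Vec d,
      (if P.Bad S θ x a (fun a' => T a' - feature P.κ x a) then (1 : ℝ) else 0)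
        ≤ (P.η ^ 2)⁻¹ * ∑ k, (T k ⬝ᵥ θ
          - S.mean x.1 (P.sel a k) fun y => outcomeVec k y ⬝ᵥ θ) ^ 2 := by
    intro T
    split_ifs with h
    · obtain ⟨k, hk⟩ := h
      rw [← div_eq_inv_mul, one_le_div (by positivity)]
      refine le_trans ?_ (Finset.single_le_sum (fun j _ => sq_nonneg _) (Finset.mem_univ k))
      rw [← sq_abs (T k ⬝ᵥ θ - _)]
      refine pow_le_pow_left₀ hη.le ?_ 2
      refine hk.le.trans_eq ?_
      rw [td, sub_dotProduct]
      congr 1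
      ring
    · exact mul_nonneg (by positivity) (Finset.sum_nonneg fun j _ => sq_nonneg _)
  refine (S.ev_mono _ h2).trans ?_
  rw [Sim.ev_const_mul]
  refine (mul_le_mul_of_nonneg_left h1 (by positivity)).trans_eq ?_
  rw [failProb]
  field_simp

variable (P S)

/-- The hypothesis `θ` describes, up to an error `η₀`, values that are bounded and that satisfy the
Bellman equation at all nodes with a property `good` that is closed under transitions. The numbers
`stg` bound from below the stage that has been reached. -/
structure Realizes (H : ℕ) (η₀ : ℝ) (good : ℕ × Feat A d → Prop) (stg : ℕ × Feat A d → ℕ)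
    (θ : Vec d) : Prop where
  mem : θ ∈ P.hyp d
  closed : ∀ x a ω, good x → S.w x.1 a ω ≠ 0 → good (S.ans ω).2
  stage : ∀ x a ω, good x → S.w x.1 a ω ≠ 0 → min H (stg x + 1) ≤ stg (S.ans ω).2
  final : ∀ x a, good x → H ≤ stg x → feature P.κ x a = 0
  bound : ∀ x a, good x → |feature P.κ x a ⬝ᵥ θ| ≤ H + 1
  bellman : ∀ x a, good x → ∃ a', |P.td S θ x a a'| ≤ η₀

variable {P S} {H : ℕ} {η₀ : ℝ} {good : ℕ × Feat A d → Prop} {stg : ℕ × Feat A d → ℕ} {θs : Vec d}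

theorem Realizes.abs_td_le (hr : P.Realizes S H η₀ good stg θs) {x : ℕ × Feat A d} (hx : good x)
    (a a' : Fin A) : |P.td S θs x a a'| ≤ 2 * H + 3 := by
  have h1 := abs_le.1 (hr.bound x a hx)
  have h2 : S.mean x.1 (P.sel a a') (fun y => outcomeVec a' y ⬝ᵥ θs) ≤ H + 2 := by
    rw [← S.mean_const x.1 (P.sel a a') ((H : ℝ) + 2)]
    refine S.mean_mono' fun ω hω => ?_
    rw [outcomeVec_dotProduct hr.mem.1]
    have h3 := abs_le.1 (hr.bound _ a' (hr.closed _ _ _ hx hω))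
    linarith [(S.ans ω).rew_le_one]
  have h4 : -((H : ℝ) + 2) ≤ S.mean x.1 (P.sel a a') (fun y => outcomeVec a' y ⬝ᵥ θs) := by
    rw [← S.mean_const x.1 (P.sel a a') (-((H : ℝ) + 2))]
    refine S.mean_mono' fun ω hω => ?_
    rw [outcomeVec_dotProduct hr.mem.1]
    have h3 := abs_le.1 (hr.bound _ a' (hr.closed _ _ _ hx hω))
    linarith [(S.ans ω).rew_nonneg]
  rw [td, abs_le]
  constructor <;> linarith

/-- With accurate estimates, the product of the temporal differences of the true hypothesis is
small. -/
theorem Realizes.tens_le (hr : P.Realizes S H η₀ good stg θs) (hH : 0 < H) (hη₀ : 0 ≤ η₀)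
    (hη : 0 < P.η) (hη1 : P.η ≤ 1) (hε' : (η₀ + P.η) * (6 * H) ^ A ≤ P.ε') {x : ℕ × Feat A d}
    (hx : good x) {a : Fin A} {D : Fin A → Vec d} (hD : ¬ P.Bad S θs x a D) :
    |tens D θs| ≤ P.ε' := by
  have hH' : (1 : ℝ) ≤ H := by exact_mod_cast hH
  simp only [Bad, not_exists, not_lt] at hD
  obtain ⟨b, hb⟩ := hr.bellman x a hx
  refine le_trans ?_ hε'
  have h6 : ∀ a', |D a' ⬝ᵥ θs| ≤ 6 * H := by
    intro a'
    have h1 := abs_le.1 (hD a')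
    have h2 := abs_le.1 (hr.abs_td_le hx a a')
    rw [abs_le]
    constructor <;> linarith
  have hb' : |D b ⬝ᵥ θs| ≤ η₀ + P.η := by
    have h1 := abs_le.1 (hD b)
    have h2 := abs_le.1 hb
    rw [abs_le]
    constructor <;> linarith
  rw [tens, Finset.abs_prod, ← Finset.mul_prod_erase _ _ (Finset.mem_univ b)]
  refine mul_le_mul hb' ?_ (Finset.prod_nonneg fun _ _ => abs_nonneg _) (by linarith)
  refine (Finset.prod_le_prod (fun _ _ => abs_nonneg _) fun i _ => h6 i).trans ?_
  rw [Finset.prod_const]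
  refine pow_le_pow_right₀ (by linarith) ?_
  simp

theorem tdEst_all (x : ℕ × Feat A d) (a : Fin A) :
    (P.tdEst x a).All fun D => ∀ a' i, |D a' i| ≤ 2 := by
  refine (estimate_all x.1 P.N A (P.sel a) fun k y i => abs_outcomeVec_le k y i).map
    fun T hT a' i => ?_
  have h1 := abs_le.1 (hT a' i)
  have h2 := abs_le.1 (abs_feature_le P.κ x a i)
  simp only [Pi.sub_apply, abs_le]
  constructor <;> linarith

variable [NeZero A]

theorem roll_all (θ : Vec d) (h : ℕ) (x : ℕ × Feat A d) (a : Fin A) :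
    (P.roll θ h x a).All fun o => ∀ D, o = some D →
      (∀ a' i, |D a' i| ≤ 2) ∧ P.ε ≤ |tens D θ| := by
  induction h generalizing x a with
  | zero => rintro D ⟨⟩
  | succ h ih =>
    rw [roll]
    refine (tdEst_all x a).bind fun D hD => ?_
    split_ifs with hv
    · rintro D' h'
      obtain rfl := Option.some_injective _ h'
      exact ⟨hD, hv⟩
    · exact fun y => ih _ _

open Classical in
/-- The simulated episodes rarely record a constraint that excludes the true hypothesis. -/
theorem Realizes.ev_roll_wrong_le (hr : P.Realizes S H η₀ good stg θs) (hH : 0 < H)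
    (hη₀ : 0 ≤ η₀) (hN : 0 < P.N) (hη : 0 < P.η) (hη1 : P.η ≤ 1)
    (hε' : (η₀ + P.η) * (6 * H) ^ A ≤ P.ε') (θ : Vec d) (h : ℕ) {x : ℕ × Feat A d} (hx : good x)
    (a : Fin A) :
    S.ev (P.roll θ h x a) (fun o => if ∃ D, o = some D ∧ ¬ |tens D θs| ≤ P.ε' then 1 else 0)
      ≤ h * P.failProb d := by
  induction h generalizing x a with
  | zero => simp [roll, Sim.ev]
  | succ h ih =>
    rw [roll, Sim.ev_bind]
    have h0 : 0 ≤ h * P.failProb d := mul_nonneg (by positivity) failProb_nonneg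
    refine (S.ev_mono _ (Ψ := fun D => (if P.Bad S θs x a D then 1 else 0) + h * P.failProb d)
      fun D => ?_).trans ?_
    · split_ifs with hv hb hb
      · rw [Sim.ev]
        split_ifs <;> linarith
      · rw [Sim.ev, if_neg]
        · linarith
        · rintro ⟨D', h', hD'⟩
          obtain rfl := Option.some_injective _ h'
          exact hD' (hr.tens_le hH hη₀ hη hη1 hε' hx hb)
      all_goals
        rw [Sim.ev]
        refine le_trans ?_ (le_add_of_nonneg_left (by norm_num))
        rw [← S.mean_const x.1 (P.sel a (best D θ)) (h * P.failProb d)]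
        exact S.mean_mono' fun ω hω => ih (hr.closed _ _ _ hx hω) _
    · rw [Sim.ev_add, Sim.ev_const]
      push_cast
      linarith [ev_bad_le (S := S) hN hη hr.mem x a]

open Classical in
/-- Unless the temporal differences have a large product, following a hypothesis earns the value
that it predicts. -/
theorem Realizes.le_playValue (hr : P.Realizes S H η₀ good stg θs) (hN : 0 < P.N) (hη : 0 < P.η)
    {τ : ℝ} (hτ : 0 ≤ τ) (hε : P.ε = τ ^ A) {θ : Vec d} (hθ : θ ∈ P.hyp d) (h : ℕ)
    {x : ℕ × Feat A d} (hx : good x) (hst : H ≤ stg x + h) (a : Fin A) :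
    feature P.κ x a ⬝ᵥ θ - h * (τ + P.η + P.range d * P.failProb d)
      - P.range d * S.ev (P.roll θ h x a) (fun o => if o.isSome then 1 else 0)
      ≤ P.playValue S θ h x a := by
  have hR := range_nonneg hθ
  induction h generalizing x a with
  | zero => simp [roll, Sim.ev, playValue, hr.final x a hx (by omega)]
  | succ h ih =>
    rw [roll, Sim.ev_bind, playValue]
    have hbad := ev_bad_le (S := S) hN hη hθ x a
    have key : ∀ D : Fin A → Vec d, feature P.κ x a ⬝ᵥ θ
        - (h * (τ + P.η + P.range d * P.failProb d) + (τ + P.η))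
        - P.range d * (if P.Bad S θ x a D then 1 else 0)
        - P.range d * S.ev (if P.ε ≤ |tens D θ| then .ret (some D)
            else .query x.1 (P.sel a (best D θ)) fun y => P.roll θ h y.2 (best D θ))
            (fun o => if o.isSome then 1 else 0)
        ≤ S.mean x.1 (P.sel a (best D θ))
            (fun y => y.rew + P.playValue S θ h y.2 (best D θ)) := by
      intro D
      have hnn : 0 ≤ S.mean x.1 (P.sel a (best D θ))
          (fun y => y.rew + P.playValue S θ h y.2 (best D θ)) :=
        S.mean_nonneg fun y => add_nonneg y.rew_nonneg (P.playValue_nonneg S θ h _ _)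
      have hf : feature P.κ x a ⬝ᵥ θ ≤ P.range d :=
        (le_abs_self _).trans (abs_dotProduct_le hθ (abs_feature_le _ _ _))
      have hc : 0 ≤ h * (τ + P.η + P.range d * P.failProb d) + (τ + P.η) := by
        have := failProb_nonneg (P := P) (d := d)
        positivity
      by_cases hv : P.ε ≤ |tens D θ|
      · rw [if_pos hv, Sim.ev]
        have : 0 ≤ P.range d * (if P.Bad S θ x a D then 1 else 0) :=
          mul_nonneg hR (by split_ifs <;> norm_num)
        simp only [Option.isSome_some, if_true, mul_one]
        linarith
      rw [if_neg hv, Sim.ev]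
      by_cases hb : P.Bad S θ x a D
      · rw [if_pos hb, mul_one]
        have : 0 ≤ P.range d * S.mean x.1 (P.sel a (best D θ)) (fun y =>
            S.ev (P.roll θ h y.2 (best D θ)) (fun o => if o.isSome then 1 else 0)) :=
          mul_nonneg hR (S.mean_nonneg fun y => S.ev_nonneg _ fun o => by split_ifs <;> norm_num)
        linarith
      rw [if_neg hb, mul_zero, sub_zero]
      -- The smallest factor of a product below `τ ^ A` is at most `τ`.
      have hsmall : |D (best D θ) ⬝ᵥ θ| ≤ τ := by
        by_contra! hlt
        apply hv
        rw [hε, tens, Finset.abs_prod]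
        calc τ ^ A = ∏ _a : Fin A, τ := by simp
          _ ≤ ∏ a, |D a ⬝ᵥ θ| := Finset.prod_le_prod (fun _ _ => hτ) fun b _ =>
              hlt.le.trans (best_spec D θ b)
      have htd : -(τ + P.η) ≤ P.td S θ x a (best D θ) := by
        simp only [Bad, not_exists, not_lt] at hb
        linarith [(abs_le.1 (hb (best D θ))).2, (abs_le.1 hsmall).1]
      rw [td] at htd
      have hstep : S.mean x.1 (P.sel a (best D θ)) (fun y => outcomeVec (best D θ) y ⬝ᵥ θ
          - h * (τ + P.η + P.range d * P.failProb d)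
          - P.range d * S.ev (P.roll θ h y.2 (best D θ)) (fun o => if o.isSome then 1 else 0))
          ≤ S.mean x.1 (P.sel a (best D θ))
            (fun y => y.rew + P.playValue S θ h y.2 (best D θ)) := by
        refine S.mean_mono' fun ω hω => ?_
        have h1 := ih (hr.closed _ _ _ hx hω)
          (by have := hr.stage _ _ _ hx hω; omega) (best D θ)
        rw [outcomeVec_dotProduct hθ.1]
        linarith
      rw [Sim.mean_sub, Sim.mean_sub, Sim.mean_const, Sim.mean_const_mul] at hstep
      linarith
    have h2 := S.ev_mono (P.tdEst x a) key
    simp only [Sim.ev_sub, Sim.ev_const, Sim.ev_const_mul] at h2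
    refine le_trans ?_ h2
    have h3 : P.range d * S.ev (P.tdEst x a) (fun D => if P.Bad S θ x a D then 1 else 0)
        ≤ P.range d * P.failProb d := mul_le_mul_of_nonneg_left hbad hR
    push_cast
    linarith

/-- The recorded constraints admit the true hypothesis and have the eluder property, as elements of
the space of tensors. -/
def Proper (P : Params A) (θs : Vec d) (L W : ℝ) (C : List (Fin A → Vec d)) : Prop :=
  (∀ D ∈ C, |tens D θs| ≤ P.ε') ∧
    Potential.Chain P.ε P.ε' L W (C.map fun D (f : Fin A → Option (Fin d)) => ∏ a, D a (f a))

omit [NeZero A] in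
theorem tensor_dotProduct (D : Fin A → Vec d) (θ : Vec d) :
    (fun f : Fin A → Option (Fin d) => ∏ a, D a (f a)) ⬝ᵥ (fun f => ∏ a, θ (f a)) = tens D θ := by
  simp only [tens, dotProduct, Finset.prod_univ_sum, Fintype.piFinset_univ, Finset.prod_mul_distrib]

omit [NeZero A] in
theorem tensor_norm_le {D : Fin A → Vec d} {r : ℝ} (hD : ∀ a i, |D a i| ≤ r) :
    (fun f : Fin A → Option (Fin d) => ∏ a, D a (f a)) ⬝ᵥ (fun f => ∏ a, D a (f a))
      ≤ (d + 1) ^ A * (r ^ A) ^ 2 := by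
  refine (Finset.sum_le_card_nsmul _ _ ((r ^ A) ^ 2) fun f _ => ?_).trans_eq (by simp)
  rw [← sq, ← sq_abs, Finset.abs_prod]
  refine pow_le_pow_left₀ (Finset.prod_nonneg fun _ _ => abs_nonneg _) ?_ 2
  refine (Finset.prod_le_prod (fun _ _ => abs_nonneg _) fun a _ => hD a (f a)).trans_eq ?_
  simp

omit [NeZero A] in
theorem Proper.cons {L W b : ℝ} {C : List (Fin A → Vec d)} (hC : Proper P θs L W C) {θ : Vec d}
    (hθ : P.Consistent C θ) {D : Fin A → Vec d} (hD : ∀ a i, |D a i| ≤ 2)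
    (hb : 1 ≤ b) (hB : P.B ≤ b) (hL : (d + 1) ^ A * (2 ^ A) ^ 2 ≤ L)
    (hW : (d + 1) ^ A * (b ^ A) ^ 2 ≤ W)
    (hv : P.ε ≤ |tens D θ|) (hs : |tens D θs| ≤ P.ε') : Proper P θs L W (D :: C) := by
  refine ⟨fun D' h => ?_, hC.2, (tensor_norm_le hD).trans hL, fun f => ∏ a, θ (f a), ?_, ?_, ?_⟩
  · rcases List.mem_cons.1 h with rfl | h'
    · exact hs
    · exact hC.1 D' h'
  · refine (tensor_norm_le (D := fun _ => θ) (r := b) fun _ i => ?_).trans hW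
    cases i with
    | none => rw [hθ.1.1, abs_one]; exact hb
    | some i => exact (hθ.1.2 i).trans hB
  · intro T hT
    obtain ⟨D', hD', rfl⟩ := List.mem_map.1 hT
    rw [tensor_dotProduct]
    exact hθ.2 D' hD'
  · rw [tensor_dotProduct]
    exact hv

variable (P S) in
/-- The expected total reward of `k` episodes, in each of which the hypothesis is followed that is
optimistic with respect to the constraints recorded in the earlier ones. -/
def totalPlay (H : ℕ) (x : ℕ × Feat A d) (k : ℕ) (C : List (Fin A → Vec d)) : ℝ :=
  ∑ i ∈ Finset.range k, S.ev (P.train H x i C) fun C' =>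
    P.playValue S (P.opt x C').1 H x (P.opt x C').2

theorem totalPlay_nonneg (H : ℕ) (x : ℕ × Feat A d) (k : ℕ) (C : List (Fin A → Vec d)) :
    0 ≤ P.totalPlay S H x k C :=
  Finset.sum_nonneg fun _ _ => S.ev_nonneg _ fun _ => P.playValue_nonneg S _ _ _ _

theorem totalPlay_succ (H : ℕ) (x : ℕ × Feat A d) (k : ℕ) (C : List (Fin A → Vec d)) :
    P.totalPlay S H x (k + 1) C = P.playValue S (P.opt x C).1 H x (P.opt x C).2
      + S.ev (P.roll (P.opt x C).1 H x (P.opt x C).2)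
        (fun o => P.totalPlay S H x k (record C o)) := by
  rw [totalPlay, Finset.sum_range_succ', add_comm]
  congr 1
  simp only [train, Sim.ev_bind, Sim.ev_map]
  rw [← Sim.ev_sum]
  rfl

open Classical in
/-- The regret bound: in each episode the loss is small unless a constraint is recorded, and this
can happen at most `m` times, as long as the true hypothesis is not excluded. -/
theorem Realizes.le_totalPlay (hr : P.Realizes S H η₀ good stg θs) (hH : 0 < H) (hη₀ : 0 ≤ η₀)
    (hN : 0 < P.N) (hη : 0 < P.η) (hη1 : P.η ≤ 1) (hε' : (η₀ + P.η) * (6 * H) ^ A ≤ P.ε')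
    {τ : ℝ} (hτ : 0 ≤ τ) (hε : P.ε = τ ^ A) {L W b : ℝ} (hb : 1 ≤ b) (hB : P.B ≤ b)
    (hL : (d + 1) ^ A * (2 ^ A) ^ 2 ≤ L) (hW : (d + 1) ^ A * (b ^ A) ^ 2 ≤ W) {m : ℕ}
    (hm : ∀ C : List (Fin A → Vec d), Proper P θs L W C → C.length ≤ m)
    {x : ℕ × Feat A d} (hx : good x) (a : Fin A) {K k : ℕ} (hk : k ≤ K)
    {C : List (Fin A → Vec d)} (hC : Proper P θs L W C) :
    k * (feature P.κ x a ⬝ᵥ θs - P.η - H * (τ + P.η + P.range d * P.failProb d)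
        - (K * (H + 1) + P.range d) * (H * P.failProb d)) - P.range d * (m - C.length)
      ≤ P.totalPlay S H x k C := by
  have hR := range_nonneg hr.mem
  have hp := failProb_nonneg (P := P) (d := d)
  set c := H * (τ + P.η + P.range d * P.failProb d) with hc
  have hc0 : 0 ≤ c := by positivity
  set β := (K * (H + 1) + P.range d) * (H * P.failProb d) with hβ
  have hβ0 : 0 ≤ β := by positivity
  set v := feature P.κ x a ⬝ᵥ θs with hv
  have hvle : v ≤ H + 1 := (abs_le.1 (hr.bound x a hx)).2
  induction k generalizing C with
  | zero =>
    have : (C.length : ℝ) ≤ m := by exact_mod_cast hm C hC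
    have h1 := totalPlay_nonneg (P := P) (S := S) H x 0 C
    have h2 : 0 ≤ P.range d * ((m : ℝ) - C.length) := mul_nonneg hR (by linarith)
    simp only [Nat.cast_zero, zero_mul]
    linarith
  | succ k ih =>
    have hcons : P.Consistent C θs := ⟨hr.mem, hC.1⟩
    obtain ⟨ho1, ho2⟩ := P.opt_spec x C hη ⟨θs, hcons⟩
    have hopt := ho2 θs a hcons
    rw [← hv] at hopt
    set θ := (P.opt x C).1
    set a₀ := (P.opt x C).2
    rw [totalPlay_succ]
    have hplay := hr.le_playValue hN hη hτ hε ho1.1 H hx (by omega) a₀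
    rw [← hc] at hplay
    set pv := S.ev (P.roll θ H x a₀) (fun o => if o.isSome then (1 : ℝ) else 0)
    have hwrong := hr.ev_roll_wrong_le hH hη₀ hN hη hη1 hε' θ H hx a₀
    set f := k * (v - P.η - c - β) - P.range d * (m - C.length) with hf
    have hlen : (C.length : ℝ) ≤ m := by exact_mod_cast hm C hC
    have hkK : (k : ℝ) ≤ K := by exact_mod_cast (Nat.le_succ k).trans hk
    have hfle : f ≤ K * (H + 1) := by
      have h1 : (k : ℝ) * (v - P.η - c - β) ≤ k * (H + 1) :=
        mul_le_mul_of_nonneg_left (by linarith) (by positivity)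
      have h2 : (k : ℝ) * (H + 1) ≤ K * (H + 1) :=
        mul_le_mul_of_nonneg_right hkK (by positivity)
      have h3 : 0 ≤ P.range d * ((m : ℝ) - C.length) := mul_nonneg hR (by linarith)
      linarith
    have hlow : S.ev (P.roll θ H x a₀) (fun o => f
        + P.range d * (if o.isSome then 1 else 0) - (K * (H + 1) + P.range d)
          * (if ∃ D, o = some D ∧ ¬ |tens D θs| ≤ P.ε' then 1 else 0))
        ≤ S.ev (P.roll θ H x a₀) (fun o => P.totalPlay S H x k (record C o)) := by
      refine S.ev_mono_of_all (roll_all θ H x a₀) fun o ho => ?_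
      cases o with
      | none =>
        rw [if_neg (by simp), if_neg (by rintro ⟨_, h', _⟩; cases h')]
        have := ih (by omega) hC
        simp only [record, Option.elim_none]
        linarith
      | some D =>
        obtain ⟨hD, hviol⟩ := ho D rfl
        rw [if_pos (Option.isSome_some (a := D))]
        by_cases hs : |tens D θs| ≤ P.ε'
        · rw [if_neg (by
            rintro ⟨D', h', hD'⟩
            obtain rfl := Option.some_injective _ h'
            exact hD' hs)]
          have := ih (by omega) (hC.cons ho1 hD hb hB hL hW hviol hs)
          simp only [List.length_cons, Nat.cast_add, Nat.cast_one] at this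
          simp only [record, Option.elim_some]
          linarith
        · rw [if_pos ⟨D, rfl, hs⟩]
          have := totalPlay_nonneg (P := P) (S := S) H x k (record C (some D))
          linarith
    rw [Sim.ev_sub, Sim.ev_add, Sim.ev_const, Sim.ev_const_mul, Sim.ev_const_mul] at hlow
    have hwrong' := mul_le_mul_of_nonneg_left hwrong
      (show 0 ≤ (K : ℝ) * (H + 1) + P.range d by positivity)
    rw [← hβ] at hwrong'
    have hkf : ((k + 1 : ℕ) : ℝ) * (v - P.η - c - β) - P.range d * (m - C.length)
        = f + (v - P.η - c - β) := by
      rw [hf]; push_cast; ring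
    rw [hkf]
    linarith

end Params

/-! ### The planner and its value -/

/-- The uniform distribution on `Fin K`. -/
def coin (K : ℕ) : Measure (Fin K) := (K : ℝ≥0∞)⁻¹ • Measure.count

instance (K : ℕ) [NeZero K] : IsProbabilityMeasure (coin K) := by
  refine ⟨?_⟩
  have : (K : ℝ≥0∞) ≠ 0 := by exact_mod_cast NeZero.ne K
  rw [coin, Measure.smul_apply, Measure.count_univ, smul_eq_mul, ENat.card_eq_coe_fintype_card,
    Fintype.card_fin]
  exact ENNReal.inv_mul_cancel this (ENNReal.natCast_ne_top K)

theorem lintegral_coin (K : ℕ) (f : Fin K → ℝ≥0∞) :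
    ∫⁻ ω, f ω ∂(coin K) = (K : ℝ≥0∞)⁻¹ * ∑ ω, f ω := by
  rw [coin, lintegral_smul_measure, lintegral_count, tsum_fintype, smul_eq_mul]

theorem ofReal_lintegral_coin {K : ℕ} (hK : 0 < K) {f : Fin K → ℝ} (hf : ∀ ω, 0 ≤ f ω) :
    ∫⁻ ω, ENNReal.ofReal (f ω) ∂(coin K) = ENNReal.ofReal ((∑ ω, f ω) / K) := by
  have hK' : (0 : ℝ) < K := by exact_mod_cast hK
  rw [lintegral_coin, ← ENNReal.ofReal_sum_of_nonneg fun ω _ => hf ω, ENNReal.ofReal_div_of_pos hK',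
    ENNReal.ofReal_natCast, ENNReal.div_eq_inv_mul]

namespace Params

variable {A d : ℕ} [NeZero A] (P : Params A) {F : Type} [MeasurableSpace F]

/-- The strategy that, with a uniformly random `k < K`, follows in the actual episode the hypothesis
found after `k` simulated episodes. -/
abbrev strategy (H K : ℕ) [NeZero K] (ρ : F → Feat A d) (hρ : Measurable ρ) :
    Strategy A P.κ F (Feat A d) where
  ρ := ρ
  measurable_ρ := hρ
  Z := Option (Vec d × Fin A)
  z₀ := none
  dflt := 0
  Ω := Fin K
  instΩ := inferInstance
  countable_Ω := inferInstance
  discrete_Ω := inferInstance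
  ν := coin K
  prob_ν := inferInstance
  call z ω x := P.call H z ω x

theorem strategy_queryCost_le (H K : ℕ) [NeZero K] (ρ : F → Feat A d) (hρ : Measurable ρ)
    (M : FMDP A H F) : (P.strategy H K ρ hρ).planner.queryCost M
      ≤ 1 + (K * (H * (A * P.N + 1)) + A * P.N : ℕ) := by
  refine (P.strategy H K ρ hρ).queryCost_le fun z x => ?_
  refine (lintegral_mono (g := fun _ => ((K * (H * (A * P.N + 1)) + A * P.N : ℕ) : ℝ≥0∞))
    fun ω : Fin K => (P.call_cost H z ω x).trans ?_).trans
    (by rw [lintegral_const, measure_univ (μ := coin K), mul_one])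
  exact Nat.cast_le.2 (Nat.add_le_add_right (Nat.mul_le_mul_right _ (le_of_lt (Fin.is_lt ω))) _)

/-- The remaining value in the actual episode. -/
def episodeValue (S : Sim A (Answer P.κ (Feat A d))) (h : ℕ) :
    Option (Vec d × Fin A) → ℕ × Feat A d → ℝ
  | none, _ => 0
  | some (θ, a), x => P.playValue S θ h x a

theorem strategy_isLowerValue (H K : ℕ) [NeZero K] (ρ : F → Feat A d) (hρ : Measurable ρ)
    (M : FMDP A H F) : Strategy.IsLowerValue (S := P.strategy H K ρ hρ) M
      (P.episodeValue (M.sim ρ P.κ)) where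
  valid z ω x := P.call_valid H z (ω : Fin K) x
  nonneg h z x := by
    rcases z with _ | ⟨θ, a⟩
    · exact le_rfl
    · exact P.playValue_nonneg _ θ h x a
  zero z x := by
    rcases z with _ | ⟨θ, a⟩ <;> rfl
  succ h z ω x := by
    rcases z with _ | ⟨θ, a⟩
    · refine Sim.ev_nonneg _ _ fun r => Sim.mean_nonneg _ fun y => add_nonneg y.rew_nonneg ?_
      rcases r.2 with _ | ⟨θ, a⟩
      · exact le_rfl
      · exact P.playValue_nonneg _ θ h _ a
    · exact (Sim.ev_map (M.sim ρ P.κ) (P.tdEst x a)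
        (fun D => (P.sel a (best D θ), some (θ, best D θ)))
        ((P.strategy H K ρ hρ).lookahead M (P.episodeValue (M.sim ρ P.κ) h) x)).symm.le

theorem totalPlay_le_value {H K : ℕ} [NeZero K] (hH : 0 < H) (ρ : F → Feat A d)
    (hρ : Measurable ρ) (M : FMDP A H F) (s₀ : M.states) :
    P.totalPlay (M.sim ρ P.κ) H ((s₀ : ℕ), ρ (M.feat s₀)) K [] / K
      ≤ ((P.strategy H K ρ hρ).planner.value M s₀).toReal := by
  have h := (P.strategy_isLowerValue H K ρ hρ M).le_value hH s₀
  obtain ⟨h', rfl⟩ : ∃ h', H = h' + 1 := ⟨H - 1, by omega⟩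
  have h1 : ∀ ω : Fin K, (M.sim ρ P.κ).ev (P.call (h' + 1) none ω ((s₀ : ℕ), ρ (M.feat s₀)))
      ((P.strategy (h' + 1) K ρ hρ).lookahead M (P.episodeValue (M.sim ρ P.κ) h')
        ((s₀ : ℕ), ρ (M.feat s₀)))
      = (M.sim ρ P.κ).ev (P.train (h' + 1) ((s₀ : ℕ), ρ (M.feat s₀)) ω []) fun C =>
        P.playValue (M.sim ρ P.κ) (P.opt ((s₀ : ℕ), ρ (M.feat s₀)) C).1 (h' + 1)
          ((s₀ : ℕ), ρ (M.feat s₀)) (P.opt ((s₀ : ℕ), ρ (M.feat s₀)) C).2 := by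
    intro ω
    refine (Sim.ev_bind _ _ _ _).trans (congrArg _ (funext fun C => ?_))
    exact Sim.ev_map _ _ _ _
  have h2 : ∫⁻ ω, ENNReal.ofReal ((M.sim ρ P.κ).ev
        (P.train (h' + 1) ((s₀ : ℕ), ρ (M.feat s₀)) ω []) fun C =>
        P.playValue (M.sim ρ P.κ) (P.opt ((s₀ : ℕ), ρ (M.feat s₀)) C).1 (h' + 1)
          ((s₀ : ℕ), ρ (M.feat s₀)) (P.opt ((s₀ : ℕ), ρ (M.feat s₀)) C).2) ∂(coin K)
      ≤ (P.strategy (h' + 1) K ρ hρ).planner.value M s₀ := by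
    refine le_trans (le_of_eq (lintegral_congr fun ω => ?_)) h
    rw [← h1]
    rfl
  rw [ofReal_lintegral_coin (NeZero.pos K) fun ω => Sim.ev_nonneg _ _ fun C =>
    P.playValue_nonneg _ _ _ _ _] at h2
  rw [totalPlay, ← Fin.sum_univ_eq_sum_range fun i => (M.sim ρ P.κ).ev
    (P.train (h' + 1) ((s₀ : ℕ), ρ (M.feat s₀)) i []) fun C =>
        P.playValue (M.sim ρ P.κ) (P.opt ((s₀ : ℕ), ρ (M.feat s₀)) C).1 (h' + 1)
          ((s₀ : ℕ), ρ (M.feat s₀)) (P.opt ((s₀ : ℕ), ρ (M.feat s₀)) C).2]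
  exact (ENNReal.ofReal_le_iff_le_toReal (Planner.value_ne_top _)).1 h2

/-- The optimal values of the members of the class are realized, up to `η₀`, by hypotheses. -/
def RealizesClass {H : ℕ} (ρ : F → Feat A d) (C : Set (FMDP A H F)) (η₀ : ℝ) : Prop :=
  ∀ M ∈ C, ∃ θs good stg, P.Realizes (M.sim ρ P.κ) H η₀ good stg θs ∧
    ∀ s₀ : M.states, M.stage s₀ = 0 → good ((s₀ : ℕ), ρ (M.feat s₀)) ∧
      ∃ a, M.vstar s₀ - η₀ ≤ feature P.κ ((s₀ : ℕ), ρ (M.feat s₀)) a ⬝ᵥ θs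

/-- Soundness of the planner, provided that the parameters are such that the regret bound is at most
`δ`. -/
theorem strategy_sound {H K m : ℕ} [NeZero K] {ρ : F → Feat A d} (hρ : Measurable ρ)
    {C : Set (FMDP A H F)} {η₀ τ b δ : ℝ} (hC : P.RealizesClass ρ C η₀)
    (hH : 0 < H) (hη₀ : 0 ≤ η₀) (hN : 0 < P.N) (hη : 0 < P.η) (hη1 : P.η ≤ 1)
    (hε' : (η₀ + P.η) * (6 * H) ^ A ≤ P.ε') (hτ : 0 < τ) (hε : P.ε = τ ^ A)
    (hb : 1 ≤ b) (hB : P.B ≤ b) (hm : m * P.ε' ^ 2 ≤ P.ε ^ 2 / 2)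
    (hm' : ((d + 1) ^ A + m * (2 * ((d + 1) ^ A * (2 ^ A) ^ 2) * ((d + 1) ^ A * (b ^ A) ^ 2)
      / P.ε ^ 2) : ℝ) ^ ((d + 1) ^ A) < 2 ^ m)
    (herr : η₀ + P.η + H * (τ + P.η + P.range d * P.failProb d)
        + (K * (H + 1) + P.range d) * (H * P.failProb d) + P.range d * m / K ≤ δ) :
    SoundLA (P.strategy H K ρ hρ).planner C δ := by
  intro M hM s₀ hs₀
  obtain ⟨θs, good, stg, hr, h0⟩ := hC M hM
  obtain ⟨hgood, a, ha⟩ := h0 s₀ hs₀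
  have hK : (0 : ℝ) < K := by exact_mod_cast NeZero.pos K
  have hlen : ∀ C' : List (Fin A → Vec d), Proper P θs ((d + 1) ^ A * (2 ^ A) ^ 2)
      ((d + 1) ^ A * (b ^ A) ^ 2) C' → C'.length ≤ m := by
    intro C' hC'
    have hcard : Fintype.card (Fin A → Option (Fin d)) = (d + 1) ^ A := by simp
    have h := hC'.2.length_lt (m := m) (by rw [hε]; positivity)
      (by positivity) hm (by rw [hcard]; push_cast; exact hm')
    rw [List.length_map] at h
    exact h.le
  have h1 := hr.le_totalPlay hH hη₀ hN hη hη1 hε' hτ.le hε hb hB le_rfl le_rfl hlen hgood a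
    (le_refl K) (C := []) ⟨by simp, trivial⟩
  refine le_trans ?_ (P.totalPlay_le_value hH ρ hρ M s₀)
  rw [le_div_iff₀ hK]
  refine le_trans ?_ h1
  simp only [List.length_nil, Nat.cast_zero, sub_zero]
  have h2 : P.range d * m = K * (P.range d * m / K) := by field_simp
  rw [h2, mul_comm, ← mul_sub]
  refine mul_le_mul_of_nonneg_left ?_ hK.le
  linarith

end Params

/-! ### Realizability of the three classes -/

/-- Rounding of a vector to multiples of `1 / κ`. -/
def roundVec {d : ℕ} (κ : ℕ) (v : EuclideanSpace ℝ (Fin d)) (i : Fin d) : ℤ := ⌊κ * v i⌋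

theorem measurable_roundVec {d : ℕ} (κ : ℕ) : Measurable (roundVec (d := d) κ) := by
  refine measurable_pi_iff.2 fun i => Int.measurable_floor.comp ?_
  exact (by fun_prop : Continuous fun v : EuclideanSpace ℝ (Fin d) => (κ : ℝ) * v i).measurable

/-- The hypothesis given by a parameter vector. -/
def ofParam {d : ℕ} (θ : EuclideanSpace ℝ (Fin d)) : Vec d
  | none => 1
  | some i => θ i

theorem abs_coord_le {d : ℕ} (v : EuclideanSpace ℝ (Fin d)) (i : Fin d) : |v i| ≤ ‖v‖ := by
  simpa using PiLp.norm_apply_le v i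

/-- The error caused by the rounding of the features. -/
theorem abs_feature_dotProduct_sub_le {A d κ : ℕ} (hκ : 0 < κ) {b : ℝ} {n : ℕ} (hn : n ≠ 0)
    {f : Feat A d} {a : Fin A} {v θ : EuclideanSpace ℝ (Fin d)} (hv : ‖v‖ ≤ 1) (hθ : ‖θ‖ ≤ b)
    (hf : f a = roundVec κ v) :
    |feature κ (n, f) a ⬝ᵥ ofParam θ - inner ℝ v θ| ≤ d * b / κ := by
  have hκ' : (0 : ℝ) < κ := by exact_mod_cast hκ
  have hcoord : ∀ i, |feature κ (n, f) a (some i) - v i| ≤ 1 / κ := by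
    intro i
    have hvi := abs_le.1 ((abs_coord_le v i).trans hv)
    have h1 := Int.floor_le ((κ : ℝ) * v i)
    have h2 := Int.lt_floor_add_one ((κ : ℝ) * v i)
    have h3 : ((⌊(κ : ℝ) * v i⌋ : ℤ) : ℝ) / κ ≤ v i := by
      rw [div_le_iff₀ hκ']; linarith
    have h4 : v i - 1 / κ ≤ ((⌊(κ : ℝ) * v i⌋ : ℤ) : ℝ) / κ := by
      rw [sub_le_iff_le_add, ← add_div, le_div_iff₀ hκ']; linarith
    have h5 : -(κ : ℤ) ≤ ⌊(κ : ℝ) * v i⌋ := by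
      rw [Int.le_floor]
      push_cast
      nlinarith
    have h6 : (-1 : ℝ) ≤ ((⌊(κ : ℝ) * v i⌋ : ℤ) : ℝ) / κ := by
      rw [le_div_iff₀ hκ']
      have : ((-(κ : ℤ) : ℤ) : ℝ) ≤ ((⌊(κ : ℝ) * v i⌋ : ℤ) : ℝ) := by exact_mod_cast h5
      push_cast at this
      linarith
    have h7 : feature κ (n, f) a (some i) = ((⌊(κ : ℝ) * v i⌋ : ℤ) : ℝ) / κ := by
      simp only [feature, if_neg hn, hf, roundVec]
      rw [min_eq_right (h3.trans hvi.2), max_eq_right h6]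
    rw [h7, abs_le]
    constructor <;> linarith [show (0 : ℝ) ≤ 1 / κ by positivity]
  have hsum : feature κ (n, f) a ⬝ᵥ ofParam θ - inner ℝ v θ
      = ∑ i, (feature κ (n, f) a (some i) - v i) * θ i := by
    unfold dotProduct
    rw [Fintype.sum_option, PiLp.inner_apply]
    simp only [feature, zero_mul, zero_add, ofParam, sub_mul, Finset.sum_sub_distrib]
    congr 1
    refine Finset.sum_congr rfl fun i _ => ?_
    simp [mul_comm]
  rw [hsum]
  refine (Finset.abs_sum_le_sum_abs _ _).trans ?_
  refine (Finset.sum_le_card_nsmul _ _ (1 / κ * b) fun i _ => ?_).trans_eq ?_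
  · rw [abs_mul]
    exact mul_le_mul (hcoord i) ((abs_coord_le θ i).trans hθ) (abs_nonneg _) (by positivity)
  · simp only [Finset.card_univ, Fintype.card_fin, nsmul_eq_mul]
    ring

theorem FMDP.integrable_digest {A H κ : ℕ} {F G : Type} (M : FMDP A H F) (ρ : F → G)
    (s : M.states) (a : Fin A) (Φ : Answer κ G → ℝ) :
    Integrable (fun x : ℝ × M.states => Φ (M.digestAnswer ρ κ x)) (M.Q s a) := by
  have := M.prob s a
  have hm : Measurable fun x : ℝ × M.states => Φ (M.digestAnswer ρ κ x) :=
    (measurable_of_countable fun z : Fin (κ + 1) × M.states => Φ ((M.sim ρ κ).ans z)).comp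
      M.measurable_outcome
  obtain ⟨C, hC⟩ := (finite_range fun z : Fin (κ + 1) × M.states =>
    ‖Φ ((M.sim ρ κ).ans z)‖).bddAbove
  exact Integrable.of_bound hm.aestronglyMeasurable C (Filter.Eventually.of_forall fun x =>
    hC ⟨M.outcome κ x, rfl⟩)

theorem MDP.integrable_reward_add {A H : ℕ} (M : MDP A H) (s : M.states) (a : Fin A)
    (f : M.states → ℝ) : Integrable (fun x : ℝ × M.states => x.1 + f x.2) (M.Q s a) := by
  have := M.prob s a
  have hm : Measurable fun x : ℝ × M.states => f x.2 :=
    (M.measurable_of_state f).comp measurable_snd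
  obtain ⟨C, hC⟩ := (finite_range fun s' : M.states => ‖f s'‖).bddAbove
  refine Integrable.add ?_ (Integrable.of_bound hm.aestronglyMeasurable C
    (Filter.Eventually.of_forall fun x => hC ⟨x.2, rfl⟩))
  refine Integrable.of_bound measurable_fst.aestronglyMeasurable 1 ?_
  filter_upwards [MDP.ae_reward s a] with x hx
  rw [Real.norm_eq_abs, abs_le]
  constructor <;> linarith [hx.1, hx.2]

/-- The effect of rounding the rewards on a one-step lookahead. -/
theorem FMDP.abs_mean_sub_integral_le {A H κ : ℕ} {F G : Type} (M : FMDP A H F) (ρ : F → G)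
    (hκ : 0 < κ) (s : M.states) (a : Fin A) (f : M.states → ℝ) :
    |(M.sim ρ κ).mean s a (fun y => y.rew + f (M.stateOf y.2.1))
      - ∫ x, (x.1 + f x.2) ∂(M.Q s a)| ≤ 1 / κ := by
  have := M.prob s a
  have hi := M.integrable_digest (κ := κ) ρ s a fun y => y.rew + f (M.stateOf y.2.1)
  rw [← FMDP.integral_digest M ρ s a (fun y => y.rew + f (M.stateOf y.2.1)),
    ← integral_sub hi (M.integrable_reward_add s a f)]
  have h : ∀ᵐ x ∂(M.Q s a), ‖(M.digestAnswer (κ := κ) ρ x).rew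
      + f (M.stateOf (M.digestAnswer (κ := κ) ρ x).2.1) - (x.1 + f x.2)‖ ≤ 1 / (κ : ℝ) := by
    filter_upwards [MDP.ae_reward s a] with x hx
    have h1 := level_div_le (κ := κ) hx.1
    have h2 := le_level_div hκ hx.2
    have h3 : (0 : ℝ) ≤ 1 / κ := by positivity
    simp only [FMDP.digestAnswer, Answer.rew, M.stateOf_coe, Real.norm_eq_abs, abs_le]
    constructor <;> linarith
  have h4 := norm_integral_le_of_norm_le_const h
  rwa [probReal_univ, mul_one] at h4

/-- Sufficient conditions for realizability, in terms of the exact values `val s a` of the nodes. -/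
theorem Params.realizes_of_values {A d H : ℕ} {P : Params A} {F : Type} (M : FMDP A H F)
    (ρ : F → Feat A d) (hκ : 0 < P.κ) (reach : M.states → Prop)
    (hreach : ∀ s a s', reach s → M.Q s a {x | x.2 = s'} ≠ 0 → reach s')
    (φ : M.states → Fin A → EuclideanSpace ℝ (Fin d)) (hφ : ∀ s a, ‖φ s a‖ ≤ 1)
    (hρ : ∀ s a, ρ (M.feat s) a = roundVec P.κ (φ s a))
    (θ : EuclideanSpace ℝ (Fin d)) (hθ : ‖θ‖ ≤ P.B) (hsmall : d * P.B / P.κ ≤ 1)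
    (val : M.states → Fin A → ℝ) (hval : ∀ s a, val s a ∈ Icc (0 : ℝ) H)
    (hbot : ∀ s a, M.stage s = H → val s a = 0)
    (hlin : ∀ s a, reach s → val s a = inner ℝ (φ s a) θ)
    (hbell : ∀ s a, reach s → ∃ a', ∫ x, (x.1 + val x.2 a') ∂(M.Q s (P.sel a a')) = val s a) :
    P.Realizes (M.sim ρ P.κ) H ((1 + 2 * d * P.B) / P.κ)
      (fun x => ∃ s, reach s ∧ x = ((s : ℕ), ρ (M.feat s))) (fun x => M.stage (M.stateOf x.1))
      (ofParam θ) ∧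
    ∀ s a, reach s →
      |feature P.κ ((s : ℕ), ρ (M.feat s)) a ⬝ᵥ ofParam θ - val s a| ≤ d * P.B / P.κ := by
  have hκ' : (0 : ℝ) < P.κ := by exact_mod_cast hκ
  have hB : 0 ≤ P.B := (norm_nonneg θ).trans hθ
  have hfin : ∀ s a, M.stage s = H → feature P.κ ((s : ℕ), ρ (M.feat s)) a = 0 := by
    intro s a hs
    have h0 := (M.stage_eq_iff s).1 hs
    funext i
    cases i with
    | none => rfl
    | some i => simp [feature, h0]
  have happrox : ∀ s a, reach s →
      |feature P.κ ((s : ℕ), ρ (M.feat s)) a ⬝ᵥ ofParam θ - val s a| ≤ d * P.B / P.κ := by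
    intro s a hs
    by_cases h0 : M.stage s = H
    · rw [hfin s a h0, hbot s a h0]
      simp only [zero_dotProduct, sub_zero, abs_zero]
      positivity
    · rw [hlin s a hs]
      exact abs_feature_dotProduct_sub_le hκ (fun h => h0 ((M.stage_eq_iff s).2 h)) (hφ s a) hθ
        (hρ s a)
  have hnext : ∀ s a (ω : (M.sim ρ P.κ).X), reach s → (M.sim ρ P.κ).w s a ω ≠ 0 →
      reach (ω : Fin (P.κ + 1) × M.states).2 := by
    intro s a ω hs hω
    refine hreach s a _ hs fun h0 => ?_
    refine M.of_weight_ne_zero ρ (s := s) (a := a)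
      (φ := fun s' => s' ≠ (ω : Fin (P.κ + 1) × M.states).2) ?_ hω rfl
    rw [ae_iff]
    simpa using h0
  refine ⟨⟨⟨rfl, fun i => (abs_coord_le θ i).trans hθ⟩, ?_, ?_, ?_, ?_, ?_⟩, happrox⟩
  · rintro _ a ω ⟨s, hs, rfl⟩ hω
    exact ⟨_, hnext s a ω hs hω, rfl⟩
  · rintro _ a ω ⟨s, hs, rfl⟩ hω
    change min H (M.stage (M.stateOf s) + 1)
      ≤ M.stage (M.stateOf (ω : Fin (P.κ + 1) × M.states).2)
    rw [M.stateOf_coe, M.stateOf_coe]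
    exact M.of_weight_ne_zero ρ (φ := fun s' => min H (M.stage s + 1) ≤ M.stage s')
      (MDP.ae_stage s a) hω
  · rintro _ a ⟨s, hs, rfl⟩ hst
    rw [M.stateOf_coe] at hst
    exact hfin s a (le_antisymm (M.stage_le s) hst)
  · rintro _ a ⟨s, hs, rfl⟩
    have h1 := abs_le.1 (happrox s a hs)
    have h2 := hval s a
    rw [abs_le]
    constructor <;> linarith [h2.1, h2.2]
  · rintro _ a ⟨s, hs, rfl⟩
    obtain ⟨a', ha'⟩ := hbell s a hs
    refine ⟨a', ?_⟩
    have := M.prob s (P.sel a a')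
    -- The exact mean, with exact values at the next state but rounded rewards.
    set μ := (M.sim ρ P.κ).mean s (P.sel a a') fun y => y.rew + val (M.stateOf y.2.1) a' with hμ
    have hμ1 : |μ - val s a| ≤ 1 / P.κ := by
      rw [← ha']
      exact M.abs_mean_sub_integral_le ρ hκ s (P.sel a a') (fun s' => val s' a')
    have hμ2 : |(M.sim ρ P.κ).mean s (P.sel a a') (fun y => outcomeVec a' y ⬝ᵥ ofParam θ) - μ|
        ≤ d * P.B / P.κ := by
      rw [hμ, ← Sim.mean_sub, abs_le]
      constructor
      · rw [← Sim.mean_const (M.sim ρ P.κ) s (P.sel a a') (-(d * P.B / P.κ))]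
        refine Sim.mean_mono' _ fun ω hω => ?_
        have h1 := abs_le.1 (happrox _ a' (hnext s _ ω hs hω))
        rw [outcomeVec_dotProduct rfl]
        simp only [FMDP.sim, M.stateOf_coe]
        linarith [h1.1]
      · rw [← Sim.mean_const (M.sim ρ P.κ) s (P.sel a a') (d * P.B / P.κ)]
        refine Sim.mean_mono' _ fun ω hω => ?_
        have h1 := abs_le.1 (happrox _ a' (hnext s _ ω hs hω))
        rw [outcomeVec_dotProduct rfl]
        simp only [FMDP.sim, M.stateOf_coe]
        linarith [h1.2]
    have hμ3 := abs_le.1 (happrox s a hs)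
    have h1 := abs_le.1 hμ1
    have h2 := abs_le.1 hμ2
    have h3 : (1 + 2 * d * P.B) / P.κ = 1 / P.κ + 2 * (d * P.B / P.κ) := by ring
    rw [Params.td, h3, abs_le]
    constructor <;> linarith [h1.1, h1.2, h2.1, h2.2, hμ3.1, hμ3.2]

/-- Realizability of the optimal values at the reachable states, by state features. -/
theorem Params.realizesClass_state {A d H : ℕ} [NeZero A] {P : Params A} {F : Type}
    [MeasurableSpace F] {C : Set (FMDP A H F)} (hH : 0 < H) (hκ : 0 < P.κ)
    (hsel : ∀ a a', P.sel a a' = a') (hsmall : d * P.B / P.κ ≤ 1)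
    (φ : F → EuclideanSpace ℝ (Fin d)) (hC : ∀ M ∈ C, (∀ s, ‖φ (M.feat s)‖ ≤ 1) ∧
      ∃ θ : EuclideanSpace ℝ (Fin d), ‖θ‖ ≤ P.B ∧
        ∀ s, M.Reachable s → M.vstar s = inner ℝ (φ (M.feat s)) θ) :
    P.RealizesClass (fun f _ => roundVec P.κ (φ f)) C ((1 + 2 * d * P.B) / P.κ) := by
  intro M hM
  obtain ⟨hφ, θ, hθ, hv⟩ := hC M hM
  have hκ' : (0 : ℝ) < P.κ := by exact_mod_cast hκ
  have hB : 0 ≤ P.B := (norm_nonneg θ).trans hθ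
  obtain ⟨h1, h2⟩ := P.realizes_of_values M (fun f _ => roundVec P.κ (φ f)) hκ M.Reachable
    (fun s a s' ⟨s₀, h0, hr⟩ hQ => ⟨s₀, h0, hr.tail ⟨a, hQ⟩⟩) (fun s _ => φ (M.feat s))
    (fun s _ => hφ s) (fun s a => rfl) θ hθ hsmall (fun s _ => M.vstar s)
    (fun s _ => ⟨MDP.vstar_nonneg s, MDP.vstar_le s⟩) (fun s _ => MDP.vstar_bot s)
    (fun s _ hs => hv s hs) (fun s a _ => by
      obtain ⟨a', ha'⟩ := MDP.exists_vstar_eq_qstar hH s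
      refine ⟨a', ?_⟩
      rw [hsel, ha', MDP.qstar_eq_integral hH])
  refine ⟨ofParam θ, _, _, h1, fun s₀ hs₀ => ?_⟩
  have hreach : M.Reachable s₀ := ⟨s₀, hs₀, .refl⟩
  refine ⟨⟨s₀, hreach, rfl⟩, 0, ?_⟩
  have h3 := (abs_le.1 (h2 s₀ 0 hreach)).1
  have h4 : (1 + 2 * d * P.B) / P.κ = 1 / P.κ + 2 * (d * P.B / P.κ) := by ring
  have h5 : 0 ≤ d * P.B / P.κ := by positivity
  have h6 : (0 : ℝ) ≤ 1 / P.κ := by positivity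
  rw [h4]
  linarith

/-- Realizability of the optimal action values, when transitions are deterministic: the node `(s, a)`
has the value `q⋆(s, a)`, and the action to be chosen at it is the one to be taken at the state that
follows. -/
theorem Params.realizesClass_action {A d H : ℕ} [NeZero A] {P : Params A} (hH : 0 < H)
    (hκ : 0 < P.κ) (hsel : ∀ a a', P.sel a a' = a) (hsmall : d * P.B / P.κ ≤ 1) {B : ℝ}
    (hB : B ≤ P.B) :
    P.RealizesClass (fun (f : QFeat A d) a => roundVec P.κ (f a))
      (classQ B d H A ∩ classPdet A H (QFeat A d)) ((1 + 2 * d * P.B) / P.κ) := by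
  rintro M ⟨⟨hφ, θ, hθ, hq⟩, hdet⟩
  have hκ' : (0 : ℝ) < P.κ := by exact_mod_cast hκ
  have hB0 : 0 ≤ P.B := ((norm_nonneg θ).trans hθ).trans hB
  have hq0 : ∀ (s : M.states) a, 0 ≤ M.qstar s a := by
    intro s a
    rw [MDP.qstar_eq hH]
    exact ENNReal.toReal_nonneg
  obtain ⟨h1, h2⟩ := P.realizes_of_values M (fun f a => roundVec P.κ (f a)) hκ (fun _ => True)
    (fun _ _ _ _ _ => trivial) (fun s a => M.feat s a) hφ (fun s a => rfl) θ (hθ.trans hB) hsmall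
    (fun s a => M.qstar s a)
    (fun s a => ⟨hq0 s a, (MDP.qstar_le_vstar hH s a).trans (MDP.vstar_le s)⟩)
    (fun s a hs => le_antisymm ((MDP.qstar_le_vstar hH s a).trans_eq (MDP.vstar_bot s hs)) (hq0 s a))
    (fun s a _ => hq s a) (fun s a _ => by
      obtain ⟨s', hs'⟩ := hdet s a
      obtain ⟨a', ha'⟩ := MDP.exists_vstar_eq_qstar hH s'
      refine ⟨a', ?_⟩
      rw [hsel, MDP.qstar_eq_integral hH s a]
      refine integral_congr_ae ?_
      filter_upwards [hs'] with x hx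
      simp only [hx, ha'])
  refine ⟨ofParam θ, _, _, h1, fun s₀ hs₀ => ?_⟩
  obtain ⟨a, ha⟩ := MDP.exists_vstar_eq_qstar hH s₀
  refine ⟨⟨s₀, trivial, rfl⟩, a, ?_⟩
  have h3 := (abs_le.1 (h2 s₀ a trivial)).1
  have h4 : (1 + 2 * d * P.B) / P.κ = 1 / P.κ + 2 * (d * P.B / P.κ) := by ring
  have h5 : 0 ≤ d * P.B / P.κ := by positivity
  have h6 : (0 : ℝ) ≤ 1 / P.κ := by positivity
  rw [h4, ha]
  linarith

/-! ### Choice of the parameters -/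

theorem queryComplexityLA_le {A H : ℕ} {F : Type} [MeasurableSpace F] {C : Set (FMDP A H F)}
    {δ : ℝ} {c : ℝ≥0∞} {P : Planner A F} (hP : SoundLA P C δ) (hc : ∀ M : FMDP A H F, P.queryCost M ≤ c) :
    queryComplexityLA C δ ≤ c :=
  (iInf₂_le P hP).trans (iSup₂_le fun M _ => hc M)

/-- A bound `E` on the number of recorded constraints: with `Q = q ^ A`, which exceeds the dimension
of the space of tensors, and with `t` the sum in brackets, `E = 16 * (Q * t) ^ 2` is such that
`(E * 2 ^ t) ^ Q < 2 ^ E`, so that a list of `E` constraints would violate the potential bound. -/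
def maxConstraints (A q b : ℕ) : ℕ := 16 * (q ^ A * (2 + 5 * q * A + 2 * b * A)) ^ 2

/-- The number of simulated episodes. -/
def numEpisodes (A q b : ℕ) : ℕ := (q ^ A) ^ 2 * b * maxConstraints A q b

/-- The parameters, in terms of `q`, which is a multiple of `d * H / δ`, and of a bound `b` of the
norm of the unknown parameter vector. The threshold `ε` is the `A`-th power of the loss `1 / q` that
is tolerated in each step; `ε'` is so small that `maxConstraints` errors of size `ε'` are harmless in
the potential argument. -/
def tuned (A q b : ℕ) (sel : Fin A → Fin A → Fin A) : Params A where
  κ := 12 * maxConstraints A q b * (q ^ A) ^ 3 * b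
  N := numEpisodes A q b * maxConstraints A q b ^ 2 * (q ^ A) ^ 13 * b ^ 3
  ε := (1 / q : ℝ) ^ A
  ε' := 1 / (2 * maxConstraints A q b * (q ^ A : ℕ))
  η := 1 / (4 * maxConstraints A q b * (q ^ A : ℕ) ^ 2)
  B := b
  sel := sel

section Numerics

variable {A q b : ℕ}

theorem maxConstraints_pos (hA : 0 < A) (hq : 16 ≤ q) : 0 < maxConstraints A q b := by
  have : 0 < q := by omega
  unfold maxConstraints
  positivity

theorem le_pow_of_one_le (hA : 0 < A) (hq : 16 ≤ q) : q ≤ q ^ A ∧ A ≤ q ^ A := by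
  refine ⟨Nat.le_self_pow hA.ne' q, ?_⟩
  exact (Nat.lt_pow_self (by omega : 1 < q)).le

theorem maxConstraints_le (hA : 0 < A) (hq : 16 ≤ q) (hb : 0 < b) :
    maxConstraints A q b ≤ (q ^ A) ^ 9 * b ^ 2 := by
  obtain ⟨h1, h2⟩ := le_pow_of_one_le hA hq
  unfold maxConstraints
  set Q := q ^ A
  have hQ : 16 ≤ Q := hq.trans h1
  have h3 : 2 + 5 * q * A + 2 * b * A ≤ 9 * Q ^ 2 * b := by
    have e1 : q * A ≤ Q * Q := Nat.mul_le_mul h1 h2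
    have e2 : Q * Q ≤ Q ^ 2 * b := by rw [sq]; exact Nat.le_mul_of_pos_right _ hb
    have e3 : b * A ≤ Q ^ 2 * b := by
      rw [mul_comm b A]; exact Nat.mul_le_mul_right _ (h2.trans (Nat.le_self_pow two_ne_zero _))
    nlinarith
  calc 16 * (Q * (2 + 5 * q * A + 2 * b * A)) ^ 2
      ≤ 16 * (Q * (9 * Q ^ 2 * b)) ^ 2 := by gcongr
    _ = 1296 * (Q ^ 6 * b ^ 2) := by ring
    _ ≤ Q ^ 3 * (Q ^ 6 * b ^ 2) := by
        refine Nat.mul_le_mul_right _ ?_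
        exact le_trans (by norm_num) (Nat.pow_le_pow_left hQ 3)
    _ = Q ^ 9 * b ^ 2 := by ring

theorem cost_tuned_le (hA : 0 < A) (hq : 16 ≤ q) (hb : 0 < b) {H : ℕ} (hH : H ≤ q)
    (sel : Fin A → Fin A → Fin A) :
    numEpisodes A q b * (H * (A * (tuned A q b sel).N + 1)) + A * (tuned A q b sel).N
      ≤ (q ^ A) ^ 56 * b ^ 13 := by
  obtain ⟨h1, h2⟩ := le_pow_of_one_le hA hq
  have hE := maxConstraints_le hA hq hb
  have hE0 := maxConstraints_pos (b := b) hA hq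
  simp only [tuned, numEpisodes]
  set Q := q ^ A
  set E := maxConstraints A q b
  have hQ : 16 ≤ Q := hq.trans h1
  set K := Q ^ 2 * b * E with hK
  set N := K * E ^ 2 * Q ^ 13 * b ^ 3 with hN
  have hK0 : 0 < K := by positivity
  have hN0 : 0 < N := by positivity
  calc K * (H * (A * N + 1)) + A * N
      ≤ K * (Q * (Q * N + Q * N)) + K * (Q * (Q * N)) := by
        refine Nat.add_le_add ?_ ?_
        · gcongr
          · exact hH.trans h1
          · exact Nat.mul_pos (by omega) hN0
        · calc A * N ≤ Q * N := Nat.mul_le_mul_right _ h2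
            _ ≤ Q * (Q * N) := Nat.mul_le_mul_left _ (Nat.le_mul_of_pos_left _ (by omega))
            _ ≤ K * (Q * (Q * N)) := Nat.le_mul_of_pos_left _ hK0
    _ = 3 * (K * Q ^ 2 * N) := by ring
    _ ≤ Q * (K * Q ^ 2 * N) := Nat.mul_le_mul_right _ (by omega)
    _ = Q ^ 20 * b ^ 5 * E ^ 4 := by rw [hN, hK]; ring
    _ ≤ Q ^ 20 * b ^ 5 * (Q ^ 9 * b ^ 2) ^ 4 := by gcongr
    _ = Q ^ 56 * b ^ 13 := by ring

theorem pow_lt_two_pow_maxConstraints (hA : 0 < A) (hq : 16 ≤ q) (hb : 0 < b) {d : ℕ}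
    (hd : 4 * (d + 1) ≤ q) :
    ((d + 1) ^ A + maxConstraints A q b * (2 * ((d + 1) ^ A * (2 ^ A) ^ 2)
      * ((d + 1) ^ A * (b ^ A) ^ 2) * (q ^ A) ^ 2)) ^ ((d + 1) ^ A) < 2 ^ maxConstraints A q b := by
  obtain ⟨h1, h2⟩ := le_pow_of_one_le hA hq
  have hE0 := maxConstraints_pos (b := b) hA hq
  have hL : (d + 1) ^ A * (2 ^ A) ^ 2 ≤ q ^ A := by
    rw [← pow_mul, mul_comm A 2, pow_mul, ← mul_pow]
    exact Nat.pow_le_pow_left (by omega) A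
  have hD : (d + 1) ^ A ≤ q ^ A := Nat.pow_le_pow_left (by omega) A
  set t := 2 + 5 * q * A + 2 * b * A with ht
  have hE : maxConstraints A q b = 16 * (q ^ A * t) ^ 2 := rfl
  have hqA : q ^ A ≤ 2 ^ (q * A) := by
    rw [pow_mul]; exact Nat.pow_le_pow_left (Nat.lt_two_pow_self).le A
  have hbA : b ^ A ≤ 2 ^ (b * A) := by
    rw [pow_mul]; exact Nat.pow_le_pow_left (Nat.lt_two_pow_self).le A
  set E := maxConstraints A q b
  have hb1 : 1 ≤ b ^ A := Nat.one_le_pow _ _ hb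
  have hbase : (d + 1) ^ A + E * (2 * ((d + 1) ^ A * (2 ^ A) ^ 2)
      * ((d + 1) ^ A * (b ^ A) ^ 2) * (q ^ A) ^ 2) ≤ E * 2 ^ t := by
    calc (d + 1) ^ A + E * (2 * ((d + 1) ^ A * (2 ^ A) ^ 2)
          * ((d + 1) ^ A * (b ^ A) ^ 2) * (q ^ A) ^ 2)
        ≤ q ^ A + E * (2 * q ^ A * (q ^ A * (b ^ A) ^ 2) * (q ^ A) ^ 2) := by gcongr
      _ ≤ E * ((q ^ A) ^ 4 * (b ^ A) ^ 2) + E * (2 * q ^ A * (q ^ A * (b ^ A) ^ 2) * (q ^ A) ^ 2) := by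
          refine Nat.add_le_add_right ?_ _
          calc q ^ A ≤ (q ^ A) ^ 4 := Nat.le_self_pow (by norm_num) _
            _ ≤ (q ^ A) ^ 4 * (b ^ A) ^ 2 := Nat.le_mul_of_pos_right _ (by positivity)
            _ ≤ E * ((q ^ A) ^ 4 * (b ^ A) ^ 2) := Nat.le_mul_of_pos_left _ hE0
      _ = E * (3 * (q ^ A) ^ 4 * (b ^ A) ^ 2) := by ring
      _ ≤ E * (2 ^ 2 * (2 ^ (q * A)) ^ 4 * (2 ^ (b * A)) ^ 2) := by gcongr; norm_num
      _ = E * 2 ^ (2 + 4 * (q * A) + 2 * (b * A)) := by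
          rw [pow_add, pow_add, pow_mul' 2 4 (q * A), pow_mul' 2 2 (b * A)]
      _ ≤ E * 2 ^ t := by
          gcongr
          · norm_num
          · rw [ht]; nlinarith [Nat.zero_le (q * A)]
  set s := q ^ A * t with hs
  have hE2 : E ≤ 2 ^ (4 + 2 * s) := by
    rw [hE, pow_add, pow_mul' 2 2 s]
    exact Nat.mul_le_mul (by norm_num) (Nat.pow_le_pow_left (Nat.lt_two_pow_self).le 2)
  have hQ : 16 ≤ q ^ A := hq.trans h1
  have ht4 : 4 ≤ t := by
    have : 1 ≤ q * A := Nat.mul_pos (by omega) hA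
    rw [ht]; nlinarith
  have hs1 : q ^ A * 4 ≤ s := Nat.mul_le_mul_left _ ht4
  have hs2 : (4 + 2 * s + t) * q ^ A < E := by
    rw [hE]
    have : (4 + 2 * s + t) * q ^ A = q ^ A * 4 + 2 * s * q ^ A + s := by rw [hs]; ring
    rw [this]
    have h3 : s * q ^ A ≤ s * s := Nat.mul_le_mul_left _ (by omega)
    nlinarith
  calc _ ≤ (E * 2 ^ t) ^ ((d + 1) ^ A) := Nat.pow_le_pow_left hbase _
    _ ≤ (E * 2 ^ t) ^ (q ^ A) := Nat.pow_le_pow_right (by positivity) hD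
    _ ≤ (2 ^ (4 + 2 * s) * 2 ^ t) ^ (q ^ A) := by gcongr
    _ = 2 ^ ((4 + 2 * s + t) * q ^ A) := by rw [← pow_add, ← pow_mul]
    _ < 2 ^ E := Nat.pow_lt_pow_right (by norm_num) hs2

theorem tuned_rounding_le {d : ℕ} (hA : 0 < A) (hq : 16 ≤ q) (hb : 0 < b) (hd : d + 1 ≤ q)
    (sel : Fin A → Fin A → Fin A) :
    (1 + 2 * d * (tuned A q b sel).B) / (tuned A q b sel).κ ≤ (tuned A q b sel).η := by
  obtain ⟨h1, h2⟩ := le_pow_of_one_le hA hq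
  have hE : (0 : ℝ) < maxConstraints A q b := by exact_mod_cast maxConstraints_pos hA hq
  have hb' : (1 : ℝ) ≤ b := by exact_mod_cast hb
  have hQd : (d + 1 : ℝ) ≤ (q ^ A : ℕ) := by exact_mod_cast hd.trans h1
  have hQ : (16 : ℝ) ≤ (q ^ A : ℕ) := by exact_mod_cast hq.trans h1
  simp only [tuned, Nat.cast_mul, Nat.cast_pow (q ^ A) 3, Nat.cast_ofNat]
  set E : ℝ := (maxConstraints A q b : ℝ)
  set Q : ℝ := ((q ^ A : ℕ) : ℝ)
  have hQ0 : 0 < Q := by linarith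
  have h3 : 1 + 2 * d * b ≤ 3 * Q * b := by nlinarith [(Nat.cast_nonneg d : (0 : ℝ) ≤ d)]
  rw [div_le_div_iff₀ (by positivity) (by positivity)]
  calc (1 + 2 * d * b) * (4 * E * Q ^ 2) ≤ 3 * Q * b * (4 * E * Q ^ 2) := by gcongr
    _ = 1 * (12 * E * Q ^ 3 * b) := by ring

/-- The numerical estimate behind the choice of the parameters: the terms of the regret bound are at
most `H / (16 * U)` each, and `H / U` is at most `δ`. -/
theorem regret_bound_le {E Q K N b R a H U δ η₀ η p : ℝ} (hE : 1 ≤ E) (hb : 1 ≤ b) (hU : 1 ≤ U)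
    (hQ : 16 * U ≤ Q) (ha : 0 ≤ a) (haQ : a ≤ Q) (hR : 0 ≤ R) (hRQ : R ≤ Q * b) (hH : 1 ≤ H)
    (hHU : H ≤ U) (hHδ : H ≤ U * δ) (hK : K = Q ^ 2 * b * E)
    (hN : N = K * E ^ 2 * Q ^ 13 * b ^ 3) (hη : η = 1 / (4 * E * Q ^ 2)) (hη₀ : η₀ ≤ η)
    (hp : p = a * R ^ 2 / (N * η ^ 2)) :
    η₀ + η + H * (1 / (16 * U) + η + R * p) + (K * (H + 1) + R) * (H * p) + R * E / K ≤ δ := by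
  have hQ16 : 16 ≤ Q := by linarith
  have hQ0 : 0 < Q := by linarith
  have hQu : 1 / Q ≤ 1 / (16 * U) := one_div_le_one_div_of_le (by linarith) hQ
  have hK1 : 1 ≤ K := by
    have h1 : 1 ≤ Q ^ 2 * b := one_le_mul_of_one_le_of_one_le (one_le_pow₀ (by linarith)) hb
    rw [hK]
    exact one_le_mul_of_one_le_of_one_le h1 hE
  have hp0 : 0 ≤ p := by
    rw [hp, hN]
    positivity
  have hηu : η ≤ 1 / Q := by
    rw [hη]
    refine one_div_le_one_div_of_le hQ0 ?_
    have h1 : 1 ≤ 4 * E * Q := by nlinarith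
    nlinarith
  have hKp : K * Q ^ 5 * b * p ≤ 1 := by
    rw [hp, hN, hη, ← mul_div_assoc, div_pow, one_pow, mul_one_div, div_div_eq_mul_div,
      div_le_one (by positivity)]
    calc K * Q ^ 5 * b * (a * R ^ 2) * (4 * E * Q ^ 2) ^ 2
        ≤ K * Q ^ 5 * b * (Q * (Q * b) ^ 2) * (4 * E * Q ^ 2) ^ 2 := by gcongr
      _ = 16 * (K * E ^ 2 * Q ^ 12 * b ^ 3) := by ring
      _ ≤ Q * (K * E ^ 2 * Q ^ 12 * b ^ 3) := by gcongr
      _ = K * E ^ 2 * Q ^ 13 * b ^ 3 := by ring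
  have hRp : R * p ≤ 1 / Q := by
    rw [le_div_iff₀ hQ0]
    refine le_trans ?_ hKp
    calc R * p * Q ≤ Q * b * p * Q := by gcongr
      _ = 1 * Q ^ 2 * b * p := by ring
      _ ≤ K * Q ^ 5 * b * p := by gcongr <;> [linarith; norm_num]
  have hKHp : K * (H + 1) * p ≤ 1 / Q := by
    rw [le_div_iff₀ hQ0]
    refine le_trans ?_ hKp
    calc K * (H + 1) * p * Q ≤ K * Q * p * Q := by gcongr; linarith
      _ = K * Q ^ 2 * 1 * p := by ring
      _ ≤ K * Q ^ 5 * b * p := by gcongr <;> [linarith; norm_num]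
  have hRK : R * E / K ≤ 1 / Q := by
    rw [div_le_div_iff₀ (by linarith) hQ0, hK]
    calc R * E * Q ≤ Q * b * E * Q := by gcongr
      _ = 1 * (Q ^ 2 * b * E) := by ring
  have hHu : H * (1 / (16 * U)) ≤ δ / 16 := by
    rw [mul_one_div, div_le_iff₀ (by positivity)]
    linarith
  generalize 1 / (16 * U) = u at hQu hHu ⊢
  generalize 1 / Q = v at *
  have hv0 : 0 ≤ v := (mul_nonneg hR hp0).trans hRp
  have hvH : v ≤ H * u := by nlinarith
  have h1 : H * (u + η + R * p) ≤ 3 * (H * u) := by nlinarith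
  have h2 : (K * (H + 1) + R) * (H * p) ≤ 2 * (H * u) := by
    calc (K * (H + 1) + R) * (H * p) = H * (K * (H + 1) * p + R * p) := by ring
      _ ≤ H * (u + u) := by gcongr <;> linarith
      _ = 2 * (H * u) := by ring
  linarith

theorem tuned_ε_eq {sel : Fin A → Fin A → Fin A} : (tuned A q b sel).ε = 1 / ((q ^ A : ℕ) : ℝ) := by
  simp only [tuned]
  push_cast
  rw [div_pow, one_pow]

theorem tuned_pow_lt {sel : Fin A → Fin A → Fin A} (hA : 0 < A) (hq : 16 ≤ q) (hb : 0 < b) {d : ℕ}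
    (hd : 4 * (d + 1) ≤ q) : ((d + 1) ^ A + (maxConstraints A q b : ℕ)
      * (2 * ((d + 1) ^ A * (2 ^ A) ^ 2) * ((d + 1) ^ A * ((b : ℝ) ^ A) ^ 2)
      / (tuned A q b sel).ε ^ 2) : ℝ) ^ ((d + 1) ^ A) < 2 ^ maxConstraints A q b := by
  have h := pow_lt_two_pow_maxConstraints (d := d) hA hq hb hd
  rw [tuned_ε_eq, one_div, inv_pow, div_inv_eq_mul]
  exact_mod_cast h

theorem tuned_N_eq {sel : Fin A → Fin A → Fin A} :
    ((tuned A q b sel).N : ℝ) = (numEpisodes A q b : ℝ) * (maxConstraints A q b : ℝ) ^ 2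
      * ((q ^ A : ℕ) : ℝ) ^ 13 * (b : ℝ) ^ 3 := by
  simp only [tuned, Nat.cast_mul, Nat.cast_pow _ 2, Nat.cast_pow _ 3, Nat.cast_pow _ 13]

theorem numEpisodes_eq : (numEpisodes A q b : ℝ)
    = ((q ^ A : ℕ) : ℝ) ^ 2 * b * (maxConstraints A q b : ℝ) := by
  simp only [numEpisodes, Nat.cast_mul, Nat.cast_pow _ 2]

/-- With the parameters chosen, the regret bound is at most `δ`. -/
theorem tuned_sound {d H U : ℕ} [NeZero A] {F : Type} [MeasurableSpace F] {δ : ℝ}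
    (hd : 0 < d) (hH : 0 < H) (hb : 0 < b) (hq : q = 16 * U) (hδ : 0 < δ) (hδ1 : δ ≤ 1)
    (hU : d * H / δ ≤ U) [NeZero (numEpisodes A q b)] {ρ : F → Feat A d} (hρ : Measurable ρ)
    (sel : Fin A → Fin A → Fin A) {C : Set (FMDP A H F)}
    (hC : (tuned A q b sel).RealizesClass ρ C
      ((1 + 2 * d * (tuned A q b sel).B) / (tuned A q b sel).κ)) :
    SoundLA ((tuned A q b sel).strategy H (numEpisodes A q b) ρ hρ).planner C δ := by
  have hA : 0 < A := NeZero.pos A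
  have hd1 : (1 : ℝ) ≤ d := by exact_mod_cast hd
  have hH1 : (1 : ℝ) ≤ H := by exact_mod_cast hH
  have hb1 : (1 : ℝ) ≤ b := by exact_mod_cast hb
  have hdH : (d * H : ℝ) ≤ U * δ := (div_le_iff₀ hδ).1 hU
  have hU0 : (0 : ℝ) ≤ U := Nat.cast_nonneg U
  have hdU : (d : ℝ) ≤ U := by nlinarith
  have hHU : (H : ℝ) ≤ U := by nlinarith
  have hHδ : (H : ℝ) ≤ U * δ := by nlinarith
  have hU1 : (1 : ℝ) ≤ U := by linarith
  have hdU' : d ≤ U := by exact_mod_cast hdU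
  have hU1' : 1 ≤ U := by exact_mod_cast hU1
  have hq16 : 16 ≤ q := by omega
  obtain ⟨h1, h2⟩ := le_pow_of_one_le hA hq16
  have hη₀ := tuned_rounding_le (b := b) (d := d) hA hq16 hb (by omega) sel
  have hη₀0 : 0 ≤ (1 + 2 * d * (tuned A q b sel).B) / (tuned A q b sel).κ := by
    simp only [tuned]; positivity
  have hm' := tuned_pow_lt (sel := sel) (d := d) hA hq16 hb (by omega)
  have hE1 : (1 : ℝ) ≤ maxConstraints A q b := by
    exact_mod_cast maxConstraints_pos (b := b) hA hq16
  have hqR : (q : ℝ) = 16 * U := by rw [hq]; push_cast; ring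
  have hQA : (A : ℝ) ≤ (q ^ A : ℕ) := by exact_mod_cast h2
  have hQ16 : 16 * (U : ℝ) ≤ (q ^ A : ℕ) := by rw [← hqR]; exact_mod_cast h1
  have hH6 : (6 * H : ℝ) ^ A ≤ ((q ^ A : ℕ) : ℝ) := by
    rw [Nat.cast_pow]
    exact pow_le_pow_left₀ (by positivity) (by rw [hqR]; linarith) A
  have hR : (1 + d * b : ℝ) ≤ ((q ^ A : ℕ) : ℝ) * b := by nlinarith
  have hK0 : (0 : ℝ) < numEpisodes A q b := by exact_mod_cast NeZero.pos (numEpisodes A q b)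
  have herr := regret_bound_le hE1 hb1 hU1 hQ16 (Nat.cast_nonneg A) hQA (by positivity) hR hH1 hHU
    hHδ numEpisodes_eq (tuned_N_eq (sel := sel)) rfl hη₀ rfl
  have hκη : (tuned A q b sel).η
      = 1 / (4 * (maxConstraints A q b : ℝ) * ((q ^ A : ℕ) : ℝ) ^ 2) := rfl
  have hε'eq : (tuned A q b sel).ε'
      = 1 / (2 * (maxConstraints A q b : ℝ) * ((q ^ A : ℕ) : ℝ)) := rfl
  have hε := tuned_ε_eq (A := A) (q := q) (b := b) (sel := sel)
  have hN : (0 : ℝ) < (tuned A q b sel).N := by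
    rw [tuned_N_eq]
    have : (0 : ℝ) < (q ^ A : ℕ) := by linarith
    positivity
  have hN' : 0 < (tuned A q b sel).N := by exact_mod_cast hN
  rw [← hqR] at herr
  have hη : 0 < (tuned A q b sel).η := by rw [hκη]; positivity
  have hη1 : (tuned A q b sel).η ≤ 1 := by
    rw [hκη, div_le_one (by positivity)]
    have h3 : (1 : ℝ) ≤ ((q ^ A : ℕ) : ℝ) ^ 2 := one_le_pow₀ (by linarith)
    nlinarith
  refine (tuned A q b sel).strategy_sound (m := maxConstraints A q b) (τ := 1 / q) (b := b) hρ hC hH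
    hη₀0 hN' hη hη1 ?_ (by rw [hqR]; positivity) rfl hb1 le_rfl ?_ hm' herr
  · refine (mul_le_mul (add_le_add_left hη₀ _) hH6 (by positivity) (by positivity)).trans_eq ?_
    rw [hκη, hε'eq]
    field_simp
    ring
  · have h3 : 0 ≤ ((q ^ A : ℕ) : ℝ) ^ 2 := by positivity
    have h4 := mul_le_mul_of_nonneg_right hE1 h3
    calc (maxConstraints A q b : ℝ) * (tuned A q b sel).ε' ^ 2
        = 1 / (4 * (maxConstraints A q b : ℝ) * ((q ^ A : ℕ) : ℝ) ^ 2) := by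
          rw [hε'eq]
          field_simp
          ring
      _ ≤ 1 / (2 * ((q ^ A : ℕ) : ℝ) ^ 2) := one_div_le_one_div_of_le (by positivity) (by linarith)
      _ = (tuned A q b sel).ε ^ 2 / 2 := by
          rw [hε]
          field_simp

end Numerics

/-- The query complexity of a class whose optimal values are realized by hypotheses. -/
theorem queryComplexityLA_le_of_realizesClass {A d H U b : ℕ} [NeZero A] {F : Type}
    [MeasurableSpace F] {δ : ℝ} (hd : 0 < d) (hH : 0 < H) (hb : 0 < b) (hδ : 0 < δ) (hδ1 : δ ≤ 1)
    (hU : d * H / δ ≤ U) (sel : Fin A → Fin A → Fin A) {C : Set (FMDP A H F)}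
    (hC : ∀ P : Params A, 0 < P.κ → P.B = b → P.sel = sel → d * P.B / P.κ ≤ 1 →
      ∃ ρ : F → Feat A d, Measurable ρ ∧ P.RealizesClass ρ C ((1 + 2 * d * P.B) / P.κ)) :
    queryComplexityLA C δ ≤ 1 + (((16 * U) ^ A) ^ 56 * b ^ 13 : ℕ) := by
  have hA : 0 < A := NeZero.pos A
  have hd1 : (1 : ℝ) ≤ d := by exact_mod_cast hd
  have hH1 : (1 : ℝ) ≤ H := by exact_mod_cast hH
  have hdH : (d * H : ℝ) ≤ U * δ := (div_le_iff₀ hδ).1 hU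
  have hU0 : (0 : ℝ) ≤ U := Nat.cast_nonneg U
  have hdU : d ≤ U := by exact_mod_cast (by nlinarith : (d : ℝ) ≤ U)
  have hHU : H ≤ U := by exact_mod_cast (by nlinarith : (H : ℝ) ≤ U)
  have hq : 16 ≤ 16 * U := by omega
  have hE := maxConstraints_pos (b := b) hA hq
  have hK : NeZero (numEpisodes A (16 * U) b) := ⟨by
    have : 0 < 16 * U := by omega
    unfold numEpisodes
    positivity⟩
  have hκ : 0 < (tuned A (16 * U) b sel).κ := by
    have : 0 < 16 * U := by omega
    simp only [tuned]
    positivity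
  have hκη := tuned_rounding_le (b := b) (d := d) hA hq hb (by omega) sel
  have hη1 : (tuned A (16 * U) b sel).η ≤ 1 := by
    have hE1 : (1 : ℝ) ≤ maxConstraints A (16 * U) b := by exact_mod_cast hE
    have hQ : (1 : ℝ) ≤ ((16 * U) ^ A : ℕ) := by
      exact_mod_cast Nat.one_le_pow A (16 * U) (by omega)
    have h3 : (1 : ℝ) ≤ (((16 * U) ^ A : ℕ) : ℝ) ^ 2 := one_le_pow₀ hQ
    rw [show (tuned A (16 * U) b sel).η
      = 1 / (4 * (maxConstraints A (16 * U) b : ℝ) * (((16 * U) ^ A : ℕ) : ℝ) ^ 2) from rfl,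
      div_le_one (by positivity)]
    nlinarith
  obtain ⟨ρ, hρ, hC⟩ := hC (tuned A (16 * U) b sel) hκ rfl rfl (by
    refine le_trans ?_ (hκη.trans hη1)
    have hB : 0 ≤ (d : ℝ) * (tuned A (16 * U) b sel).B := by simp only [tuned]; positivity
    gcongr
    linarith)
  refine queryComplexityLA_le (tuned_sound hd hH hb rfl hδ hδ1 hU hρ sel hC) fun M => ?_
  refine (Params.strategy_queryCost_le _ H _ ρ hρ M).trans (add_le_add le_rfl (Nat.cast_le.2 ?_))
  exact cost_tuned_le hA hq hb (by omega) sel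

/-! ### Horizon one and large tolerances -/

section Bandit

variable {A : ℕ} [NeZero A]

/-- The `j` arms that follow the arm `ω`, cyclically. -/
def arms (j : ℕ) (ω : Fin A) (i : Fin j) : Fin A := ω + Fin.ofNat A i

/-- The index of the arm whose estimated reward is the largest. -/
def bestArm {j : ℕ} [NeZero j] (T : Fin j → Unit → ℝ) : Fin j :=
  (Finite.exists_max fun i => T i ()).choose

omit [NeZero A] in
theorem le_bestArm {j : ℕ} [NeZero j] (T : Fin j → Unit → ℝ) (i : Fin j) :
    T i () ≤ T (bestArm T) () :=
  (Finite.exists_max fun i => T i ()).choose_spec i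

/-- Estimate the mean rewards of `j` consecutive arms from `N` samples each, and play the best one.
The first arm is chosen uniformly at random. Rewards are rounded to multiples of `1 / 8`. -/
abbrev banditStrategy (A j N : ℕ) [NeZero A] [NeZero j] (F : Type) [MeasurableSpace F] :
    Strategy A 8 F Unit where
  ρ := fun _ => ()
  measurable_ρ := measurable_const
  Z := Unit
  z₀ := ()
  dflt := 0
  Ω := Fin A
  instΩ := inferInstance
  countable_Ω := inferInstance
  discrete_Ω := inferInstance
  ν := coin A
  prob_ν := inferInstance
  call _ ω x := (estimate x.1 N j (arms j ω) fun _ y _ => y.rew).map fun T =>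
    (arms j ω (bestArm T), ())

variable {H : ℕ} {F : Type} [MeasurableSpace F] {j N : ℕ} [NeZero j]

theorem banditStrategy_queryCost_le (M : FMDP A H F) :
    (banditStrategy A j N F).planner.queryCost M ≤ 1 + (j * N : ℕ) := by
  refine (banditStrategy A j N F).queryCost_le fun z x => ?_
  refine (lintegral_mono (g := fun _ => ((j * N : ℕ) : ℝ≥0∞)) fun ω : Fin A =>
    (Prog.cost_map_le _ _).trans (estimate_cost _ _ _ _ _)).trans
    (by rw [lintegral_const, measure_univ (μ := coin A), mul_one])

/-- If no initial state has an optimal value above `δ`, no query is needed. -/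
theorem queryComplexityLA_le_one {C : Set (FMDP A H F)} {δ : ℝ}
    (hC : ∀ M ∈ C, ∀ s₀ : M.states, M.stage s₀ = 0 → M.vstar s₀ ≤ δ) :
    queryComplexityLA C δ ≤ 1 := by
  refine queryComplexityLA_le (P := (banditStrategy A 1 0 F).planner) (fun M hM s₀ hs₀ => ?_)
    fun M => (banditStrategy_queryCost_le M).trans_eq (by simp)
  exact (sub_nonpos.2 (hC M hM s₀ hs₀)).trans ENNReal.toReal_nonneg

omit [NeZero A] in
/-- Among the arms that are tried, the chosen one is nearly optimal in expectation. -/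
theorem le_ev_bestArm (S : Sim A (Answer 8 Unit)) (n : ℕ) (b : Fin j → Fin A) (i : Fin j) :
    S.mean n (b i) (fun y => y.rew) - 3 / 8
      ≤ S.ev (estimate n (32 * j) j b fun _ y _ => y.rew) fun T =>
        S.mean n (b (bestArm T)) fun y => y.rew := by
  have hj : (0 : ℝ) < j := by exact_mod_cast NeZero.pos j
  have hvar := estimate_variance S (n := n) (N := 32 * j) (by have := NeZero.pos j; omega)
    (fun _ : Unit => (1 : ℝ)) (R := 1) j b (fun _ y _ => y.rew) (fun k y => by
      simp only [dotProduct, Finset.univ_unique, Finset.sum_singleton, mul_one]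
      rw [abs_of_nonneg y.rew_nonneg]
      exact y.rew_le_one)
  simp only [dotProduct, Finset.univ_unique, Finset.sum_singleton, mul_one] at hvar
  have hN : (j * 1 ^ 2 / ((32 * j : ℕ) : ℝ)) = 1 / 32 := by
    push_cast
    field_simp
  rw [hN] at hvar
  set μ : Fin A → ℝ := fun a => S.mean n a fun y => y.rew with hμ
  have key : ∀ T : Fin j → Unit → ℝ, μ (b i) - 1 / 8 - 8 * ∑ k, (T k () - μ (b k)) ^ 2
      ≤ μ (b (bestArm T)) := by
    intro T
    have h1 := le_bestArm T i
    have h2 : ∀ k, (T k () - μ (b k)) ^ 2 ≤ ∑ k, (T k () - μ (b k)) ^ 2 := fun k =>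
      Finset.single_le_sum (f := fun k => (T k () - μ (b k)) ^ 2) (fun _ _ => sq_nonneg _)
        (Finset.mem_univ k)
    have h3 := h2 i
    have h4 := h2 (bestArm T)
    -- `|x| ≤ 4 x² + 1 / 16` for the two errors
    nlinarith [sq_nonneg (8 * (T i () - μ (b i)) + 1),
      sq_nonneg (8 * (T (bestArm T) () - μ (b (bestArm T))) - 1)]
  refine le_trans ?_ (S.ev_mono _ key)
  rw [Sim.ev_sub, Sim.ev_const, Sim.ev_const_mul]
  change μ (b i) - 3 / 8 ≤ _
  have h5 : S.ev (estimate n (32 * j) j b fun _ y _ => y.rew)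
      (fun T => ∑ k, (T k () - μ (b k)) ^ 2) ≤ 1 / 32 := hvar
  linarith

omit [MeasurableSpace F] in
theorem vstar_le_mean_rew (M : FMDP A 1 F) (s : M.states) : ∃ a : Fin A,
    M.vstar s - 1 / 8 ≤ (M.sim (fun _ => ()) 8).mean s a fun y : Answer 8 Unit => y.rew := by
  obtain ⟨a, ha⟩ := MDP.exists_vstar_eq_qstar (M := M.toMDP) one_pos s
  refine ⟨a, ?_⟩
  have h := (abs_le.1 (M.abs_mean_sub_integral_le (κ := 8) (fun _ => ()) (by norm_num) s a
    fun _ => 0)).1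
  have h1 : M.vstar s = ∫ x, (x.1 + 0) ∂(M.Q s a) := by
    rw [ha, MDP.qstar_eq_integral one_pos]
    refine integral_congr_ae ?_
    filter_upwards [M.ae_stage s a] with x hx
    rw [M.vstar_bot x.2 (le_antisymm (M.stage_le _) (le_trans (by omega) hx))]
  rw [← h1] at h
  simp only [add_zero] at h
  push_cast at h
  linarith

omit [NeZero j] in
/-- For each `i`, the arm `a` is the `i`-th of the arms tried for exactly one of the choices of the
first arm. -/
theorem mul_le_sum_of_arms (hj : j ≤ A) (a : Fin A) {R : Fin A → ℝ} (hR : ∀ ω, 0 ≤ R ω) {v : ℝ}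
    (h : ∀ ω i, arms j ω i = a → v ≤ R ω) : j * v ≤ ∑ ω, R ω := by
  have hinj : Function.Injective fun i : Fin j => a - Fin.ofNat A i := by
    intro i i' hi
    have h1 : Fin.ofNat A (i : ℕ) = Fin.ofNat A (i' : ℕ) := sub_right_injective hi
    have h2 := congrArg Fin.val h1
    simp only [Fin.val_ofNat] at h2
    rw [Nat.mod_eq_of_lt (i.2.trans_le hj), Nat.mod_eq_of_lt (i'.2.trans_le hj)] at h2
    exact Fin.ext h2
  calc (j : ℝ) * v = ∑ _i : Fin j, v := by simp
    _ ≤ ∑ i : Fin j, R (a - Fin.ofNat A i) :=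
        Finset.sum_le_sum fun i _ => h _ i (by rw [arms, sub_add_cancel])
    _ = ∑ ω ∈ Finset.univ.image (fun i : Fin j => a - Fin.ofNat A i), R ω :=
        (Finset.sum_image fun x _ y _ hxy => hinj hxy).symm
    _ ≤ ∑ ω, R ω := Finset.sum_le_sum_of_subset_of_nonneg (Finset.subset_univ _)
        fun ω _ _ => hR ω

theorem banditStrategy_isLowerValue (M : FMDP A H F) :
    Strategy.IsLowerValue (S := banditStrategy A j N F) M (fun _ _ _ => 0) where
  valid _ _ x := (estimate_valid (fun y : Answer 8 Unit => y.2.1) x.1 N j _ _ (mem_singleton x.1)).map _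
  nonneg _ _ _ := le_rfl
  zero _ _ := rfl
  succ _ _ _ _ := Sim.ev_nonneg _ _ fun _ => Sim.mean_nonneg _ fun y =>
    add_nonneg y.rew_nonneg le_rfl

theorem banditStrategy_sound (hj : j ≤ A) {δ : ℝ} (hδ : 1 / 2 < δ) (hjδ : 2 * (1 - δ) * A ≤ j)
    (C : Set (FMDP A 1 F)) : SoundLA (banditStrategy A j (32 * j) F).planner C δ := by
  intro M _ s₀ _
  have hA : (0 : ℝ) < A := by exact_mod_cast NeZero.pos A
  rcases lt_or_ge (M.vstar s₀) (1 / 2) with hv | hv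
  · exact (by linarith : M.vstar s₀ - δ ≤ 0).trans ENNReal.toReal_nonneg
  have hv1 : M.vstar s₀ ≤ 1 := by simpa using MDP.vstar_le (M := M.toMDP) s₀
  obtain ⟨a, ha⟩ := vstar_le_mean_rew M s₀
  set S := M.sim (fun _ => ()) 8 with hS
  set R : Fin A → ℝ := fun ω => S.ev (estimate (s₀ : ℕ) (32 * j) j (arms j ω) fun _ y _ => y.rew)
    fun T => S.mean s₀ (arms j ω (bestArm T)) fun y : Answer 8 Unit => y.rew with hRdef
  have hR : ∀ ω, 0 ≤ R ω := fun ω => Sim.ev_nonneg _ _ fun T =>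
    Sim.mean_nonneg _ fun y => y.rew_nonneg
  have hsum := mul_le_sum_of_arms hj a hR (v := M.vstar s₀ - 1 / 2) fun ω i hi => by
    have h := le_ev_bestArm S s₀ (arms j ω) i
    rw [hi] at h
    linarith
  have h := (banditStrategy_isLowerValue (j := j) (N := 32 * j) M).le_value one_pos s₀
  have h2 : ∫⁻ ω, ENNReal.ofReal (R ω) ∂(coin A)
      ≤ (banditStrategy A j (32 * j) F).planner.value M s₀ := by
    refine le_trans (le_of_eq (lintegral_congr fun ω => ?_)) h
    congr 1
    refine Eq.trans ?_ (Sim.ev_map _ _ _ _).symm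
    simp only [Strategy.lookahead, add_zero]
    rfl
  rw [ofReal_lintegral_coin (NeZero.pos A) hR] at h2
  refine le_trans ?_ ((ENNReal.ofReal_le_iff_le_toReal (Planner.value_ne_top _)).1 h2)
  rw [le_div_iff₀ hA]
  refine le_trans ?_ hsum
  have h3 : 2 * (1 - δ) * A * (M.vstar s₀ - 1 / 2) ≤ j * (M.vstar s₀ - 1 / 2) :=
    mul_le_mul_of_nonneg_right hjδ (by linarith)
  refine le_trans ?_ h3
  have h4 : M.vstar s₀ - δ ≤ 2 * (1 - δ) * (M.vstar s₀ - 1 / 2) := by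
    nlinarith [mul_nonneg (by linarith : 0 ≤ 2 * δ - 1) (sub_nonneg.2 hv1)]
  calc (M.vstar s₀ - δ) * A ≤ 2 * (1 - δ) * (M.vstar s₀ - 1 / 2) * A := by gcongr
    _ = 2 * (1 - δ) * A * (M.vstar s₀ - 1 / 2) := by ring

/-- For horizon one and `δ > 1 / 2`, the fraction of the arms that has to be tried is of the order
of `1 - δ`, and `A * (1 - δ)` is at most `(1 / δ) ^ A`. -/
theorem queryComplexityLA_le_of_horizon_one (C : Set (FMDP A 1 F)) {δ : ℝ} (hδ : 1 / 2 < δ)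
    (hδ1 : δ ≤ 1) : queryComplexityLA C δ ≤ ENNReal.ofReal (1 + 128 * ((1 / δ) ^ A) ^ 2) := by
  have hδ0 : 0 < δ := by linarith
  have hA : (0 : ℝ) < A := by exact_mod_cast NeZero.pos A
  rcases hδ1.eq_or_lt with rfl | hδ1
  · refine (queryComplexityLA_le_one fun M _ s₀ _ => by simpa using MDP.vstar_le s₀).trans ?_
    norm_num
  have hpos : 0 < 2 * (1 - δ) * A := by nlinarith
  set j := ⌈2 * (1 - δ) * A⌉₊ with hjdef
  have hj0 : 0 < j := Nat.ceil_pos.2 hpos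
  have : NeZero j := ⟨hj0.ne'⟩
  have hjA : j ≤ A := Nat.ceil_le.2 (by nlinarith)
  have hjx : (j : ℝ) ≤ 2 * (1 / δ) ^ A := by
    have h1 : (j : ℝ) < 2 * (1 - δ) * A + 1 := Nat.ceil_lt_add_one hpos.le
    have h2 := one_add_mul_le_pow (a := 1 / δ - 1)
      (by have : 0 < 1 / δ := by positivity
          linarith) A
    have h3 : 1 - δ ≤ 1 / δ - 1 := by
      rw [le_sub_iff_add_le, le_div_iff₀ hδ0]
      nlinarith [sq_nonneg (1 - δ)]
    have h4 : A * (1 - δ) ≤ A * (1 / δ - 1) := by gcongr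
    rw [add_sub_cancel] at h2
    linarith
  refine (queryComplexityLA_le (banditStrategy_sound hjA hδ (Nat.le_ceil _) C)
    fun M => banditStrategy_queryCost_le M).trans ?_
  rw [ENNReal.ofReal_add zero_le_one (by positivity), ENNReal.ofReal_one]
  refine add_le_add le_rfl ?_
  rw [← ENNReal.ofReal_natCast]
  refine ENNReal.ofReal_le_ofReal ?_
  push_cast
  nlinarith [(Nat.cast_nonneg j : (0 : ℝ) ≤ j)]

end Bandit

/-! ### The three classes -/

section Classes

variable {A d H : ℕ} {B δ : ℝ}

/-- `c` bounds the query complexity of the three classes. -/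
def ClassesLe (B : ℝ) (d H A : ℕ) (δ : ℝ) (c : ℝ≥0∞) : Prop :=
  queryComplexityLA (classV B d H A) δ ≤ c ∧
  queryComplexityLA (classQ B d H A ∩ classPdet A H (QFeat A d)) δ ≤ c ∧
  queryComplexityLA (classReach B d H A) δ ≤ c

theorem ClassesLe.mono {c c' : ℝ≥0∞} (h : ClassesLe B d H A δ c) (hc : c ≤ c') :
    ClassesLe B d H A δ c' :=
  ⟨h.1.trans hc, h.2.1.trans hc, h.2.2.trans hc⟩

theorem queryComplexityLA_anti {F : Type} [MeasurableSpace F] (C : Set (FMDP A H F)) {δ' : ℝ}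
    (h : δ' ≤ δ) : queryComplexityLA C δ ≤ queryComplexityLA C δ' :=
  le_iInf₂ fun P hP => iInf₂_le P fun M hM s₀ hs₀ =>
    (sub_le_sub_left h _).trans (hP M hM s₀ hs₀)

theorem ClassesLe.anti {c : ℝ≥0∞} {δ' : ℝ} (h : ClassesLe B d H A δ' c) (hδ : δ' ≤ δ) :
    ClassesLe B d H A δ c :=
  ⟨(queryComplexityLA_anti _ hδ).trans h.1, (queryComplexityLA_anti _ hδ).trans h.2.1,
    (queryComplexityLA_anti _ hδ).trans h.2.2⟩

theorem inner_le_of_norm_le {v θ : EuclideanSpace ℝ (Fin d)} (hv : ‖v‖ ≤ 1) (hθ : ‖θ‖ ≤ B) :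
    inner ℝ v θ ≤ B := by
  refine (real_inner_le_norm v θ).trans ?_
  nlinarith [norm_nonneg θ]

theorem classesLe_one [NeZero A] (hH : 0 < H) (h : B ≤ δ) : ClassesLe B d H A δ 1 := by
  refine ⟨queryComplexityLA_le_one ?_, queryComplexityLA_le_one ?_, queryComplexityLA_le_one ?_⟩
  · rintro M ⟨hφ, θ, hθ, hv⟩ s₀ _
    rw [hv]
    exact (inner_le_of_norm_le (hφ s₀) hθ).trans h
  · rintro M ⟨⟨hφ, θ, hθ, hq⟩, _⟩ s₀ _
    obtain ⟨a, ha⟩ := MDP.exists_vstar_eq_qstar (M := M.toMDP) hH s₀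
    rw [ha, hq]
    exact (inner_le_of_norm_le (hφ s₀ a) hθ).trans h
  · rintro M ⟨hφ, _, θ, hθ, hv⟩ s₀ hs₀
    rw [(hv s₀ ⟨s₀, hs₀, .refl⟩).1]
    exact (inner_le_of_norm_le (hφ s₀) hθ).trans h

/-- The bound for `δ ≤ 1`. For the third class, the features of the actions are ignored. -/
theorem classesLe_of_le_one [NeZero A] (hd : 0 < d) (hH : 0 < H) (hδ : 0 < δ) (hδ1 : δ ≤ 1)
    {U b : ℕ} (hb : 0 < b) (hB : B ≤ b) (hU : d * H / δ ≤ U) :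
    ClassesLe B d H A δ (1 + (((16 * U) ^ A) ^ 56 * b ^ 13 : ℕ)) := by
  refine ⟨?_, ?_, ?_⟩
  · refine queryComplexityLA_le_of_realizesClass hd hH hb hδ hδ1 hU (fun _ a' => a')
      fun P hκ hPB hsel hsmall => ⟨fun f _ => roundVec P.κ f,
        measurable_pi_iff.2 fun _ => measurable_roundVec P.κ,
        Params.realizesClass_state hH hκ (by simp [hsel]) hsmall id fun M hM => ⟨hM.1, ?_⟩⟩
    obtain ⟨θ, hθ, hv⟩ := hM.2
    exact ⟨θ, hPB ▸ hθ.trans hB, fun s _ => hv s⟩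
  · exact queryComplexityLA_le_of_realizesClass hd hH hb hδ hδ1 hU (fun a _ => a)
      fun P hκ hPB hsel hsmall => ⟨fun f a => roundVec P.κ (f a),
        measurable_pi_iff.2 fun a => (measurable_roundVec P.κ).comp (measurable_pi_apply a),
        Params.realizesClass_action hH hκ (by simp [hsel]) hsmall (hPB ▸ hB)⟩
  · refine queryComplexityLA_le_of_realizesClass hd hH hb hδ hδ1 hU (fun _ a' => a')
      fun P hκ hPB hsel hsmall => ⟨fun f _ => roundVec P.κ f.1,
        measurable_pi_iff.2 fun _ => (measurable_roundVec P.κ).comp measurable_fst,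
        Params.realizesClass_state hH hκ (by simp [hsel]) hsmall Prod.fst fun M hM => ⟨hM.1, ?_⟩⟩
    obtain ⟨θ, hθ, hv⟩ := hM.2.2
    exact ⟨θ, hPB ▸ hθ.trans hB, fun s hs => (hv s hs).1⟩

/-- The bound for `δ ≤ 1`, in terms of real numbers. -/
theorem classesLe_ofReal [NeZero A] (hd : 0 < d) (hH : 0 < H) (hB : 0 < B) (hδ : 0 < δ)
    (hδ1 : δ ≤ 1) : ClassesLe B d H A δ
      (ENNReal.ofReal (1 + ((32 * (d * H / δ)) ^ A) ^ 56 * (B + 2) ^ 13)) := by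
  have hd1 : (1 : ℝ) ≤ d := by exact_mod_cast hd
  have hH1 : (1 : ℝ) ≤ H := by exact_mod_cast hH
  have hu : 1 ≤ d * H / δ := by
    rw [le_div_iff₀ hδ]
    nlinarith
  refine (classesLe_of_le_one hd hH hδ hδ1 (b := ⌈B⌉₊ + 1) (Nat.succ_pos _)
    ((Nat.le_ceil B).trans (by simp)) (Nat.le_ceil _)).mono ?_
  have hU := Nat.ceil_lt_add_one (zero_le_one.trans hu)
  have hb := Nat.ceil_lt_add_one hB.le
  rw [ENNReal.ofReal_add zero_le_one (by positivity), ENNReal.ofReal_one, ← ENNReal.ofReal_natCast]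
  refine add_le_add le_rfl (ENNReal.ofReal_le_ofReal ?_)
  push_cast
  gcongr (?_ ^ A) ^ 56 * ?_ ^ 13 <;> linarith

open MvPolynomial in
/-- For a given number of actions, the case `δ > 1` is reduced to `δ = 1`, which costs a factor
`1 + B`, unless `δ` is so large that nothing has to be done. -/
theorem exists_polynomial_of_actions [NeZero A] : ∃ p : MvPolynomial (Fin 2) ℝ,
    ∀ (d H : ℕ) (B δ : ℝ), 0 < d → 0 < H → 0 < B → 0 < δ →
      ClassesLe B d H A δ (ENNReal.ofReal (eval ![((d : ℝ) * H / δ) ^ A, B] p)) := by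
  refine ⟨1 + C (((32 : ℝ) ^ A) ^ 56) * X 0 ^ 56 * ((1 + X 1) ^ A) ^ 56
      * (X 1 + 2) ^ 13, fun d H B δ hd hH hB hδ => ?_⟩
  have hd1 : (1 : ℝ) ≤ d := by exact_mod_cast hd
  have hH1 : (1 : ℝ) ≤ H := by exact_mod_cast hH
  simp only [map_add, map_mul, map_pow, map_one, eval_X, Matrix.cons_val_zero,
    Matrix.cons_val_one, map_ofNat]
  rcases le_or_gt B δ with h | h
  · refine (classesLe_one hH h).mono ?_
    rw [ENNReal.one_le_ofReal]
    exact le_add_of_nonneg_right (by positivity)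
  have hle : d * H / min δ 1 ≤ d * H / δ * (1 + B) := by
    rcases le_total δ 1 with h1 | h1
    · rw [min_eq_left h1]
      exact le_mul_of_one_le_right (by positivity) (by linarith)
    · rw [min_eq_right h1, div_one, div_mul_eq_mul_div, le_div_iff₀ hδ]
      gcongr
      linarith
  refine ((classesLe_ofReal hd hH hB (lt_min hδ one_pos) (min_le_right δ 1)).anti
    (min_le_left δ 1)).mono (ENNReal.ofReal_le_ofReal ?_)
  rw [add_le_add_iff_left, ← mul_pow, ← mul_pow, ← mul_pow, ← mul_pow, mul_assoc 32]
  gcongr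

open MvPolynomial in
/-- A polynomial that does not depend on the number of actions: if `d * H / δ` is at least `2`, then
constant factors are bounded by its powers. -/
theorem exists_polynomial : ∃ p : MvPolynomial (Fin 2) ℝ,
    ∀ (A d H : ℕ) (B δ : ℝ), 0 < A → 0 < d → 0 < H → 0 < B → 0 < δ → δ ≤ 1 →
      ClassesLe B d H A δ (ENNReal.ofReal (eval ![((d : ℝ) * H / δ) ^ A, B] p)) := by
  refine ⟨1 + X 0 ^ 336 * (X 1 + 2) ^ 13 + 128 * X 0 ^ 2,
    fun A d H B δ hA hd hH hB hδ hδ1 => ?_⟩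
  have : NeZero A := ⟨hA.ne'⟩
  have hd1 : (1 : ℝ) ≤ d := by exact_mod_cast hd
  have hH1 : (1 : ℝ) ≤ H := by exact_mod_cast hH
  simp only [map_add, map_mul, map_pow, map_one, eval_X, Matrix.cons_val_zero,
    Matrix.cons_val_one, map_ofNat]
  rcases le_or_gt 2 (d * H / δ) with hu | hu
  · refine (classesLe_ofReal hd hH hB hδ hδ1).mono (ENNReal.ofReal_le_ofReal ?_)
    refine le_add_of_le_of_nonneg ?_ (by positivity)
    have h1 : 32 * (d * H / δ) ≤ (d * H / δ) ^ 6 := by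
      rw [pow_succ]
      gcongr
      exact le_trans (by norm_num) (pow_le_pow_left₀ zero_le_two hu 5)
    have h2 : ((32 * (d * H / δ)) ^ A) ^ 56 ≤ ((d * H / δ) ^ A) ^ 336 := by
      calc ((32 * (d * H / δ)) ^ A) ^ 56 ≤ (((d * H / δ) ^ 6) ^ A) ^ 56 := by gcongr
        _ = ((d * H / δ) ^ A) ^ 336 := by simp only [← pow_mul]; ring_nf
    gcongr
    -- In the remaining case, `d = H = 1` and `δ > 1 / 2`.
  · rw [div_lt_iff₀ hδ] at hu
    obtain rfl : d = 1 := le_antisymm (by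
      have : (d : ℝ) < 2 := by nlinarith
      exact Nat.lt_succ_iff.1 (by exact_mod_cast this)) hd
    obtain rfl : H = 1 := le_antisymm (by
      have : (H : ℝ) < 2 := by nlinarith
      exact Nat.lt_succ_iff.1 (by exact_mod_cast this)) hH
    have hδ2 : 1 / 2 < δ := by
      push_cast at hu
      linarith
    have hc : ENNReal.ofReal (1 + 128 * ((1 / δ) ^ A) ^ 2) ≤ ENNReal.ofReal
        (1 + (((1 : ℕ) * (1 : ℕ) / δ) ^ A) ^ 336 * (B + 2) ^ 13
          + 128 * (((1 : ℕ) * (1 : ℕ) / δ) ^ A) ^ 2) := by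
      refine ENNReal.ofReal_le_ofReal ?_
      have : 0 ≤ ((1 / δ) ^ A) ^ 336 * (B + 2) ^ 13 := by positivity
      push_cast
      rw [mul_one]
      linarith
    exact ⟨(queryComplexityLA_le_of_horizon_one _ hδ2 hδ1).trans hc,
      (queryComplexityLA_le_of_horizon_one _ hδ2 hδ1).trans hc,
      (queryComplexityLA_le_of_horizon_one _ hδ2 hδ1).trans hc⟩

end Classes

theorem theorem2 :
    (∀ A : ℕ, 0 < A → ∃ p : MvPolynomial (Fin 2) ℝ,
      ∀ (d H : ℕ) (B δ : ℝ), 0 < d → 0 < H → 0 < B → 0 < δ →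
        queryComplexityLA (classV B d H A) δ ≤
          ENNReal.ofReal (MvPolynomial.eval ![((d : ℝ) * H / δ) ^ A, B] p) ∧
        queryComplexityLA (classQ B d H A ∩ classPdet A H (QFeat A d)) δ ≤
          ENNReal.ofReal (MvPolynomial.eval ![((d : ℝ) * H / δ) ^ A, B] p) ∧
        queryComplexityLA (classReach B d H A) δ ≤
          ENNReal.ofReal (MvPolynomial.eval ![((d : ℝ) * H / δ) ^ A, B] p)) ∧
    (∃ p : MvPolynomial (Fin 2) ℝ,
      ∀ (A d H : ℕ) (B δ : ℝ), 0 < A → 0 < d → 0 < H → 0 < B → 0 < δ → δ ≤ 1 →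
        queryComplexityLA (classV B d H A) δ ≤
          ENNReal.ofReal (MvPolynomial.eval ![((d : ℝ) * H / δ) ^ A, B] p) ∧
        queryComplexityLA (classQ B d H A ∩ classPdet A H (QFeat A d)) δ ≤
          ENNReal.ofReal (MvPolynomial.eval ![((d : ℝ) * H / δ) ^ A, B] p) ∧
        queryComplexityLA (classReach B d H A) δ ≤
          ENNReal.ofReal (MvPolynomial.eval ![((d : ℝ) * H / δ) ^ A, B] p)) := by
  refine ⟨fun A hA => ?_, exists_polynomial⟩
  have : NeZero A := ⟨hA.ne'⟩
  exact exists_polynomial_of_actions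

end
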